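/- **Conventions.** All tensor products of $C^*$-algebras are minimal, $M(B)$ is the multiplier algebra of $B$, and $[F]$ is the closed linear span of $F$. A $*$-homomorphism $\varphi\colon A\to M(B)$ is *nondegenerate* if $[\varphi(A)B]=B$, and *strict* if it is strictly continuous on the unit ball of $A$; in that case it extends uniquely to a $*$-homomorphism $M(A)\to M(B)$ that is strictly continuous on the unit ball, again denoted by $\varphi$ (so $\varphi(1_A)\in M(B)$ is a projection). For $C^*$-algebras $A\subseteq D$ and $B\subseteq E$ we regard $A\otimes B$ as a $C^*$-subalgebra of $D\otimes E$, and $M(B)\otimes A$ as a $C^*$-subalgebra of $M(B\otimes A)$. A *$C^*$-bialgebra* is a $C^*$-algebra $A$ with a nondegenerate $*$-homomorphism $\Delta\colon A\to M(A\otimes A)$ satisfying $(\Delta\otimes\mathrm{id}_A)\Delta=(\mathrm{id}_A\otimes\Delta)\Delta$. A *partial coaction* of $(A,\Delta)$ on a $C^*$-algebra $C$ is a strict $*$-homomorphism $\delta_C\colon C\to M(C\otimes A)$ such that $\delta_C(C)(1_C\otimes A)\subseteq C\otimes A$ and $$(\delta_C\otimes\mathrm{id}_A)\delta_C(c)=(\delta_C(1_C)\otimes1_A)(\mathrm{id}_C\otimes\Delta)\delta_C(c)\qquad(c\in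 C).$$ It is *regular* if $(\mathrm{id}_C\otimes\Delta)(\delta_C(C))(1_C\otimes1_A\otimes A)\subseteq M(C\otimes A)\otimes A$. A *coaction* of $(A,\Delta)$ on a $C^*$-algebra $B$ is a $*$-homomorphism $\delta_B\colon B\to M(B\otimes A)$ (not required to be strict or nondegenerate) such that $\delta_B(B)(1_B\otimes A)\subseteq B\otimes A$ and which is coassociative, that is, $(\delta_B\otimes\mathrm{id}_A)(\delta_B(b)(1_B\otimes a))=(\mathrm{id}_B\otimes\Delta)(\delta_B(b))(1_B\otimes1_A\otimes a)$ for all $b\in B$, $a\in A$. A *dilation* of a partial coaction $\delta_C$ is a triple $(B,\delta_B,\iota)$ of a $C^*$-algebra $B$, a coaction $\delta_B$ of $(A,\Delta)$ on $B$ and an injective $*$-homomorphism $\iota\colon C\to B$ such that $$\delta_B(\iota(c))(\iota(c')\otimes a)=(\iota\otimes\mathrm{id}_A)(\delta_C(c)(c'\otimes a))\qquad(c,c'\in C,\ a\in A).$$ The $C^*$-algebra $A$ has the *slice map property* if for every $C^*$-algebra $B$ and every $C^*$-subalgebra $D\subseteq B$, every $x\in B\otimes A$ with $(\mathrm{id}\otimes\omega)(x)\in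 D$ for all $\omega\in A^*$ lies in $D\otimes A$. **Proposition 7.6.** Let $\delta_C$ be an injective, regular partial coaction of a $C^*$-bialgebra $(A,\Delta)$ on a $C^*$-algebra $C$, and suppose that $A$ has the slice map property. Denote by $C\boxtimes A\subseteq M(C\otimes A)$ the set of all $x$ such that 1. $[x,\delta_C(1_C)]=0$; 2. $(\delta_C\otimes\mathrm{id}_A)(x)=(\delta_C(1_C)\otimes1_A)(\mathrm{id}_C\otimes\Delta)(x)=(\mathrm{id}_C\otimes\Delta)(x)(\delta_C(1_C)\otimes1_A)$; 3. $x(1_C\otimes A)$ and $(1_C\otimes A)x$ are contained in $C\otimes A$; 4. $(\mathrm{id}_C\otimes\Delta)(x)(1_C\otimes1_A\otimes A)$ and $(1_C\otimes1_A\otimes A)(\mathrm{id}_C\otimes\Delta)(x)$ are contained in $M(C\otimes A)\otimes A$. Then $C\boxtimes A$ is a $C^*$-subalgebra of $M(C\otimes A)$. The map $\mathrm{id}_C\otimes\Delta$ restricts to a coaction of $(A,\Delta)$ on $C\boxtimes A$; that is, there is a coaction $\delta$ of $(A,\Delta)$ on $C\boxtimes A$ such that for all $x\in C\boxtimes A$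 and $a\in A$, the element $\delta(x)(1\otimes a)$ of $(C\boxtimes A)\otimes A$ equals $(\mathrm{id}_C\otimes\Delta)(x)(1_C\otimes1_A\otimes a)$. Moreover $\delta_C(C)\subseteq C\boxtimes A$, and $(C\boxtimes A,\delta,\delta_C)$ is a dilation of $\delta_C$. -/

import Mathlib

open scoped TensorProduct MultiplierAlgebra
open Filter Topology

universe u

section CStarCompletion

open UniformSpace UniformSpace.Completion

variable (R : Type*) [NonUnitalSeminormedRing R]

/-- The product on the completion of a seminormed ring, extended by continuity. -/
@[reducible]
noncomputable def complMul : Mul (Completion R) where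
  mul := Function.curry <| (isDenseInducing_coe.prodMap isDenseInducing_coe).extend
    ((↑) ∘ Function.uncurry ((· * ·) : R → R → R))

/-- The involution on the completion, extended by continuity. -/
@[reducible]
noncomputable def complStar [Star R] : Star (Completion R) where
  star := Completion.map (star : R → R)

attribute [local instance] complMul complStar

theorem compl_coe_mul (a b : R) : ((a * b : R) : Completion R) = a * b :=
  ((isDenseInducing_coe.prodMap isDenseInducing_coe).extend_eq
      ((continuous_coe R).comp (@continuous_mul R _ _ _)) (a, b)).symm

theorem compl_continuousMul : ContinuousMul (Completion R) where
  continuous_mul := by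
    let m := (AddMonoidHom.mul : R →+ R →+ R).compr₂ toCompl
    have : Continuous fun p : R × R => m p.1 p.2 := (continuous_coe R).comp continuous_mul
    have di : IsDenseInducing (toCompl : R → Completion R) := isDenseInducing_coe
    exact (di.extend_Z_bilin di this :)

attribute [local instance] compl_continuousMul

theorem compl_coe_star [StarRing R] [NormedStarGroup R] (a : R) :
    ((star a : R) : Completion R) = star (a : Completion R) :=
  (map_coe (Isometry.of_dist_eq (f := (star : R → R)) fun x y => by
    rw [dist_eq_norm, dist_eq_norm, ← star_sub, norm_star]).uniformContinuous a).symm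

theorem compl_continuousStar [StarRing R] : ContinuousStar (Completion R) where
  continuous_star := continuous_map

attribute [local instance] compl_continuousStar

/-- The completion of a seminormed ring as a normed ring. -/
@[reducible]
noncomputable def complRing : NonUnitalNormedRing (Completion R) where
  __ := (inferInstance : NormedAddCommGroup (Completion R))
  __ := complMul R
  dist_eq := dist_eq_norm_neg_add
  zero_mul a := Completion.induction_on a (isClosed_eq (by fun_prop) continuous_const)
    fun a => by rw [← coe_zero, ← compl_coe_mul, zero_mul]
  mul_zero a := Completion.induction_on a (isClosed_eq (by fun_prop) continuous_const)
    fun a => by rw [← coe_zero, ← compl_coe_mul, mul_zero]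
  mul_assoc a b c := Completion.induction_on₃ a b c (isClosed_eq (by fun_prop) (by fun_prop))
    fun a b c => by simp only [← compl_coe_mul, mul_assoc]
  left_distrib a b c := Completion.induction_on₃ a b c (isClosed_eq (by fun_prop) (by fun_prop))
    fun a b c => by simp only [← coe_add, ← compl_coe_mul, mul_add]
  right_distrib a b c := Completion.induction_on₃ a b c (isClosed_eq (by fun_prop) (by fun_prop))
    fun a b c => by simp only [← coe_add, ← compl_coe_mul, add_mul]
  norm_mul_le a b := Completion.induction_on₂ a b (isClosed_le (by fun_prop) (by fun_prop))
    fun a b => by simp only [← compl_coe_mul, norm_coe]; exact norm_mul_le a b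

attribute [local instance] complRing

/-- The completion of a seminormed ⋆-ring as a ⋆-ring. -/
@[reducible]
noncomputable def complStarRing [StarRing R] [NormedStarGroup R] : StarRing (Completion R) where
  __ := complStar R
  star_involutive a := Completion.induction_on a (isClosed_eq (by fun_prop) continuous_id)
    fun a => by simp only [← compl_coe_star, star_star]
  star_mul a b := Completion.induction_on₂ a b (isClosed_eq (by fun_prop) (by fun_prop))
    fun a b => by simp only [← compl_coe_star, ← compl_coe_mul, star_mul]
  star_add a b := Completion.induction_on₂ a b (isClosed_eq (by fun_prop) (by fun_prop))
    fun a b => by simp only [← compl_coe_star, ← coe_add, star_add]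

attribute [local instance] complStarRing

theorem compl_cstarRing [StarRing R] [NormedStarGroup R] (h : ∀ x : R, ‖x‖ * ‖x‖ ≤ ‖star x * x‖) : CStarRing (Completion R) where
  norm_mul_self_le a := by
    refine Completion.induction_on a (isClosed_le ?_ ?_) fun a => ?_
    · exact continuous_norm.mul continuous_norm
    · exact continuous_norm.comp (continuous_star.mul continuous_id)
    · rw [← compl_coe_star, ← compl_coe_mul, norm_coe, norm_coe]; exact h a

variable [NormedSpace ℂ R]

theorem compl_isScalarTower [IsScalarTower ℂ R R] :
    IsScalarTower ℂ (Completion R) (Completion R) where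
  smul_assoc c a b := by
    refine Completion.induction_on₂ a b (isClosed_eq ?_ ?_) fun a b => ?_
    · exact (continuous_fst.const_smul c).mul continuous_snd
    · exact (continuous_fst.mul continuous_snd).const_smul c
    · simp only [smul_eq_mul]
      rw [← Completion.coe_smul, ← compl_coe_mul, ← compl_coe_mul, ← Completion.coe_smul,
        smul_mul_assoc]

theorem compl_smulCommClass [SMulCommClass ℂ R R] :
    SMulCommClass ℂ (Completion R) (Completion R) where
  smul_comm c a b := by
    refine Completion.induction_on₂ a b (isClosed_eq ?_ ?_) fun a b => ?_
    · exact (continuous_fst.mul continuous_snd).const_smul c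
    · exact continuous_fst.mul (continuous_snd.const_smul c)
    · simp only [smul_eq_mul]
      rw [← Completion.coe_smul, ← compl_coe_mul, ← compl_coe_mul, ← Completion.coe_smul,
        mul_smul_comm]

variable [StarRing R] [NormedStarGroup R]

theorem compl_starModule [StarModule ℂ R] : StarModule ℂ (Completion R) where
  star_smul c a := by
    refine Completion.induction_on a (isClosed_eq ?_ ?_) fun a => ?_
    · exact Continuous.star (f := fun a : Completion R => c • a) (continuous_const_smul c)
    · exact Continuous.const_smul (M := ℂ) (g := fun a : Completion R => star a) continuous_star _
    · rw [← Completion.coe_smul, ← compl_coe_star, ← compl_coe_star, ← Completion.coe_smul,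
        star_smul]

/-- The completion (after separation) of a complex ⋆-algebra with a C⋆-seminorm. -/
@[reducible]
noncomputable def complCStar [IsScalarTower ℂ R R] [SMulCommClass ℂ R R] [StarModule ℂ R]
    (h : ∀ x : R, ‖x‖ * ‖x‖ ≤ ‖star x * x‖) : NonUnitalCStarAlgebra (Completion R) :=
  have := compl_cstarRing R h
  have := compl_isScalarTower R
  have := compl_smulCommClass R
  have := compl_starModule R
  { complRing R, complStarRing R, (inferInstance : NormedSpace ℂ (Completion R)) with
    complete := CompleteSpace.complete
    norm_mul_self_le := CStarRing.norm_mul_self_le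
    smul_assoc := smul_assoc
    smul_comm := smul_comm
    star_smul := star_smul }

end CStarCompletion

/-- The seminormed ring determined by a submultiplicative seminorm on a ring. -/
@[reducible]
noncomputable def seminormedRingOf (R : Type*) [NonUnitalRing R] (N : R → ℝ) (h0 : N 0 = 0)
    (hneg : ∀ x, N (-x) = N x) (hadd : ∀ x y, N (x + y) ≤ N x + N y)
    (hmul : ∀ x y, N (x * y) ≤ N x * N y) : NonUnitalSeminormedRing R where
  __ := (inferInstance : NonUnitalRing R)
  norm := N
  dist x y := N (-x + y)
  dist_self x := by simp [h0]
  dist_comm x y := by rw [← hneg (-x + y)]; congr 1; abel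
  dist_triangle x y z := by
    have := hadd (-x + y) (-y + z)
    rwa [show -x + y + (-y + z) = -x + z by abel] at this
  dist_eq _ _ := rfl
  norm_mul_le := hmul

section MinTensor

theorem opNorm_mul_self_le {E : Type*} [NormedAddCommGroup E] [InnerProductSpace ℂ E]
    (S T : E →L[ℂ] E) (h : ∀ ξ η, inner ℂ (S ξ) η = inner ℂ ξ (T η)) : ‖T‖ * ‖T‖ ≤ ‖S * T‖ := by
  have h0 : ‖T‖ ≤ √ ‖S * T‖ := by
    refine ContinuousLinearMap.opNorm_le_bound _ (Real.sqrt_nonneg _) fun ξ => ?_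
    have hs : √ ‖S * T‖ * ‖ξ‖ = √ (‖S * T‖ * ‖ξ‖ ^ 2) := by
      rw [Real.sqrt_mul' _ (sq_nonneg ‖ξ‖), Real.sqrt_sq (norm_nonneg ξ)]
    rw [hs]
    refine Real.le_sqrt_of_sq_le ?_
    have h1 : ‖T ξ‖ ^ 2 = ‖inner ℂ ((S * T) ξ) ξ‖ := by
      change _ = ‖inner ℂ (S (T ξ)) ξ‖
      rw [h, inner_self_eq_norm_sq_to_K]
      simp
    rw [h1]
    calc _ ≤ ‖(S * T) ξ‖ * ‖ξ‖ := norm_inner_le_norm _ _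
      _ ≤ (‖S * T‖ * ‖ξ‖) * ‖ξ‖ := by gcongr; exact ContinuousLinearMap.le_opNorm _ _
      _ = _ := by ring
  calc _ ≤ √ ‖S * T‖ * √ ‖S * T‖ := by gcongr
    _ = _ := Real.mul_self_sqrt (norm_nonneg _)

theorem opNorm_le_of_adjoint {E : Type*} [NormedAddCommGroup E] [InnerProductSpace ℂ E]
    (S T : E →L[ℂ] E) (h : ∀ ξ η, inner ℂ (S ξ) η = inner ℂ ξ (T η)) : ‖S‖ ≤ ‖T‖ := by
  refine ContinuousLinearMap.opNorm_le_bound _ (norm_nonneg _) fun ξ => ?_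
  by_cases h0 : ‖S ξ‖ = 0
  · rw [h0]; positivity
  have h1 : ‖S ξ‖ ^ 2 = ‖inner ℂ ξ (T (S ξ))‖ := by
    rw [← h, inner_self_eq_norm_sq_to_K]
    simp
  have h2 : ‖S ξ‖ ^ 2 ≤ ‖ξ‖ * (‖T‖ * ‖S ξ‖) := by
    rw [h1]
    refine (norm_inner_le_norm _ _).trans ?_
    gcongr
    exact ContinuousLinearMap.le_opNorm _ _
  have h3 : 0 < ‖S ξ‖ := lt_of_le_of_ne (norm_nonneg _) (Ne.symm h0)
  nlinarith

theorem opNorm_smul' {E : Type*} [NormedAddCommGroup E] [InnerProductSpace ℂ E]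
    (c : ℂ) (T : E →L[ℂ] E) : ‖c • T‖ = ‖c‖ * ‖T‖ := norm_smul c T

/-- A ⋆-representation of a C⋆-algebra on a Hilbert space. -/
structure HilbertRep (A : Type u) [NonUnitalCStarAlgebra A] where
  H : Type u
  [instNormedAddCommGroup : NormedAddCommGroup H]
  [instInnerProductSpace : InnerProductSpace ℂ H]
  [instCompleteSpace : CompleteSpace H]
  π : A →⋆ₙₐ[ℂ] (H →L[ℂ] H)

attribute [instance] HilbertRep.instNormedAddCommGroup HilbertRep.instInnerProductSpace
  HilbertRep.instCompleteSpace

variable {A B : Type u} [NonUnitalCStarAlgebra A] [NonUnitalCStarAlgebra B]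

/-- The operator `(π ⊗ ρ)(x)`, acting on the algebraic tensor product of the two Hilbert spaces
with its canonical inner product.  (Its norm is that of its extension to the completion.) -/
noncomputable def HilbertRep.tensor (π : HilbertRep A) (ρ : HilbertRep B) :
    A ⊗[ℂ] B →ₗ[ℂ] (π.H ⊗[ℂ] ρ.H →L[ℂ] π.H ⊗[ℂ] ρ.H) :=
  TensorProduct.lift <| LinearMap.mk₂ ℂ (fun a b => TensorProduct.mapL (π.π a) (ρ.π b))
    (fun _ _ _ => by rw [map_add, TensorProduct.mapL_add_left])
    (fun _ _ _ => by rw [map_smul, TensorProduct.mapL_smul_left])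
    (fun _ _ _ => by rw [map_add, TensorProduct.mapL_add_right])
    (fun _ _ _ => by rw [map_smul, TensorProduct.mapL_smul_right])

namespace HilbertRep

variable (π : HilbertRep A) (ρ : HilbertRep B)

@[simp]
theorem tensor_tmul (a : A) (b : B) :
    tensor π ρ (a ⊗ₜ b) = TensorProduct.mapL (π.π a) (ρ.π b) := by simp [tensor]

theorem tensor_mul (x y : A ⊗[ℂ] B) : tensor π ρ (x * y) = tensor π ρ x * tensor π ρ y := by
  induction x with
  | zero => simp
  | add x₁ x₂ h₁ h₂ => rw [add_mul, map_add, h₁, h₂, map_add, add_mul]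
  | tmul a b =>
    induction y with
    | zero => simp
    | add y₁ y₂ h₁ h₂ => rw [mul_add, map_add, h₁, h₂, map_add, mul_add]
    | tmul c d =>
      simp only [Algebra.TensorProduct.tmul_mul_tmul, tensor_tmul, map_mul,
        TensorProduct.mapL_mul]

theorem tensor_star (x : A ⊗[ℂ] B) (ξ η : π.H ⊗[ℂ] ρ.H) :
    inner ℂ (tensor π ρ (star x) ξ) η = inner ℂ ξ (tensor π ρ x η) := by
  induction x with
  | zero => simp
  | add x₁ x₂ h₁ h₂ =>
    simp only [star_add, map_add, add_apply, inner_add_left, inner_add_right,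
      h₁, h₂]
  | tmul a b =>
    induction ξ with
    | zero => simp
    | add ξ₁ ξ₂ h₁ h₂ => simp only [map_add, inner_add_left, h₁, h₂]
    | tmul p q =>
      induction η with
      | zero => simp
      | add ξ₁ ξ₂ h₁ h₂ => simp only [map_add, inner_add_right, h₁, h₂]
      | tmul r s =>
        simp [TensorProduct.star_tmul, map_star, ContinuousLinearMap.star_eq_adjoint,
          ContinuousLinearMap.adjoint_inner_left]

theorem norm_tensor_star_mul (x : A ⊗[ℂ] B) :
    ‖tensor π ρ x‖ * ‖tensor π ρ x‖ ≤ ‖tensor π ρ (star x * x)‖ := by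
  rw [tensor_mul]
  exact opNorm_mul_self_le (tensor π ρ (star x)) (tensor π ρ x) (tensor_star π ρ x)

theorem norm_tensor_star (x : A ⊗[ℂ] B) : ‖tensor π ρ (star x)‖ ≤ ‖tensor π ρ x‖ :=
  opNorm_le_of_adjoint (tensor π ρ (star x)) (tensor π ρ x) (tensor_star π ρ x)

end HilbertRep

/-- The minimal (spatial) C⋆-seminorm on the algebraic tensor product: the supremum of
`‖(π ⊗ ρ)(x)‖` over all pairs of ⋆-representations on Hilbert spaces. -/
noncomputable def minTensorNorm (x : A ⊗[ℂ] B) : ℝ :=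
  ⨆ p : HilbertRep A × HilbertRep B, ‖p.1.tensor p.2 x‖

theorem minTensorNorm_bdd (x : A ⊗[ℂ] B) :
    ∃ M, ∀ p : HilbertRep A × HilbertRep B, ‖p.1.tensor p.2 x‖ ≤ M := by
  induction x with
  | zero => exact ⟨0, fun p => by rw [map_zero]; exact ContinuousLinearMap.opNorm_zero.le⟩
  | add x y hx hy =>
    obtain ⟨M, hM⟩ := hx
    obtain ⟨N, hN⟩ := hy
    exact ⟨M + N, fun p => by
      rw [map_add]; exact (ContinuousLinearMap.opNorm_add_le _ _).trans (add_le_add (hM p) (hN p))⟩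
  | tmul a b =>
    refine ⟨‖a‖ * ‖b‖, fun p => ?_⟩
    rw [HilbertRep.tensor_tmul]
    refine (TensorProduct.norm_mapL_le _ _).trans ?_
    gcongr
    · exact NonUnitalStarAlgHom.norm_apply_le _ _
    · exact NonUnitalStarAlgHom.norm_apply_le _ _

theorem norm_tensor_le_minTensorNorm (π : HilbertRep A) (ρ : HilbertRep B) (x : A ⊗[ℂ] B) :
    ‖π.tensor ρ x‖ ≤ minTensorNorm x := by
  obtain ⟨M, hM⟩ := minTensorNorm_bdd x
  exact le_ciSup (f := fun p : HilbertRep A × HilbertRep B => ‖p.1.tensor p.2 x‖)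
    ⟨M, by rintro _ ⟨p, rfl⟩; exact hM p⟩ (π, ρ)

theorem minTensorNorm_nonneg (x : A ⊗[ℂ] B) : 0 ≤ minTensorNorm x :=
  Real.iSup_nonneg fun _ => ContinuousLinearMap.opNorm_nonneg _

theorem minTensorNorm_le {x : A ⊗[ℂ] B} {M : ℝ} (hM : 0 ≤ M)
    (h : ∀ (π : HilbertRep A) (ρ : HilbertRep B), ‖π.tensor ρ x‖ ≤ M) : minTensorNorm x ≤ M :=
  Real.iSup_le (fun p => h p.1 p.2) hM

variable (A B) in
/-- The algebraic tensor product of two C⋆-algebras, equipped with the minimal C⋆-seminorm. -/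
def AlgMinTensor (A B : Type u) [NonUnitalCStarAlgebra A] [NonUnitalCStarAlgebra B] : Type u :=
  A ⊗[ℂ] B

namespace AlgMinTensor

noncomputable instance : NonUnitalRing (AlgMinTensor A B) :=
  inferInstanceAs (NonUnitalRing (A ⊗[ℂ] B))
noncomputable instance : Module ℂ (AlgMinTensor A B) := inferInstanceAs (Module ℂ (A ⊗[ℂ] B))
/-- The minimal C⋆-seminorm. -/
noncomputable def seminorm : Seminorm ℂ (A ⊗[ℂ] B) :=
  Seminorm.of minTensorNorm
    (fun x y => minTensorNorm_le (add_nonneg (minTensorNorm_nonneg _) (minTensorNorm_nonneg _))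
      fun π ρ => by
        rw [map_add]
        exact (ContinuousLinearMap.opNorm_add_le _ _).trans (add_le_add (norm_tensor_le_minTensorNorm _ _ _)
          (norm_tensor_le_minTensorNorm _ _ _)))
    (fun c x => by
      unfold minTensorNorm
      rw [Real.mul_iSup_of_nonneg (norm_nonneg _)]
      refine congrArg _ (funext fun p => ?_)
      rw [map_smul]
      exact opNorm_smul' c (p.1.tensor p.2 x))

noncomputable instance : NonUnitalSeminormedRing (AlgMinTensor A B) :=
  seminormedRingOf (AlgMinTensor A B) (seminorm (A := A) (B := B)) (map_zero _)
    (map_neg_eq_map _) (map_add_le_add _)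
    fun x y => minTensorNorm_le (mul_nonneg (minTensorNorm_nonneg _) (minTensorNorm_nonneg _))
      fun π ρ => by
        refine (congrArg norm (HilbertRep.tensor_mul π ρ (A := A) (B := B) x y)).le.trans ?_
        refine (ContinuousLinearMap.opNorm_comp_le _ _).trans ?_
        exact mul_le_mul (norm_tensor_le_minTensorNorm _ _ _) (norm_tensor_le_minTensorNorm _ _ _)
          (ContinuousLinearMap.opNorm_nonneg _) (minTensorNorm_nonneg _)

theorem norm_def (x : AlgMinTensor A B) : ‖x‖ = minTensorNorm (A := A) (B := B) x := rfl

noncomputable instance : NormedSpace ℂ (AlgMinTensor A B) where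
  __ := (inferInstance : Module ℂ (AlgMinTensor A B))
  norm_smul_le c x := (map_smul_eq_mul (seminorm (A := A) (B := B)) c x).le

noncomputable instance : StarRing (AlgMinTensor A B) := inferInstanceAs (StarRing (A ⊗[ℂ] B))
instance : StarModule ℂ (AlgMinTensor A B) := inferInstanceAs (StarModule ℂ (A ⊗[ℂ] B))
instance : IsScalarTower ℂ (AlgMinTensor A B) (AlgMinTensor A B) :=
  inferInstanceAs (IsScalarTower ℂ (A ⊗[ℂ] B) (A ⊗[ℂ] B))
instance : SMulCommClass ℂ (AlgMinTensor A B) (AlgMinTensor A B) :=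
  inferInstanceAs (SMulCommClass ℂ (A ⊗[ℂ] B) (A ⊗[ℂ] B))

instance : NormedStarGroup (AlgMinTensor A B) where
  norm_star_le x := minTensorNorm_le (minTensorNorm_nonneg _) fun π ρ =>
    (HilbertRep.norm_tensor_star π ρ _).trans (norm_tensor_le_minTensorNorm _ _ _)

theorem norm_mul_self_le (x : AlgMinTensor A B) : ‖x‖ * ‖x‖ ≤ ‖star x * x‖ := by
  have h : ‖x‖ ≤ √ ‖star x * x‖ := minTensorNorm_le (Real.sqrt_nonneg _) fun π ρ =>
    Real.le_sqrt_of_sq_le <| by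
      rw [sq]
      exact (HilbertRep.norm_tensor_star_mul π ρ _).trans (norm_tensor_le_minTensorNorm _ _ _)
  calc _ ≤ √ ‖star x * x‖ * √ ‖star x * x‖ := by gcongr
    _ = _ := Real.mul_self_sqrt (norm_nonneg _)

end AlgMinTensor

/-- The minimal tensor product of two C⋆-algebras. -/
def MinTensor (A B : Type u) [NonUnitalCStarAlgebra A] [NonUnitalCStarAlgebra B] : Type u :=
  UniformSpace.Completion (AlgMinTensor A B)

noncomputable instance : NonUnitalCStarAlgebra (MinTensor A B) :=
  complCStar (AlgMinTensor A B) AlgMinTensor.norm_mul_self_le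

namespace MinTensor

/-- The canonical map from the algebraic to the minimal tensor product. -/
noncomputable def of : A ⊗[ℂ] B →ₗ[ℂ] MinTensor A B where
  toFun x := ((show AlgMinTensor A B from x : AlgMinTensor A B) :
    UniformSpace.Completion (AlgMinTensor A B))
  map_add' := UniformSpace.Completion.coe_add (α := AlgMinTensor A B)
  map_smul' c := UniformSpace.Completion.coe_smul (X := AlgMinTensor A B) c

theorem norm_of (x : A ⊗[ℂ] B) : ‖of x‖ = minTensorNorm x :=
  UniformSpace.Completion.norm_coe (E := AlgMinTensor A B) x

theorem denseRange_of : DenseRange (of : A ⊗[ℂ] B → MinTensor A B) :=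
  UniformSpace.Completion.denseRange_coe (α := AlgMinTensor A B)

theorem of_mul (x y : A ⊗[ℂ] B) : of (x * y) = of x * of y :=
  compl_coe_mul (AlgMinTensor A B) x y

theorem of_star (x : A ⊗[ℂ] B) : of (star x) = star (of x) :=
  compl_coe_star (AlgMinTensor A B) x

/-- The elementary tensor `a ⊗ b`. -/
noncomputable def tmul (a : A) (b : B) : MinTensor A B := of (a ⊗ₜ b)


theorem induction_on {p : MinTensor A B → Prop} (x : MinTensor A B) (hc : IsClosed {x | p x})
    (h : ∀ y : A ⊗[ℂ] B, p (of y)) : p x :=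
  denseRange_of.induction_on x hc h

theorem continuous_extend {D : Type*} [NormedAddCommGroup D] [NormedSpace ℂ D] [CompleteSpace D]
    (f : A ⊗[ℂ] B →ₗ[ℂ] D) (h : ∀ x, ‖f x‖ ≤ minTensorNorm x) :
    ∃ g : MinTensor A B →L[ℂ] D, ∀ x, g (of x) = f x := by
  have h' : ∀ x, ‖f x‖ ≤ 1 * ‖(of : A ⊗[ℂ] B →ₗ[ℂ] MinTensor A B) x‖ := fun x => by
    rw [one_mul, norm_of]; exact h x
  exact ⟨LinearMap.extendOfNorm f of, fun x =>
    LinearMap.extendOfNorm_eq denseRange_of ⟨1, h'⟩ x⟩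

/-- The extension to the minimal tensor product of a ⋆-homomorphism on the algebraic tensor
product that is bounded with respect to the minimal norm. -/
noncomputable def lift {D : Type*} [NonUnitalCStarAlgebra D] (f : A ⊗[ℂ] B →ₗ[ℂ] D)
    (hmul : ∀ x y, f (x * y) = f x * f y) (hstar : ∀ x, f (star x) = star (f x))
    (h : ∀ x, ‖f x‖ ≤ minTensorNorm x) : MinTensor A B →⋆ₙₐ[ℂ] D :=
  let g := (continuous_extend f h).choose
  have hg : ∀ x, g (of x) = f x := (continuous_extend f h).choose_spec
  { g with
    map_zero' := g.map_zero
    map_mul' := fun x y => by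
      refine induction_on x (isClosed_eq (f := fun x => g (x * y)) (g := fun x => g x * g y)
        (by fun_prop) (by fun_prop)) fun x => ?_
      refine induction_on y (isClosed_eq (f := fun y => g (of x * y))
        (g := fun y => g (of x) * g y) (by fun_prop) (by fun_prop)) fun y => ?_
      rw [← of_mul, hg, hg, hg, hmul]
    map_star' := fun x => by
      refine induction_on x (isClosed_eq (f := fun x => g (star x)) (g := fun x => star (g x))
        (by fun_prop) (by fun_prop)) fun x => ?_
      rw [← of_star, hg, hg, hstar] }

theorem lift_of {D : Type*} [NonUnitalCStarAlgebra D] (f : A ⊗[ℂ] B →ₗ[ℂ] D)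
    (hmul : ∀ x y, f (x * y) = f x * f y) (hstar : ∀ x, f (star x) = star (f x))
    (h : ∀ x, ‖f x‖ ≤ minTensorNorm x) (x : A ⊗[ℂ] B) : lift f hmul hstar h (of x) = f x :=
  (continuous_extend f h).choose_spec x

variable {A' B' : Type u} [NonUnitalCStarAlgebra A'] [NonUnitalCStarAlgebra B']

/-- The ⋆-homomorphism `f ⊗ g` between minimal tensor products. -/
noncomputable def map (f : A →⋆ₙₐ[ℂ] A') (g : B →⋆ₙₐ[ℂ] B') :
    MinTensor A B →⋆ₙₐ[ℂ] MinTensor A' B' :=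
  lift (of ∘ₗ TensorProduct.map (f : A →ₗ[ℂ] A') (g : B →ₗ[ℂ] B'))
    (fun x y => by
      simp only [LinearMap.comp_apply, ← of_mul]
      congr 1
      induction x with
      | zero => simp
      | add x₁ x₂ h₁ h₂ => rw [add_mul, map_add, h₁, h₂, map_add, add_mul]
      | tmul a b =>
        induction y with
        | zero => simp
        | add y₁ y₂ h₁ h₂ => rw [mul_add, map_add, h₁, h₂, map_add, mul_add]
        | tmul c d => simp)
    (fun x => by
      simp only [LinearMap.comp_apply, ← of_star]
      congr 1
      induction x with
      | zero => simp
      | add x₁ x₂ h₁ h₂ => simp only [star_add, map_add, h₁, h₂]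
      | tmul a b => simp [TensorProduct.star_tmul, map_star])
    (fun x => by
      rw [LinearMap.comp_apply, norm_of]
      refine minTensorNorm_le (minTensorNorm_nonneg _) fun π ρ => ?_
      have : π.tensor ρ (TensorProduct.map (f : A →ₗ[ℂ] A') (g : B →ₗ[ℂ] B') x) =
          HilbertRep.tensor ⟨π.H, π.π.comp f⟩ ⟨ρ.H, ρ.π.comp g⟩ x := by
        induction x with
        | zero => simp only [map_zero]
        | add x₁ x₂ h₁ h₂ => simp only [map_add, h₁, h₂]
        | tmul a b => simp only [TensorProduct.map_tmul, HilbertRep.tensor_tmul]; rfl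
      rw [this]
      exact norm_tensor_le_minTensorNorm _ _ x)

theorem map_tmul (f : A →⋆ₙₐ[ℂ] A') (g : B →⋆ₙₐ[ℂ] B') (a : A) (b : B) :
    map f g (tmul a b) = tmul (f a) (g b) := by
  rw [map, tmul, lift_of, LinearMap.comp_apply, TensorProduct.map_tmul]
  rfl

end MinTensor

end MinTensor

section Multiplier

open MinTensor

variable {A B C D : Type u} [NonUnitalCStarAlgebra A] [NonUnitalCStarAlgebra B]
  [NonUnitalCStarAlgebra C] [NonUnitalCStarAlgebra D]

/-- The canonical embedding of a C⋆-algebra into its multiplier algebra. -/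
noncomputable abbrev toMul (A : Type u) [NonUnitalCStarAlgebra A] : A →⋆ₙₐ[ℂ] 𝓜(ℂ, A) :=
  DoubleCentralizer.coeHom

/-- The canonical ⋆-homomorphism `M(A) ⊗ M(B) → M(A ⊗ B)`: the unique one satisfying
`(m ⊗ n)(a ⊗ b) = ma ⊗ nb`. -/
noncomputable def mulTensor (A B : Type u) [NonUnitalCStarAlgebra A] [NonUnitalCStarAlgebra B] :
    MinTensor 𝓜(ℂ, A) 𝓜(ℂ, B) →⋆ₙₐ[ℂ] 𝓜(ℂ, MinTensor A B) :=
  Classical.epsilon fun κ => ∀ (m : 𝓜(ℂ, A)) (n : 𝓜(ℂ, B)) (a : A) (b : B),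
    (κ (tmul m n)).fst (tmul a b) = tmul (m.fst a) (n.fst b)

/-- The ⋆-homomorphism `φ ⊗ ψ : A ⊗ B → M(C ⊗ D)` for `φ : A → M(C)` and `ψ : B → M(D)`. -/
noncomputable def homTensor (φ : A →⋆ₙₐ[ℂ] 𝓜(ℂ, C)) (ψ : B →⋆ₙₐ[ℂ] 𝓜(ℂ, D)) :
    MinTensor A B →⋆ₙₐ[ℂ] 𝓜(ℂ, MinTensor C D) :=
  (mulTensor C D).comp (MinTensor.map φ ψ)

/-- The multiplier `m ⊗ n` of `A ⊗ B` for multipliers `m` of `A` and `n` of `B`. -/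
noncomputable def mulTmul (m : 𝓜(ℂ, A)) (n : 𝓜(ℂ, B)) : 𝓜(ℂ, MinTensor A B) :=
  mulTensor A B (tmul m n)

/-- The strict topology on the multiplier algebra: the initial topology for the maps `m ↦ mb` and
`m ↦ bm` into `B` (with its norm topology), where `b` ranges over `B`. -/
@[reducible]
noncomputable def strictTopology (B : Type u) [NonUnitalCStarAlgebra B] : TopologicalSpace 𝓜(ℂ, B) :=
  .induced (fun m (b : B) => (m.fst b, m.snd b)) inferInstance

/-- A ⋆-homomorphism `A → M(B)` is strict if it is strictly continuous on the unit ball. -/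
def IsStrict (φ : A →⋆ₙₐ[ℂ] 𝓜(ℂ, B)) : Prop :=
  @ContinuousOn _ _ ((strictTopology A).induced (toMul A)) (strictTopology B) φ
    (Metric.closedBall 0 1)

/-- The canonical extension `M(A) → M(B)` of a strict ⋆-homomorphism `A → M(B)`: the unique
⋆-homomorphism that extends it and is strictly continuous on the unit ball. -/
noncomputable def strictExt (φ : A →⋆ₙₐ[ℂ] 𝓜(ℂ, B)) : 𝓜(ℂ, A) →⋆ₙₐ[ℂ] 𝓜(ℂ, B) :=
  Classical.epsilon fun Φ => (∀ a, Φ (toMul A a) = φ a) ∧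
    @ContinuousOn _ _ (strictTopology A) (strictTopology B) Φ (Metric.closedBall 0 1)

/-- The canonical isomorphism `A ⊗ (B ⊗ C) → (A ⊗ B) ⊗ C` (as a ⋆-homomorphism): the unique one
satisfying `a ⊗ (b ⊗ c) ↦ (a ⊗ b) ⊗ c`. -/
noncomputable def tensorAssoc (A B C : Type u) [NonUnitalCStarAlgebra A] [NonUnitalCStarAlgebra B]
    [NonUnitalCStarAlgebra C] :
    MinTensor A (MinTensor B C) →⋆ₙₐ[ℂ] MinTensor (MinTensor A B) C :=
  Classical.epsilon fun α => ∀ (a : A) (b : B) (c : C),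
    α (tmul a (tmul b c)) = tmul (tmul a b) c

/-- The slice map `id ⊗ ω : B ⊗ A → B` of a bounded functional `ω` on `A`: the unique bounded
linear map satisfying `b ⊗ a ↦ ω(a) b`. -/
noncomputable def slice (ω : A →L[ℂ] ℂ) : MinTensor B A →L[ℂ] B :=
  Classical.epsilon fun T => ∀ (b : B) (a : A), T (tmul b a) = ω a • b

/-- The slice map property of `A`: for every C⋆-algebra `B` and every C⋆-subalgebra `S` of `B`,
each `x ∈ B ⊗ A` all of whose slices lie in `S` lies in `S ⊗ A`, the closed linear span in `B ⊗ A`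
of the elementary tensors `s ⊗ a` with `s ∈ S`. -/
def SliceMapProperty (A : Type u) [NonUnitalCStarAlgebra A] : Prop :=
  ∀ (B : Type u) [NonUnitalCStarAlgebra B] (S : NonUnitalStarSubalgebra ℂ B),
    IsClosed (S : Set B) → ∀ x : MinTensor B A, (∀ ω : A →L[ℂ] ℂ, slice ω x ∈ S) →
      x ∈ (Submodule.span ℂ {y | ∃ s ∈ S, ∃ a : A, y = tmul s a}).topologicalClosure

end Multiplier

section Bialgebra

variable {A B C : Type u} [NonUnitalCStarAlgebra A] [NonUnitalCStarAlgebra B]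
  [NonUnitalCStarAlgebra C]

/-- A ⋆-homomorphism `φ : A → M(B)` is nondegenerate if the closed linear span of `φ(A)B`
is `B`. -/
def IsNondegenerate (φ : A →⋆ₙₐ[ℂ] 𝓜(ℂ, B)) : Prop :=
  (Submodule.span ℂ {y | ∃ (a : A) (b : B), y = (φ a).fst b}).topologicalClosure = ⊤

/-- The map `id ⊗ Δ : M(C ⊗ A) → M(C ⊗ A ⊗ A)` induced by a nondegenerate ⋆-homomorphism
`Δ : A → M(A ⊗ A)`.  Here and below, `C ⊗ A ⊗ A` is realized as `(C ⊗ A) ⊗ A`. -/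
noncomputable def idTensor (C : Type u) [NonUnitalCStarAlgebra C]
    (Δ : A →⋆ₙₐ[ℂ] 𝓜(ℂ, MinTensor A A)) :
    𝓜(ℂ, MinTensor C A) →⋆ₙₐ[ℂ] 𝓜(ℂ, MinTensor (MinTensor C A) A) :=
  (strictExt ((toMul _).comp (tensorAssoc C A A))).comp (strictExt (homTensor (toMul C) Δ))

/-- The map `δ ⊗ id : B ⊗ A → M(B ⊗ A ⊗ A)` induced by a ⋆-homomorphism `δ : B → M(B ⊗ A)`. -/
noncomputable def tensorId (δ : B →⋆ₙₐ[ℂ] 𝓜(ℂ, MinTensor B A)) :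
    MinTensor B A →⋆ₙₐ[ℂ] 𝓜(ℂ, MinTensor (MinTensor B A) A) :=
  homTensor δ (toMul A)

/-- The C⋆-subalgebra `M(B) ⊗ A` of `M(B ⊗ A)`. -/
noncomputable def mulTensorRange (B A : Type u) [NonUnitalCStarAlgebra A]
    [NonUnitalCStarAlgebra B] : Set 𝓜(ℂ, MinTensor B A) :=
  Set.range (homTensor (NonUnitalStarAlgHom.id ℂ 𝓜(ℂ, B)) (toMul A))

/-- The ⋆-homomorphism `Δ : A → M(A ⊗ A)` turns the C⋆-algebra `A` into a C⋆-bialgebra. -/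
structure IsCStarBialgebra (Δ : A →⋆ₙₐ[ℂ] 𝓜(ℂ, MinTensor A A)) : Prop where
  nondegenerate : IsNondegenerate Δ
  coassoc : ∀ a, strictExt (tensorId Δ) (Δ a) = idTensor A Δ (Δ a)

/-- The projection `δ(1)` for a strict ⋆-homomorphism `δ`. -/
noncomputable def unitImage (φ : A →⋆ₙₐ[ℂ] 𝓜(ℂ, B)) : 𝓜(ℂ, B) := strictExt φ 1

/-- `δ : C → M(C ⊗ A)` is a partial coaction of the C⋆-bialgebra `(A, Δ)` on `C`. -/
structure IsPartialCoaction (Δ : A →⋆ₙₐ[ℂ] 𝓜(ℂ, MinTensor A A))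
    (δ : C →⋆ₙₐ[ℂ] 𝓜(ℂ, MinTensor C A)) : Prop where
  strict : IsStrict δ
  mul_mem : ∀ (c : C) (a : A), δ c * mulTmul 1 (toMul A a) ∈ Set.range (toMul (MinTensor C A))
  coassoc : ∀ c, strictExt (tensorId δ) (δ c) = mulTmul (unitImage δ) 1 * idTensor C Δ (δ c)

/-- The partial coaction `δ` is regular: `(id ⊗ Δ)(δ(C)) (1 ⊗ 1 ⊗ A) ⊆ M(C ⊗ A) ⊗ A`. -/
def IsRegularPartialCoaction (Δ : A →⋆ₙₐ[ℂ] 𝓜(ℂ, MinTensor A A))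
    (δ : C →⋆ₙₐ[ℂ] 𝓜(ℂ, MinTensor C A)) : Prop :=
  ∀ (c : C) (a : A),
    idTensor C Δ (δ c) * mulTmul 1 (toMul A a) ∈ mulTensorRange (MinTensor C A) A

/-- `δ : B → M(B ⊗ A)` is a coaction of the C⋆-bialgebra `(A, Δ)` on `B`: it satisfies
`δ(B)(1 ⊗ A) ⊆ B ⊗ A` and `(δ ⊗ id)δ = (id ⊗ Δ)δ`.  Since `δ` need not extend to multipliers, the
latter equation is read as `(δ ⊗ id)(δ(b)(1 ⊗ a)) = (id ⊗ Δ)(δ(b))(1 ⊗ 1 ⊗ a)`, where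
`δ(b)(1 ⊗ a)` lies in `B ⊗ A` by the first condition. -/
structure IsCoaction (Δ : A →⋆ₙₐ[ℂ] 𝓜(ℂ, MinTensor A A))
    (δ : B →⋆ₙₐ[ℂ] 𝓜(ℂ, MinTensor B A)) : Prop where
  mul_mem : ∀ (b : B) (a : A), δ b * mulTmul 1 (toMul A a) ∈ Set.range (toMul (MinTensor B A))
  coassoc : ∀ (b : B) (a : A) (y : MinTensor B A), toMul _ y = δ b * mulTmul 1 (toMul A a) →
    tensorId δ y = idTensor B Δ (δ b) * mulTmul 1 (toMul A a)

/-- `(B, δB, ι)` is a dilation of the partial coaction `δC`: `δB` is a coaction on `B` and `ι` is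
an embedding of `C` into `B` with `δB(ι(c))(ι(c') ⊗ a) = (ι ⊗ id)(δC(c)(c' ⊗ a))`. -/
structure IsDilation (Δ : A →⋆ₙₐ[ℂ] 𝓜(ℂ, MinTensor A A))
    (δC : C →⋆ₙₐ[ℂ] 𝓜(ℂ, MinTensor C A)) (δB : B →⋆ₙₐ[ℂ] 𝓜(ℂ, MinTensor B A))
    (ι : C →⋆ₙₐ[ℂ] B) : Prop where
  coaction : IsCoaction Δ δB
  injective : Function.Injective ι
  weak_morphism : ∀ (c c' : C) (a : A), (δB (ι c)).fst (MinTensor.tmul (ι c') a) =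
    MinTensor.map ι (NonUnitalStarAlgHom.id ℂ A) ((δC c).fst (MinTensor.tmul c' a))

/-- The four conditions on `x ∈ M(C ⊗ A)` that define membership in `C ⊠ A`. -/
structure MemBoxtimes (Δ : A →⋆ₙₐ[ℂ] 𝓜(ℂ, MinTensor A A))
    (δ : C →⋆ₙₐ[ℂ] 𝓜(ℂ, MinTensor C A)) (x : 𝓜(ℂ, MinTensor C A)) : Prop where
  commute : x * unitImage δ = unitImage δ * x
  left_eq : strictExt (tensorId δ) x = mulTmul (unitImage δ) 1 * idTensor C Δ x
  right_eq : strictExt (tensorId δ) x = idTensor C Δ x * mulTmul (unitImage δ) 1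
  mul_mem : ∀ a : A, x * mulTmul 1 (toMul A a) ∈ Set.range (toMul (MinTensor C A))
  mem_mul : ∀ a : A, mulTmul 1 (toMul A a) * x ∈ Set.range (toMul (MinTensor C A))
  comul_mul_mem : ∀ a : A,
    idTensor C Δ x * mulTmul 1 (toMul A a) ∈ mulTensorRange (MinTensor C A) A
  mem_comul_mul : ∀ a : A,
    mulTmul 1 (toMul A a) * idTensor C Δ x ∈ mulTensorRange (MinTensor C A) A

/-- The set `C ⊠ A ⊆ M(C ⊗ A)`. -/
def boxtimes (Δ : A →⋆ₙₐ[ℂ] 𝓜(ℂ, MinTensor A A)) (δ : C →⋆ₙₐ[ℂ] 𝓜(ℂ, MinTensor C A)) :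
    Set 𝓜(ℂ, MinTensor C A) := {x | MemBoxtimes Δ δ x}

/-- Let `D` be a C⋆-algebra, `j : S → M(D)` the inclusion of a C⋆-subalgebra of `M(D)`, and let
`Φ : M(D) → M(D ⊗ A)` be a ⋆-homomorphism.  The map `δ : S → M(S ⊗ A)` is the restriction of `Φ`
to `S` if for all `s ∈ S` and `a ∈ A` the element `δ(s)(1 ⊗ a)` lies in `S ⊗ A` and is equal to
`Φ(s)(1 ⊗ a)` in `M(D ⊗ A)`. -/
def IsRestriction {S D : Type u} [NonUnitalCStarAlgebra S] [NonUnitalCStarAlgebra D]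
    (Φ : 𝓜(ℂ, D) →⋆ₙₐ[ℂ] 𝓜(ℂ, MinTensor D A)) (j : S →⋆ₙₐ[ℂ] 𝓜(ℂ, D))
    (δ : S →⋆ₙₐ[ℂ] 𝓜(ℂ, MinTensor S A)) : Prop :=
  ∀ (s : S) (a : A), ∃ y : MinTensor S A, toMul _ y = δ s * mulTmul 1 (toMul A a) ∧
    homTensor j (toMul A) y = Φ (j s) * mulTmul 1 (toMul A a)

end Bialgebra

/-!
Write `D = C ⊗ A`, `Φ = id ⊗ Δ : M(D) → M(D ⊗ A)` and `p = δ(1)`.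

The defining conditions of `C ⊠ A` are closed and stable under sums, products and adjoints; for
products one uses that `Φ(x)` commutes with `p ⊗ 1` (`MemBoxtimes.mul_mem_boxtimes`).  So `C ⊠ A` is
a C⋆-subalgebra, and it contains `δ(C)` because `δ` is a regular partial coaction
(`IsPartialCoaction.memBoxtimes`).

The main point is that `Φ(x)(1 ⊗ a)` lies in `(C ⊠ A) ⊗ A` for `x ∈ C ⊠ A`.  It lies in `M(D) ⊗ A`,
so that by the slice map property it suffices that its slices satisfy the conditions again
(`MemBoxtimes.slice_mem`).  The equations follow by slicing the identities
`(Φ ⊗ id)Φ = (id ⊗ Δ)Φ` (`idTensor_coassoc`) and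
`((δ ⊗ id) ⊗ id)Φ = (id ⊗ Δ)(δ ⊗ id)` (`mulTensorId_idTensor`).  The inclusions follow by slicing
products such as `Φ(x)(1 ⊗ b ⊗ a)`: nondegeneracy of `Δ` allows one to approximate `b ⊗ a` by sums
of elements `Δ(b')w`, and `Φ(x)(1 ⊗ Δ(b')w) = Φ(x(1 ⊗ b'))(1 ⊗ w)` (`idTensor_mul_mem_range`).
Therefore `Φ` restricts to `C ⊠ A` (`exists_isRestriction`); the restriction is coassociative because
`Φ` is (`IsRestriction.isCoaction`), and the dilation property is the coassociativity of `δ`, cut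
down by `p ⊗ 1` (`IsPartialCoaction.tensorId_fst`).

Two bodies of theory support this.

* The minimal norm on `A ⊙ B` is computed by any pair of faithful representations
  (`minTensorNorm_eq_of_injective`).  This gives the slice maps, the injectivity of `f ⊗ g` for
  injective `f` and `g`, the embedding of `M(A) ⊗ M(B)` into `M(A ⊗ B)` and the associator
  `A ⊗ (B ⊗ C) → (A ⊗ B) ⊗ C`.
* A strict ⋆-homomorphism `φ : A → M(B)` has a support projection `p`, which is the identity on
  `φ(A)` and maps `B` into `[φ(A)B]` (`IsStrict.exists_hasSupport`).  Conversely, a ⋆-homomorphism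
  with a support has a strict extension, which maps `1` to `p`.  Such extensions are here called
  normal homomorphisms of multiplier algebras.  They are stable under composition and tensor
  products, and they are determined by the image of `1` and their restriction to `A`
  (`IsNormal.ext`); this is how all identities between maps on multiplier algebras are proved.
-/

/-! ### Faithful representations -/

section FaithfulRep

open scoped ComplexOrder

/-- A nonzero `star b * b` is detected by a positive functional: separate `-(star b * b)` from the
closed cone of nonnegative elements. -/
theorem exists_positive_apply_ne_zero {A : Type u} [NonUnitalCStarAlgebra A] [PartialOrder A]
    [StarOrderedRing A] {b : A} (hb : b ≠ 0) : ∃ f : A →ₚ[ℂ] ℂ, f (star b * b) ≠ 0 := by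
  let C : ProperCone ℝ A :=
    { carrier := {a | 0 ≤ a}
      add_mem' := fun ha hb => add_nonneg ha hb
      zero_mem' := le_rfl
      smul_mem' := fun c a ha => by
        have : 0 ≤ (c : ℝ) • a := smul_nonneg c.2 ha
        exact this
      isClosed' := CStarAlgebra.isClosed_nonneg }
  have hn : -(star b * b) ∉ C := fun h => by
    have h1 : 0 ≤ -(star b * b) := h
    have h2 : star b * b = 0 := le_antisymm (neg_nonneg.mp h1) (star_mul_self_nonneg b)
    exact hb (CStarRing.star_mul_self_eq_zero_iff b |>.mp h2)
  obtain ⟨f, hf, hf0⟩ := ProperCone.hyperplane_separation_point C hn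
  let h : A →ₗ[ℝ] ℝ :=
    { toFun := fun a => f a + f (star a)
      map_add' := fun a b => by simp only [star_add, map_add]; ring
      map_smul' := fun c a => by
        rw [star_smul]
        simp only [map_smul, smul_eq_mul, star_trivial, RingHom.id_apply]; ring }
  have hsa : ∀ a : A, star a = a → Module.Dual.extendRCLike (𝕜 := ℂ) h a = ((2 * f a : ℝ) : ℂ) := by
    intro a ha
    rw [Module.Dual.extendRCLike_apply]
    simp [h, ha, two_mul]
  refine ⟨PositiveLinearMap.mk₀ (Module.Dual.extendRCLike (𝕜 := ℂ) h) fun a ha => ?_, ?_⟩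
  · rw [hsa a (IsSelfAdjoint.of_nonneg ha)]
    have := hf a ha
    exact_mod_cast (by positivity : 0 ≤ 2 * f a)
  · change Module.Dual.extendRCLike (𝕜 := ℂ) h _ ≠ 0
    rw [hsa _ (by simp)]
    rw [map_neg] at hf0
    norm_cast
    linarith

variable {A : Type u} [NonUnitalCStarAlgebra A]

/-- A diagonal operator on a Hilbert sum. -/
noncomputable def lpDiagonal {ι : Type u} {G : ι → Type u} [∀ i, NormedAddCommGroup (G i)]
    [∀ i, InnerProductSpace ℂ (G i)] (T : ∀ i, G i →L[ℂ] G i) (M : ℝ) (hM : ∀ i, ‖T i‖ ≤ M) :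
    lp G 2 →L[ℂ] lp G 2 :=
  have key : ∀ (v : lp G 2) i, ‖T i (v i)‖ ^ (2 : ENNReal).toReal ≤
      M ^ (2 : ENNReal).toReal * ‖v i‖ ^ (2 : ENNReal).toReal := fun v i => by
    have hM0 : 0 ≤ M := (norm_nonneg _).trans (hM i)
    rw [← Real.mul_rpow hM0 (norm_nonneg _)]
    exact Real.rpow_le_rpow (norm_nonneg _) ((T i).le_of_opNorm_le (hM i) _) (by simp)
  have sm : ∀ v : lp G 2, Summable fun i => ‖v i‖ ^ (2 : ENNReal).toReal := fun v =>
    (memℓp_gen_iff (by simp)).mp (lp.memℓp v)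
  LinearMap.mkContinuous
    { toFun := fun v => ⟨fun i => T i (v i), (memℓp_gen_iff (by simp)).mpr <|
        Summable.of_nonneg_of_le (fun i => by positivity) (key v) ((sm v).mul_left _)⟩
      map_add' := fun v w => by ext i; exact map_add (T i) (v i) (w i)
      map_smul' := fun c v => by ext i; simp } (max M 0) fun v => by
    refine lp.norm_le_of_tsum_le (by simp) (by positivity) ?_
    rw [Real.mul_rpow (by positivity) (norm_nonneg _), lp.norm_rpow_eq_tsum (by simp) v,
      ← tsum_mul_left]
    refine Summable.tsum_le_tsum (fun i => (key v i).trans ?_) ?_ ((sm v).mul_left _)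
    · gcongr
      · exact (norm_nonneg _).trans (hM i)
      · exact le_max_left _ _
    · exact Summable.of_nonneg_of_le (fun i => by positivity) (key v) ((sm v).mul_left _)

@[simp]
theorem lpDiagonal_apply {ι : Type u} {G : ι → Type u} [∀ i, NormedAddCommGroup (G i)]
    [∀ i, InnerProductSpace ℂ (G i)] (T : ∀ i, G i →L[ℂ] G i) (M : ℝ) (hM : ∀ i, ‖T i‖ ≤ M)
    (v : lp G 2) (i : ι) : lpDiagonal T M hM v i = T i (v i) := rfl

/-- The direct sum of a family of representations. -/
noncomputable def HilbertRep.directSum {ι : Type u} (π : ι → HilbertRep A) : HilbertRep A where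
  H := lp (fun i => (π i).H) 2
  π :=
    { toFun := fun a => lpDiagonal (fun i => (π i).π a) ‖a‖ fun i =>
        NonUnitalStarAlgHom.norm_apply_le _ _
      map_smul' := fun c a => by ext v i; simp
      map_zero' := by ext v i; simp
      map_add' := fun a b => by ext v i; simp
      map_mul' := fun a b => by ext v i; simp
      map_star' := fun a => by
        rw [ContinuousLinearMap.star_eq_adjoint, ContinuousLinearMap.eq_adjoint_iff]
        intro v w
        simp [lp.inner_eq_tsum, map_star, ContinuousLinearMap.star_eq_adjoint,
          ContinuousLinearMap.adjoint_inner_left] }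

theorem exists_rep_apply_ne_zero {a : A} (ha : a ≠ 0) : ∃ π : HilbertRep A, π.π a ≠ 0 := by
  let _ := CStarAlgebra.spectralOrder A
  let _ := CStarAlgebra.spectralOrderedRing A
  have hb : a * star a ≠ 0 := fun h => ha (CStarRing.mul_star_self_eq_zero_iff a |>.mp h)
  obtain ⟨f, hf⟩ := exists_positive_apply_ne_zero hb
  refine ⟨⟨f.GNS, f.gnsNonUnitalStarAlgHom⟩, fun h => hf ?_⟩
  have h1 := DFunLike.congr_fun h ((f.toPreGNS (star a) : f.PreGNS) : f.GNS)
  simp only [PositiveLinearMap.gnsNonUnitalStarAlgHom_apply_coe, zero_apply] at h1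
  have h2 := f.preGNS_norm_sq (f.leftMulMapPreGNS a (f.toPreGNS (star a)))
  rw [← UniformSpace.Completion.norm_coe, h1] at h2
  simpa using h2.symm

variable (A) in
/-- Every C⋆-algebra has a faithful representation. -/
theorem exists_faithful_rep : ∃ π : HilbertRep A, Function.Injective π.π := by
  classical
  let π : {a : A // a ≠ 0} → HilbertRep A := fun a => (exists_rep_apply_ne_zero a.2).choose
  have hπ : ∀ a, (π a).π a ≠ 0 := fun a => (exists_rep_apply_ne_zero a.2).choose_spec
  refine ⟨HilbertRep.directSum π, (injective_iff_map_eq_zero _).mpr fun a ha => ?_⟩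
  by_contra h0
  refine hπ ⟨a, h0⟩ (ContinuousLinearMap.ext fun v => ?_)
  have h1 := DFunLike.congr_fun ha (lp.single 2 (⟨a, h0⟩ : {a : A // a ≠ 0}) v : lp (fun i => (π i).H) 2)
  have h2 : (π ⟨a, h0⟩).π a ((lp.single 2 (⟨a, h0⟩ : {a : A // a ≠ 0}) v :
      lp (fun i => (π i).H) 2) ⟨a, h0⟩) = 0 :=
    congrArg (fun w : lp (fun i => (π i).H) 2 => w ⟨a, h0⟩) h1
  simpa using h2

end FaithfulRep

/-! ### The minimal norm in faithful representations -/

section FaithfulNorm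

variable {A B : Type u} [NonUnitalCStarAlgebra A] [NonUnitalCStarAlgebra B]

theorem opNorm_le_of_inner {E : Type*} [NormedAddCommGroup E] [InnerProductSpace ℂ E]
    {T : E →L[ℂ] E} {M : ℝ} (hM : 0 ≤ M) (h : ∀ ξ η, ‖inner ℂ η (T ξ)‖ ≤ M * ‖ξ‖ * ‖η‖) :
    ‖T‖ ≤ M := by
  refine ContinuousLinearMap.opNorm_le_bound _ hM fun ξ => ?_
  have h1 := h ξ (T ξ)
  rw [inner_self_eq_norm_sq_to_K] at h1
  have h2 : ‖T ξ‖ * ‖T ξ‖ ≤ M * ‖ξ‖ * ‖T ξ‖ := by simpa [sq] using h1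
  by_cases h0 : ‖T ξ‖ = 0
  · rw [h0]; positivity
  · exact le_of_mul_le_mul_right h2 (lt_of_le_of_ne (norm_nonneg _) (Ne.symm h0))

/-- The representation of `n × n` matrices over `B` on `Hⁿ` induced by a representation of `B`
on `H`. -/
noncomputable def HilbertRep.matrix (π : HilbertRep B) (n : Type) [Fintype n] :
    CStarMatrix n n B →⋆ₙₐ[ℂ] (PiLp 2 (fun _ : n => π.H) →L[ℂ] PiLp 2 (fun _ : n => π.H)) where
  toFun y :=
    { toFun := fun ξ => WithLp.toLp 2 fun i => ∑ j, π.π (y i j) (ξ j)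
      map_add' := fun ξ η => by ext i; simp [Finset.sum_add_distrib]
      map_smul' := fun c ξ => by ext i; simp [Finset.smul_sum]
      cont := by fun_prop }
  map_smul' c y := by ext ξ i; simp [Finset.smul_sum]
  map_zero' := by ext ξ i; simp
  map_add' y z := by ext ξ i; simp [Finset.sum_add_distrib]
  map_mul' y z := by
    ext ξ i
    simp only [CStarMatrix.mul_apply, map_sum, map_mul, ContinuousLinearMap.coe_mk',
      LinearMap.coe_mk, AddHom.coe_mk, mul_apply_eq_comp,
      sum_apply]
    rw [Finset.sum_comm]
  map_star' y := by
    rw [ContinuousLinearMap.star_eq_adjoint, ContinuousLinearMap.eq_adjoint_iff]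
    intro v w
    simp only [PiLp.inner_apply, ContinuousLinearMap.coe_mk', LinearMap.coe_mk, AddHom.coe_mk,
      CStarMatrix.star_apply, map_star, ContinuousLinearMap.star_eq_adjoint, sum_inner, inner_sum,
      ContinuousLinearMap.adjoint_inner_left]
    rw [Finset.sum_comm]

theorem HilbertRep.matrix_apply (π : HilbertRep B) {n : Type} [Fintype n] (y : CStarMatrix n n B)
    (ξ : PiLp 2 (fun _ : n => π.H)) (i : n) :
    π.matrix n y ξ i = ∑ j, π.π (y i j) (ξ j) := rfl

theorem HilbertRep.matrix_injective {π : HilbertRep B} (hπ : Function.Injective π.π) (n : Type)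
    [Fintype n] [DecidableEq n] : Function.Injective (π.matrix n) := by
  refine (injective_iff_map_eq_zero _).mpr fun y hy => ?_
  ext i j
  refine (injective_iff_map_eq_zero _).mp hπ _ (ContinuousLinearMap.ext fun v => ?_)
  have h1 := congrArg (fun w : PiLp 2 (fun _ : n => π.H) => w i)
    (DFunLike.congr_fun hy (PiLp.single 2 j v))
  simp only [HilbertRep.matrix_apply] at h1
  rw [Finset.sum_eq_single j (fun k _ hk => by simp [hk]) (by simp)] at h1
  simpa using h1

/-- The slice map on the algebraic tensor product. -/
noncomputable def algSlice (ω : A →ₗ[ℂ] ℂ) : B ⊗[ℂ] A →ₗ[ℂ] B :=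
  (TensorProduct.rid ℂ B).toLinearMap ∘ₗ LinearMap.lTensor B ω

@[simp]
theorem algSlice_tmul (ω : A →ₗ[ℂ] ℂ) (b : B) (a : A) : algSlice ω (b ⊗ₜ a) = ω a • b := by
  simp [algSlice]

/-- The vector functional `a ↦ ⟪η, ρ(a) ξ⟫`. -/
noncomputable def HilbertRep.vecFun (ρ : HilbertRep A) (η ξ : ρ.H) : A →ₗ[ℂ] ℂ where
  toFun a := inner ℂ η (ρ.π a ξ)
  map_add' a b := by simp
  map_smul' c a := by simp

@[simp]
theorem HilbertRep.vecFun_apply (ρ : HilbertRep A) (η ξ : ρ.H) (a : A) :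
    ρ.vecFun η ξ a = inner ℂ η (ρ.π a ξ) := rfl

theorem HilbertRep.inner_tensor_tmul (π : HilbertRep B) (ρ : HilbertRep A) (x : B ⊗[ℂ] A)
    (ξ ξ' : π.H) (η η' : ρ.H) : inner ℂ (ξ' ⊗ₜ[ℂ] η') (π.tensor ρ x (ξ ⊗ₜ η)) =
      inner ℂ ξ' (π.π (algSlice (ρ.vecFun η' η) x) ξ) := by
  induction x with
  | zero => simp
  | add x y hx hy => simp only [map_add, add_apply, inner_add_right, hx, hy]
  | tmul b a => simp [mul_comm]

/-- On vectors `∑ ξⱼ ⊗ eⱼ` the operator `(π ⊗ ρ)(x)` is the matrix of the slices of `x` by the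
coefficients of `ρ` with respect to `e`. -/
theorem HilbertRep.inner_tensor_sum (π : HilbertRep B) (ρ : HilbertRep A) (x : B ⊗[ℂ] A)
    {n : Type} [Fintype n] (e : n → ρ.H) (ξ ξ' : PiLp 2 (fun _ : n => π.H)) :
    inner ℂ (∑ i, ξ' i ⊗ₜ[ℂ] e i) (π.tensor ρ x (∑ j, ξ j ⊗ₜ e j)) =
      inner ℂ ξ' (π.matrix n (CStarMatrix.ofMatrix
        fun i j => algSlice (ρ.vecFun (e i) (e j)) x) ξ) := by
  simp only [map_sum, sum_inner, inner_sum, HilbertRep.inner_tensor_tmul, PiLp.inner_apply,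
    HilbertRep.matrix_apply]
  rw [Finset.sum_comm]
  rfl

theorem norm_sum_tmul_orthonormal {H K : Type*} [NormedAddCommGroup H] [InnerProductSpace ℂ H]
    [NormedAddCommGroup K] [InnerProductSpace ℂ K] {n : Type} [Fintype n] [DecidableEq n]
    {e : n → K}
    (he : Orthonormal ℂ e) (ξ : PiLp 2 (fun _ : n => H)) : ‖∑ i, ξ i ⊗ₜ[ℂ] e i‖ = ‖ξ‖ := by
  have h : inner ℂ (∑ i, ξ i ⊗ₜ[ℂ] e i) (∑ i, ξ i ⊗ₜ[ℂ] e i) = inner ℂ ξ ξ := by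
    simp only [sum_inner, inner_sum, TensorProduct.inner_tmul, PiLp.inner_apply,
      orthonormal_iff_ite.mp he]
    simp
  rw [@norm_eq_sqrt_re_inner ℂ, h, ← @norm_eq_sqrt_re_inner ℂ]

theorem exists_orthonormal_repr {H K : Type*} [NormedAddCommGroup H] [InnerProductSpace ℂ H]
    [NormedAddCommGroup K] [InnerProductSpace ℂ K] (ζ ζ' : H ⊗[ℂ] K) :
    ∃ (n : ℕ) (e : Fin n → K) (ξ ξ' : PiLp 2 (fun _ : Fin n => H)), Orthonormal ℂ e ∧
      ζ = ∑ i, ξ i ⊗ₜ[ℂ] e i ∧ ζ' = ∑ i, ξ' i ⊗ₜ[ℂ] e i := by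
  obtain ⟨F, hF, hs⟩ := TensorProduct.exists_finite_submodule_right_of_setFinite
    ({ζ, ζ'} : Set (H ⊗[ℂ] K)) (by simp)
  let e := stdOrthonormalBasis ℂ F
  have key : ∀ z ∈ LinearMap.range (F.subtype.lTensor H), ∃ ξ : PiLp 2 (fun _ : Fin _ => H),
      z = ∑ i, ξ i ⊗ₜ[ℂ] (e i : K) := by
    rintro _ ⟨z, rfl⟩
    induction z with
    | zero => exact ⟨0, by simp⟩
    | add x y hx hy =>
      obtain ⟨ξ, hξ⟩ := hx
      obtain ⟨η, hη⟩ := hy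
      exact ⟨ξ + η, by simp [hξ, hη, TensorProduct.add_tmul, Finset.sum_add_distrib]⟩
    | tmul h k =>
      refine ⟨WithLp.toLp 2 fun i => e.repr k i • h, ?_⟩
      simp only [LinearMap.lTensor_tmul, Submodule.subtype_apply, TensorProduct.smul_tmul,
        ← TensorProduct.tmul_sum]
      congr 1
      conv_lhs => rw [← e.sum_repr k]
      simp
  obtain ⟨ξ, hξ⟩ := key ζ (hs (by simp))
  obtain ⟨ξ', hξ'⟩ := key ζ' (hs (by simp))
  exact ⟨_, _, ξ, ξ', e.orthonormal.comp_linearIsometry F.subtypeₗᵢ, hξ, hξ'⟩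

/-- Compressing `(π ⊗ ρ)(x)` to `H ⊗ span(e)` for a finite orthonormal family `e` gives a matrix over
`B`, whose norm is the same in every faithful representation of `B`. -/
theorem HilbertRep.norm_tensor_le_of_injective_left (π : HilbertRep B) {π₀ : HilbertRep B}
    (hπ₀ : Function.Injective π₀.π) (ρ : HilbertRep A) (x : B ⊗[ℂ] A) :
    ‖π.tensor ρ x‖ ≤ ‖π₀.tensor ρ x‖ := by
  let _ := CStarAlgebra.spectralOrder B
  let _ := CStarAlgebra.spectralOrderedRing B
  refine opNorm_le_of_inner (ContinuousLinearMap.opNorm_nonneg _) fun ζ ζ' => ?_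
  obtain ⟨n, e, ξ, ξ', he, rfl, rfl⟩ := exists_orthonormal_repr ζ ζ'
  rw [HilbertRep.inner_tensor_sum, norm_sum_tmul_orthonormal he, norm_sum_tmul_orthonormal he]
  set y : CStarMatrix (Fin n) (Fin n) B :=
    CStarMatrix.ofMatrix fun i j => algSlice (ρ.vecFun (e i) (e j)) x
  have h1 : ‖π₀.matrix (Fin n) y‖ ≤ ‖π₀.tensor ρ x‖ := by
    refine opNorm_le_of_inner (ContinuousLinearMap.opNorm_nonneg _) fun η η' => ?_
    rw [← HilbertRep.inner_tensor_sum, mul_comm _ ‖η'‖, ← norm_sum_tmul_orthonormal he η',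
      ← norm_sum_tmul_orthonormal he η]
    refine (norm_inner_le_norm (𝕜 := ℂ) (∑ i, η' i ⊗ₜ[ℂ] e i) _).trans ?_
    gcongr
    exact ContinuousLinearMap.le_opNorm _ _
  have h2 : ‖π.matrix (Fin n) y‖ ≤ ‖π₀.matrix (Fin n) y‖ := by
    have h3 := NonUnitalStarAlgHom.norm_map (π₀.matrix (Fin n))
      (HilbertRep.matrix_injective hπ₀ (Fin n)) y
    exact (NonUnitalStarAlgHom.norm_apply_le (π.matrix (Fin n)) y).trans h3.ge
  calc _ ≤ ‖ξ'‖ * (‖π.matrix (Fin n) y‖ * ‖ξ‖) := (norm_inner_le_norm _ _).trans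
        (by gcongr; exact ContinuousLinearMap.le_opNorm _ _)
    _ ≤ ‖ξ'‖ * (‖π₀.tensor ρ x‖ * ‖ξ‖) := by gcongr; exact h2.trans h1
    _ = _ := by ring

theorem HilbertRep.norm_tensor_comm (π : HilbertRep B) (ρ : HilbertRep A) (x : B ⊗[ℂ] A) :
    ‖ρ.tensor π (TensorProduct.comm ℂ B A x)‖ = ‖π.tensor ρ x‖ := by
  have key : ∀ ζ, ρ.tensor π (TensorProduct.comm ℂ B A x) (TensorProduct.commIsometry ℂ _ _ ζ) =
      TensorProduct.commIsometry ℂ _ _ (π.tensor ρ x ζ) := fun ζ => by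
    induction x with
    | zero => simp
    | add x y hx hy => simp only [map_add, add_apply, hx, hy]
    | tmul b a =>
      induction ζ with
      | zero => simp
      | add x y hx hy => simp only [map_add, hx, hy]
      | tmul ξ η => simp
  refine le_antisymm ?_ ?_
  · refine ContinuousLinearMap.opNorm_le_bound _ (ContinuousLinearMap.opNorm_nonneg _) fun ζ => ?_
    obtain ⟨ζ, rfl⟩ := (TensorProduct.commIsometry ℂ π.H ρ.H).surjective ζ
    rw [key, LinearIsometryEquiv.norm_map, LinearIsometryEquiv.norm_map]
    exact ContinuousLinearMap.le_opNorm _ _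
  · refine ContinuousLinearMap.opNorm_le_bound _ (ContinuousLinearMap.opNorm_nonneg _) fun ζ => ?_
    rw [← LinearIsometryEquiv.norm_map (TensorProduct.commIsometry ℂ π.H ρ.H), ← key,
      ← LinearIsometryEquiv.norm_map (TensorProduct.commIsometry ℂ π.H ρ.H) ζ]
    exact ContinuousLinearMap.le_opNorm _ _

/-- The minimal norm is attained in any pair of faithful representations. -/
theorem minTensorNorm_eq_of_injective {π₀ : HilbertRep B} (hπ₀ : Function.Injective π₀.π)
    {ρ₀ : HilbertRep A} (hρ₀ : Function.Injective ρ₀.π) (x : B ⊗[ℂ] A) :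
    minTensorNorm x = ‖π₀.tensor ρ₀ x‖ := by
  refine le_antisymm (minTensorNorm_le (ContinuousLinearMap.opNorm_nonneg _) fun π ρ => ?_)
    (norm_tensor_le_minTensorNorm _ _ _)
  refine (HilbertRep.norm_tensor_le_of_injective_left π hπ₀ ρ x).trans ?_
  rw [← HilbertRep.norm_tensor_comm, ← HilbertRep.norm_tensor_comm π₀ ρ₀]
  exact HilbertRep.norm_tensor_le_of_injective_left ρ hρ₀ π₀ _

end FaithfulNorm

/-! ### Functoriality and slices of the minimal tensor product -/

section Slices

variable {A B : Type u} [NonUnitalCStarAlgebra A] [NonUnitalCStarAlgebra B]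
  {A' B' : Type u} [NonUnitalCStarAlgebra A'] [NonUnitalCStarAlgebra B']

open UniformSpace.Completion

theorem norm_completion_le {E : Type*} [NormedAddCommGroup E] [InnerProductSpace ℂ E]
    (T : E →L[ℂ] E) : ‖T.completion‖ ≤ ‖T‖ := by
  refine ContinuousLinearMap.opNorm_le_bound _ (ContinuousLinearMap.opNorm_nonneg _) fun x => ?_
  refine UniformSpace.Completion.induction_on x (isClosed_le (by fun_prop) (by fun_prop)) fun x => ?_
  rw [ContinuousLinearMap.completion_apply_coe, norm_coe, norm_coe]
  exact ContinuousLinearMap.le_opNorm _ _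

theorem clm_completion_ext {E : Type*} [NormedAddCommGroup E] [InnerProductSpace ℂ E]
    {S T : UniformSpace.Completion E →L[ℂ] UniformSpace.Completion E}
    (h : ∀ x : E, S x = T x) : S = T := by
  ext x
  exact UniformSpace.Completion.induction_on x (isClosed_eq (by fun_prop) (by fun_prop)) h

/-- The representation `π ⊗ ρ` of the minimal tensor product on the Hilbert space tensor
product. -/
noncomputable def HilbertRep.spatialHom (π : HilbertRep B) (ρ : HilbertRep A) :
    MinTensor B A →⋆ₙₐ[ℂ] (UniformSpace.Completion (π.H ⊗[ℂ] ρ.H) →L[ℂ]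
      UniformSpace.Completion (π.H ⊗[ℂ] ρ.H)) :=
  MinTensor.lift
    { toFun := fun x => (π.tensor ρ x).completion
      map_add' := fun x y => clm_completion_ext fun ζ => by simp [coe_add]
      map_smul' := fun c x => clm_completion_ext fun ζ => by simp [coe_smul] }
    (fun x y => clm_completion_ext fun ζ => by simp [HilbertRep.tensor_mul])
    (fun x => by
      rw [ContinuousLinearMap.star_eq_adjoint, ContinuousLinearMap.eq_adjoint_iff]
      intro v w
      refine induction_on₂ v w (isClosed_eq (by fun_prop) (by fun_prop)) fun v w => ?_
      simp [HilbertRep.tensor_star])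
    (fun x => (norm_completion_le _).trans (norm_tensor_le_minTensorNorm _ _ _))

theorem HilbertRep.spatialHom_of (π : HilbertRep B) (ρ : HilbertRep A) (x : B ⊗[ℂ] A)
    (ζ : π.H ⊗[ℂ] ρ.H) : π.spatialHom ρ (MinTensor.of x) ζ = (π.tensor ρ x ζ : π.H ⊗[ℂ] ρ.H) := by
  rw [HilbertRep.spatialHom, MinTensor.lift_of]
  exact ContinuousLinearMap.completion_apply_coe _ _

namespace MinTensor

theorem ext_of_clm {E : Type*} [NormedAddCommGroup E] [NormedSpace ℂ E]
    {f g : MinTensor A B →L[ℂ] E} (h : ∀ a b, f (tmul a b) = g (tmul a b)) : f = g := by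
  ext x
  refine induction_on x (isClosed_eq f.continuous g.continuous) fun y => ?_
  induction y with
  | zero => simp
  | add x y hx hy => simp only [map_add, hx, hy]
  | tmul a b => exact h a b

/-- A ⋆-homomorphism of C⋆-algebras as a continuous linear map. -/
noncomputable def _root_.NonUnitalStarAlgHom.toCLM {E F : Type*} [NonUnitalCStarAlgebra E]
    [NonUnitalCStarAlgebra F] (f : E →⋆ₙₐ[ℂ] F) : E →L[ℂ] F :=
  LinearMap.mkContinuous (f : E →ₗ[ℂ] F) 1 fun x => by
    rw [one_mul]; exact NonUnitalStarAlgHom.norm_apply_le f x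

@[simp]
theorem _root_.NonUnitalStarAlgHom.toCLM_apply {E F : Type*} [NonUnitalCStarAlgebra E]
    [NonUnitalCStarAlgebra F] (f : E →⋆ₙₐ[ℂ] F) (x : E) : f.toCLM x = f x := rfl

theorem _root_.NonUnitalStarAlgHom.continuous {E F : Type*} [NonUnitalCStarAlgebra E]
    [NonUnitalCStarAlgebra F] (f : E →⋆ₙₐ[ℂ] F) : Continuous f := f.toCLM.continuous

theorem ext_hom {E : Type*} [NonUnitalCStarAlgebra E]
    {f g : MinTensor A B →⋆ₙₐ[ℂ] E} (h : ∀ a b, f (tmul a b) = g (tmul a b)) : f = g := by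
  have : f.toCLM = g.toCLM := ext_of_clm h
  ext x
  exact DFunLike.congr_fun this x

/-- The elementary tensor as a continuous bilinear map. -/
noncomputable def tmulL (A B : Type u) [NonUnitalCStarAlgebra A] [NonUnitalCStarAlgebra B] :
    A →L[ℂ] B →L[ℂ] MinTensor A B :=
  LinearMap.mkContinuous₂ ((TensorProduct.mk ℂ A B).compr₂ of) 1 fun a b => by
    simp only [LinearMap.compr₂_apply, TensorProduct.mk_apply, norm_of, one_mul]
    refine minTensorNorm_le (by positivity) fun p q => ?_
    rw [HilbertRep.tensor_tmul]
    refine (TensorProduct.norm_mapL_le _ _).trans ?_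
    gcongr
    · exact NonUnitalStarAlgHom.norm_apply_le _ _
    · exact NonUnitalStarAlgHom.norm_apply_le _ _

@[simp]
theorem tmulL_apply (a : A) (b : B) : tmulL A B a b = tmul a b := rfl

@[fun_prop]
theorem continuous_tmul {X : Type*} [TopologicalSpace X] {f : X → A} {g : X → B}
    (hf : Continuous f) (hg : Continuous g) : Continuous fun x => tmul (f x) (g x) :=
  ((tmulL A B).continuous.comp hf).clm_apply hg

theorem tmul_mul_tmul (a a' : A) (b b' : B) : tmul a b * tmul a' b' = tmul (a * a') (b * b') := by
  simp only [tmul, ← of_mul, Algebra.TensorProduct.tmul_mul_tmul]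

theorem star_tmul (a : A) (b : B) : star (tmul a b) = tmul (star a) (star b) := by
  simp only [tmul, ← of_star, TensorProduct.star_tmul]

/-- Induction principle: a closed property which is stable under sums and holds for elementary
tensors holds everywhere. -/
theorem induction_tmul {p : MinTensor A B → Prop} (x : MinTensor A B) (hc : IsClosed {x | p x})
    (hadd : ∀ x y, p x → p y → p (x + y)) (h : ∀ a b, p (tmul a b)) : p x := by
  refine induction_on x hc fun y => ?_
  induction y with
  | zero => simpa [tmul] using h 0 0
  | add x y hx hy => rw [map_add]; exact hadd _ _ hx hy
  | tmul a b => exact h a b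

theorem map_of (f : A →⋆ₙₐ[ℂ] A') (g : B →⋆ₙₐ[ℂ] B') (x : A ⊗[ℂ] B) :
    map f g (of x) = of (TensorProduct.map (f : A →ₗ[ℂ] A') (g : B →ₗ[ℂ] B') x) := by
  rw [map, lift_of]; rfl

/-- The minimal norm of a subalgebra is the restricted one: restrict faithful representations. -/
theorem norm_map {f : A →⋆ₙₐ[ℂ] A'} {g : B →⋆ₙₐ[ℂ] B'} (hf : Function.Injective f)
    (hg : Function.Injective g) (x : MinTensor A B) : ‖map f g x‖ = ‖x‖ := by
  obtain ⟨π, hπ⟩ := exists_faithful_rep A'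
  obtain ⟨ρ, hρ⟩ := exists_faithful_rep B'
  refine induction_on x (isClosed_eq ((map f g).continuous.norm) continuous_norm) fun y => ?_
  rw [map_of, norm_of, norm_of, minTensorNorm_eq_of_injective hπ hρ,
    minTensorNorm_eq_of_injective (π₀ := ⟨π.H, π.π.comp f⟩) (ρ₀ := ⟨ρ.H, ρ.π.comp g⟩)
      (hπ.comp hf) (hρ.comp hg)]
  have : π.tensor ρ (TensorProduct.map (f : A →ₗ[ℂ] A') (g : B →ₗ[ℂ] B') y) =
      HilbertRep.tensor ⟨π.H, π.π.comp f⟩ ⟨ρ.H, ρ.π.comp g⟩ y := by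
    induction y with
    | zero => simp only [map_zero]
    | add x₁ x₂ h₁ h₂ => simp only [map_add, h₁, h₂]
    | tmul a b => simp only [TensorProduct.map_tmul, HilbertRep.tensor_tmul]; rfl
  rw [this]

theorem map_injective {f : A →⋆ₙₐ[ℂ] A'} {g : B →⋆ₙₐ[ℂ] B'} (hf : Function.Injective f)
    (hg : Function.Injective g) : Function.Injective (map f g) :=
  (injective_iff_map_eq_zero _).mpr fun x hx => by
    rw [← norm_eq_zero, ← norm_map hf hg, hx, norm_zero]

theorem minTensorNorm_comm (x : A ⊗[ℂ] B) :
    minTensorNorm (TensorProduct.comm ℂ A B x) = minTensorNorm x := by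
  obtain ⟨π, hπ⟩ := exists_faithful_rep A
  obtain ⟨ρ, hρ⟩ := exists_faithful_rep B
  rw [minTensorNorm_eq_of_injective hπ hρ, minTensorNorm_eq_of_injective hρ hπ,
    HilbertRep.norm_tensor_comm]

/-- The flip `A ⊗ B → B ⊗ A`. -/
noncomputable def flip (A B : Type u) [NonUnitalCStarAlgebra A] [NonUnitalCStarAlgebra B] :
    MinTensor A B →⋆ₙₐ[ℂ] MinTensor B A :=
  lift (of ∘ₗ (TensorProduct.comm ℂ A B).toLinearMap)
    (fun x y => by
      simp only [LinearMap.comp_apply, ← of_mul]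
      congr 1
      induction x with
      | zero => simp
      | add x₁ x₂ h₁ h₂ => rw [add_mul, map_add, h₁, h₂, map_add, add_mul]
      | tmul a b =>
        induction y with
        | zero => simp
        | add y₁ y₂ h₁ h₂ => rw [mul_add, map_add, h₁, h₂, map_add, mul_add]
        | tmul c d => simp)
    (fun x => by
      simp only [LinearMap.comp_apply, ← of_star]
      congr 1
      induction x with
      | zero => simp
      | add x₁ x₂ h₁ h₂ => simp only [star_add, map_add, h₁, h₂]
      | tmul a b => simp [TensorProduct.star_tmul])
    (fun x => by
      rw [LinearMap.comp_apply, norm_of]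
      exact (minTensorNorm_comm x).le)

@[simp]
theorem flip_tmul (a : A) (b : B) : flip A B (tmul a b) = tmul b a := by
  rw [flip, tmul, lift_of]; rfl

theorem norm_algSlice_le (ω : A →L[ℂ] ℂ) (x : B ⊗[ℂ] A) :
    ‖algSlice (ω : A →ₗ[ℂ] ℂ) x‖ ≤ ‖ω‖ * minTensorNorm x := by
  obtain ⟨π, hπ⟩ := exists_faithful_rep B
  obtain ⟨ρ, hρ⟩ := exists_faithful_rep A
  rw [← NonUnitalStarAlgHom.norm_map π.π hπ]
  refine opNorm_le_of_inner (mul_nonneg (norm_nonneg _) (minTensorNorm_nonneg _)) fun ξ ξ' => ?_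
  -- slicing the first leg by a vector functional reduces to an estimate in `A`
  set a : A := algSlice (π.vecFun ξ' ξ) (TensorProduct.comm ℂ B A x) with ha
  have h1 : inner ℂ ξ' (π.π (algSlice (ω : A →ₗ[ℂ] ℂ) x) ξ) = ω a := by
    rw [ha]
    clear ha a
    induction x with
    | zero => simp
    | add x y hx hy => simp only [map_add, add_apply, inner_add_right, hx, hy]
    | tmul b a => simp [mul_comm]
  have h2 : ‖a‖ ≤ minTensorNorm x * ‖ξ‖ * ‖ξ'‖ := by
    rw [← NonUnitalStarAlgHom.norm_map ρ.π hρ]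
    have h0 := minTensorNorm_nonneg x
    refine opNorm_le_of_inner (by positivity) fun η η' => ?_
    rw [ha, ← HilbertRep.inner_tensor_tmul]
    refine (norm_inner_le_norm (𝕜 := ℂ) (η' ⊗ₜ[ℂ] ξ') _).trans ?_
    have h3 := ContinuousLinearMap.le_opNorm (ρ.tensor π (TensorProduct.comm ℂ B A x)) (η ⊗ₜ ξ)
    have h4 := norm_tensor_le_minTensorNorm ρ π (TensorProduct.comm ℂ B A x)
    rw [minTensorNorm_comm] at h4
    rw [TensorProduct.norm_tmul] at h3 ⊢
    calc _ ≤ ‖η'‖ * ‖ξ'‖ * (minTensorNorm x * (‖η‖ * ‖ξ‖)) := by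
            gcongr
            refine h3.trans ?_
            gcongr
      _ = _ := by ring
  rw [h1]
  refine (ω.le_opNorm a).trans ?_
  calc _ ≤ ‖ω‖ * (minTensorNorm x * ‖ξ‖ * ‖ξ'‖) := by gcongr
    _ = _ := by ring

end MinTensor

open MinTensor

/-- The defining property of the slice map, which exists because slices of algebraic tensors are
bounded for the minimal norm. -/
theorem slice_tmul (ω : A →L[ℂ] ℂ) (b : B) (a : A) : slice ω (tmul b a) = ω a • b := by
  have h : ∃ T : MinTensor B A →L[ℂ] B, ∀ (b : B) (a : A), T (tmul b a) = ω a • b :=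
    ⟨LinearMap.extendOfNorm (algSlice (ω : A →ₗ[ℂ] ℂ)) MinTensor.of, fun b a => by
      rw [tmul, LinearMap.extendOfNorm_eq MinTensor.denseRange_of ⟨‖ω‖, fun x => by
        rw [norm_of]; exact norm_algSlice_le ω x⟩]
      simp⟩
  exact Classical.epsilon_spec h b a

/-- The slice map on the first leg. -/
noncomputable def leftSlice (φ : B →L[ℂ] ℂ) : MinTensor B A →L[ℂ] A :=
  (slice φ).comp (flip B A).toCLM

theorem leftSlice_tmul (φ : B →L[ℂ] ℂ) (b : B) (a : A) : leftSlice φ (tmul b a) = φ b • a := by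
  simp [leftSlice, slice_tmul]

theorem apply_slice_eq (φ : B →L[ℂ] ℂ) (ω : A →L[ℂ] ℂ) (x : MinTensor B A) :
    φ (slice ω x) = ω (leftSlice φ x) := by
  have : φ.comp (slice ω) = ω.comp (leftSlice φ) := ext_of_clm fun b a => by
    simp [slice_tmul, leftSlice_tmul, mul_comm]
  exact DFunLike.congr_fun this x

/-- The vector functional `a ↦ ⟪η, ρ(a) ξ⟫` as a bounded functional. -/
noncomputable def HilbertRep.vecFunL (ρ : HilbertRep A) (η ξ : ρ.H) : A →L[ℂ] ℂ :=
  LinearMap.mkContinuous (ρ.vecFun η ξ) (‖η‖ * ‖ξ‖) fun a => by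
    refine (norm_inner_le_norm (𝕜 := ℂ) _ _).trans ?_
    rw [mul_assoc, mul_comm ‖ξ‖]
    gcongr
    exact (ρ.π a).le_of_opNorm_le (NonUnitalStarAlgHom.norm_apply_le _ _) _

theorem HilbertRep.continuous_spatialHom (π : HilbertRep B) (ρ : HilbertRep A) :
    Continuous (π.spatialHom ρ) :=
  NonUnitalStarAlgHom.continuous (E := MinTensor B A)
    (F := UniformSpace.Completion (π.H ⊗[ℂ] ρ.H) →L[ℂ] UniformSpace.Completion (π.H ⊗[ℂ] ρ.H))
    (π.spatialHom ρ)

theorem HilbertRep.inner_spatialHom_tmul (π : HilbertRep B) (ρ : HilbertRep A)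
    (x : MinTensor B A) (ξ ξ' : π.H) (η η' : ρ.H) :
    inner ℂ ((ξ' ⊗ₜ[ℂ] η' : π.H ⊗[ℂ] ρ.H) : UniformSpace.Completion (π.H ⊗[ℂ] ρ.H))
      (π.spatialHom ρ x (ξ ⊗ₜ[ℂ] η : π.H ⊗[ℂ] ρ.H)) =
      inner ℂ ξ' (π.π (slice (ρ.vecFunL η' η) x) ξ) := by
  induction x using MinTensor.induction_tmul with
  | hc =>
    have h1 := π.continuous_spatialHom ρ
    have h2 := π.π.continuous
    exact isClosed_eq (by fun_prop) (by fun_prop)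
  | hadd x y hx hy => simp only [map_add, add_apply, inner_add_right, hx, hy]
  | h b a =>
    rw [slice_tmul, tmul, HilbertRep.spatialHom_of, inner_coe, HilbertRep.inner_tensor_tmul,
      algSlice_tmul]
    rfl

theorem MinTensor.injective_of_norm_le {E : Type*} [NonUnitalCStarAlgebra E]
    (f : MinTensor B A →⋆ₙₐ[ℂ] E) (h : ∀ y, minTensorNorm y ≤ ‖f (of y)‖) :
    Function.Injective f := by
  refine (injective_iff_map_eq_zero _).mpr fun x hx => ?_
  have : ‖x‖ ≤ ‖f x‖ := MinTensor.induction_on x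
    (isClosed_le continuous_norm f.continuous.norm) fun y => by rw [norm_of]; exact h y
  rw [hx, norm_zero] at this
  exact norm_le_zero_iff.mp this

theorem HilbertRep.spatialHom_injective {π : HilbertRep B} {ρ : HilbertRep A}
    (hπ : Function.Injective π.π) (hρ : Function.Injective ρ.π) :
    Function.Injective (π.spatialHom ρ) := by
  refine MinTensor.injective_of_norm_le
    (E := UniformSpace.Completion (π.H ⊗[ℂ] ρ.H) →L[ℂ] UniformSpace.Completion (π.H ⊗[ℂ] ρ.H))
    (π.spatialHom ρ) fun y => ?_
  rw [minTensorNorm_eq_of_injective hπ hρ]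
  refine ContinuousLinearMap.opNorm_le_bound _ (ContinuousLinearMap.opNorm_nonneg _) fun ζ => ?_
  rw [← norm_coe, ← norm_coe ζ, ← HilbertRep.spatialHom_of]
  exact ContinuousLinearMap.le_opNorm _ _

/-- Slices separate the points of the minimal tensor product. -/
theorem eq_zero_of_slice_eq_zero {x : MinTensor B A} (h : ∀ ω : A →L[ℂ] ℂ, slice ω x = 0) :
    x = 0 := by
  obtain ⟨π, hπ⟩ := exists_faithful_rep B
  obtain ⟨ρ, hρ⟩ := exists_faithful_rep A
  refine (injective_iff_map_eq_zero _).mp (HilbertRep.spatialHom_injective hπ hρ) x ?_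
  refine clm_completion_ext fun ζ => ?_
  induction ζ with
  | zero => rw [coe_zero, map_zero, map_zero]
  | add x y hx hy => rw [coe_add, map_add, map_add, hx, hy]
  | tmul ξ η =>
    refine (denseRange_coe (α := π.H ⊗[ℂ] ρ.H)).eq_zero_of_inner_right ℂ fun ζ' => ?_
    induction ζ' with
    | zero => rw [coe_zero, inner_zero_left]
    | add x y hx hy => rw [coe_add, inner_add_left, hx, hy, add_zero]
    | tmul ξ' η' => rw [HilbertRep.inner_spatialHom_tmul, h, map_zero]; simp

end Slices

/-! ### Multipliers -/

section Multipliers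

variable {A B C : Type u} [NonUnitalCStarAlgebra A] [NonUnitalCStarAlgebra B]
  [NonUnitalCStarAlgebra C]

open MinTensor

theorem eq_of_forall_mul_eq {x y : B} (h : ∀ b, x * b = y * b) : x = y := by
  have h1 : (x - y) * star (x - y) = 0 := by rw [sub_mul, h, sub_self]
  exact sub_eq_zero.mp ((CStarRing.mul_star_self_eq_zero_iff _).mp h1)

theorem multiplier_ext {m n : 𝓜(ℂ, B)} (h : ∀ b, m.fst b = n.fst b) : m = n := by
  refine DoubleCentralizer.ext _ _ _ _ (Prod.ext (ContinuousLinearMap.ext h)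
    (ContinuousLinearMap.ext fun x => eq_of_forall_mul_eq fun b => ?_))
  rw [m.central, n.central, h]

theorem mul_fst_apply (m n : 𝓜(ℂ, B)) (b : B) : (m * n).fst b = m.fst (n.fst b) := rfl

theorem one_fst_apply (b : B) : (1 : 𝓜(ℂ, B)).fst b = b := rfl

@[simp]
theorem toMul_fst (x b : B) : (toMul B x).fst b = x * b := rfl

theorem fst_mul (m : 𝓜(ℂ, B)) (x y : B) : m.fst (x * y) = m.fst x * y := by
  refine eq_of_forall_mul_eq (B := B) (x := m.fst (x * y)) (y := m.fst x * y) fun b => ?_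
  have h : ∀ z, z * m.fst (x * y) = z * (m.fst x * y) := fun z => by
    rw [← m.central, ← mul_assoc, m.central, mul_assoc]
  have h1 : star (m.fst (x * y)) = star (m.fst x * y) := eq_of_forall_mul_eq fun z => by
    have := congrArg star (h (star z))
    simpa using this
  rw [star_injective h1]

theorem mul_toMul (m : 𝓜(ℂ, B)) (b : B) : m * toMul B b = toMul B (m.fst b) :=
  multiplier_ext fun x => by rw [mul_fst_apply, toMul_fst, toMul_fst, fst_mul]

variable (B) in
theorem toMul_injective : Function.Injective (toMul B) := fun x y h =>
  eq_of_forall_mul_eq fun b => by rw [← toMul_fst, h, toMul_fst]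

theorem continuous_fst_apply (b : B) : Continuous fun m : 𝓜(ℂ, B) => m.fst b := by
  have h : (fun m : 𝓜(ℂ, B) => m.fst b) = fun m => (DoubleCentralizer.toProdHom m).1 b := rfl
  have h1 : Continuous fun m : 𝓜(ℂ, B) => DoubleCentralizer.toProdHom m :=
    continuous_iff_continuousAt.mpr fun m => (AddMonoidHomClass.isometry_of_norm
      DoubleCentralizer.toProdHom fun _ => rfl).continuous.continuousAt
  rw [h]
  fun_prop

/-- The multiplier given by a bounded operator `T` with adjoint `S`. -/
noncomputable def multiplierOfAdjoint (T S : B →L[ℂ] B)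
    (h : ∀ x y, star (S x) * y = star x * T y) : 𝓜(ℂ, B) where
  fst := T
  snd := LinearMap.mkContinuous
    { toFun := fun x => star (S (star x))
      map_add' := fun x y => by simp
      map_smul' := fun c x => by simp [star_smul] } ‖S‖ fun x => by
    change ‖star (S (star x))‖ ≤ _
    rw [norm_star, ← norm_star x]
    exact S.le_opNorm _
  central x y := by
    change star (S (star x)) * y = x * T y
    rw [h, star_star]

@[simp]
theorem multiplierOfAdjoint_fst (T S : B →L[ℂ] B)
    (h : ∀ x y, star (S x) * y = star x * T y) : (multiplierOfAdjoint T S h).fst = T := rfl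

theorem NonUnitalStarAlgHom.isClosed_range {E F : Type*} [NonUnitalCStarAlgebra E]
    [NonUnitalCStarAlgebra F] {f : E →⋆ₙₐ[ℂ] F} (hf : Function.Injective f) :
    IsClosed (Set.range f) :=
  (NonUnitalStarAlgHom.isometry f hf).isClosedEmbedding.isClosed_range

/-- If `G` acts on an algebra containing `I` such that `I` is invariant, then `G` acts on `I` by
multipliers. -/
theorem exists_hom_multiplier {G E I : Type*} [NonUnitalCStarAlgebra G] [NonUnitalCStarAlgebra E]
    [NonUnitalCStarAlgebra I] (K : G →⋆ₙₐ[ℂ] E) {κ : I →⋆ₙₐ[ℂ] E} (hκ : Function.Injective κ)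
    (h : ∀ g i, K g * κ i ∈ Set.range κ) :
    ∃ L : G →⋆ₙₐ[ℂ] 𝓜(ℂ, I), ∀ g i, κ ((L g).fst i) = K g * κ i := by
  choose T hT using h
  let T' : G → I →L[ℂ] I := fun g => LinearMap.mkContinuous
    { toFun := T g
      map_add' := fun x y => hκ (by rw [map_add, hT, hT, hT, map_add, mul_add])
      map_smul' := fun c x => hκ (by simp [hT, mul_smul_comm]) } ‖K g‖ fun x => by
    rw [← NonUnitalStarAlgHom.norm_map κ hκ, ← NonUnitalStarAlgHom.norm_map κ hκ x]
    change ‖κ (T g x)‖ ≤ _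
    rw [hT]
    exact norm_mul_le _ _
  have hT' : ∀ g i, κ (T' g i) = K g * κ i := hT
  have hadj : ∀ g x y, star (T' (star g) x) * y = star x * T' g y := fun g x y => hκ (by
    rw [map_mul, map_mul, map_star, map_star, hT', hT', star_mul, map_star, star_star, mul_assoc])
  refine ⟨{ toFun := fun g => multiplierOfAdjoint (T' g) (T' (star g)) (hadj g)
            map_smul' := fun c g => multiplier_ext fun i => hκ ?_
            map_zero' := multiplier_ext fun i => hκ ?_
            map_add' := fun g g' => multiplier_ext fun i => hκ ?_
            map_mul' := fun g g' => multiplier_ext fun i => hκ ?_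
            map_star' := fun g => multiplier_ext fun i => hκ ?_ }, fun g i => hT' g i⟩
  · simp [hT', smul_mul_assoc]
  · simp [hT']
  · simp [hT', add_mul]
  · simp [hT', mul_assoc]
  · rw [DoubleCentralizer.star_fst]
    change _ = κ (star (star (T' (star g) (star (star i)))))
    simp [hT']

/-! ### The tensor product of multipliers -/

section MulTensor

theorem tmul_mul_map_mem_range (x : MinTensor 𝓜(ℂ, A) 𝓜(ℂ, B)) (i : MinTensor A B) :
    x * MinTensor.map (toMul A) (toMul B) i ∈ Set.range (MinTensor.map (toMul A) (toMul B)) := by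
  have hcl : IsClosed (Set.range (MinTensor.map (toMul A) (toMul B))) :=
    NonUnitalStarAlgHom.isClosed_range
      (MinTensor.map_injective (toMul_injective A) (toMul_injective B))
  induction x using MinTensor.induction_tmul with
  | hc => exact hcl.preimage (by fun_prop)
  | hadd x y hx hy =>
    obtain ⟨u, hu⟩ := hx
    obtain ⟨v, hv⟩ := hy
    exact ⟨u + v, by rw [map_add, hu, hv, add_mul]⟩
  | h m n =>
    induction i using MinTensor.induction_tmul with
    | hc =>
      have := (MinTensor.map (toMul A) (toMul B)).continuous
      exact hcl.preimage (by fun_prop)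
    | hadd x y hx hy =>
      obtain ⟨u, hu⟩ := hx
      obtain ⟨v, hv⟩ := hy
      exact ⟨u + v, by rw [map_add, hu, hv, map_add, mul_add]⟩
    | h a b =>
      exact ⟨tmul (m.fst a) (n.fst b), by
        rw [map_tmul, map_tmul, tmul_mul_tmul, mul_toMul, mul_toMul]⟩

/-- The defining property of `mulTensor`: the map exists because `A ⊗ B` embeds as an ideal into
`M(A) ⊗ M(B)`. -/
theorem mulTensor_tmul_fst (m : 𝓜(ℂ, A)) (n : 𝓜(ℂ, B)) (a : A) (b : B) :
    (mulTensor A B (tmul m n)).fst (tmul a b) = tmul (m.fst a) (n.fst b) := by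
  have hinj := MinTensor.map_injective (toMul_injective A) (toMul_injective B)
  obtain ⟨L, hL⟩ := exists_hom_multiplier (NonUnitalStarAlgHom.id ℂ (MinTensor 𝓜(ℂ, A) 𝓜(ℂ, B)))
    hinj tmul_mul_map_mem_range
  refine Classical.epsilon_spec (p := fun κ : MinTensor 𝓜(ℂ, A) 𝓜(ℂ, B) →⋆ₙₐ[ℂ]
    𝓜(ℂ, MinTensor A B) => ∀ (m : 𝓜(ℂ, A)) (n : 𝓜(ℂ, B)) (a : A) (b : B),
    (κ (tmul m n)).fst (tmul a b) = tmul (m.fst a) (n.fst b)) ⟨L, fun m n a b => hinj ?_⟩ m n a b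
  rw [hL, map_tmul, map_tmul]
  change tmul m n * _ = _
  rw [tmul_mul_tmul, mul_toMul, mul_toMul]

@[simp]
theorem mulTmul_fst (m : 𝓜(ℂ, A)) (n : 𝓜(ℂ, B)) (a : A) (b : B) :
    (mulTmul m n).fst (tmul a b) = tmul (m.fst a) (n.fst b) := mulTensor_tmul_fst m n a b

/-- The tensor product of multipliers acts on `A ⊗ B` by multiplication inside
`M(A) ⊗ M(B)`. -/
theorem map_mulTensor_fst (x : MinTensor 𝓜(ℂ, A) 𝓜(ℂ, B)) (i : MinTensor A B) :
    MinTensor.map (toMul A) (toMul B) ((mulTensor A B x).fst i) =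
      x * MinTensor.map (toMul A) (toMul B) i := by
  have h1 := (MinTensor.map (toMul A) (toMul B)).continuous
  induction x using MinTensor.induction_tmul with
  | hc =>
    have h2 := (continuous_fst_apply i).comp (mulTensor A B).continuous
    exact isClosed_eq (h1.comp h2) (by fun_prop)
  | hadd x y hx hy => rw [map_add, DoubleCentralizer.add_fst, add_apply, map_add, hx, hy, add_mul]
  | h m n =>
    induction i using MinTensor.induction_tmul with
    | hc => exact isClosed_eq (by fun_prop) (by fun_prop)
    | hadd x y hx hy => rw [map_add, map_add, hx, hy, map_add, mul_add]
    | h a b =>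
      rw [mulTensor_tmul_fst, map_tmul, map_tmul, tmul_mul_tmul, mul_toMul, mul_toMul]

theorem slice_mul_tmul {a : A} (ω : B →L[ℂ] ℂ) (x : MinTensor A B) (b : B) :
    slice ω (x * tmul a b) = slice (ω.comp ((ContinuousLinearMap.mul ℂ B).flip b)) x * a := by
  induction x using MinTensor.induction_tmul with
  | hc => exact isClosed_eq (by fun_prop) (by fun_prop)
  | hadd x y hx hy => rw [add_mul, map_add, hx, hy, map_add, add_mul]
  | h c d => simp [tmul_mul_tmul, slice_tmul, smul_mul_assoc]

variable (A B) in
/-- `M(A) ⊗ M(B)` embeds into `M(A ⊗ B)`, because `A ⊗ B` is an essential ideal of it. -/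
theorem mulTensor_injective : Function.Injective (mulTensor A B) := by
  refine (injective_iff_map_eq_zero _).mpr fun x hx => ?_
  have h0 : ∀ a b, x * tmul (toMul A a) (toMul B b) = 0 := fun a b => by
    rw [← map_tmul, ← map_mulTensor_fst, hx]; simp
  -- slice the second leg, then the first leg, to remove `a` and `b`
  have h1 : ∀ (ω : 𝓜(ℂ, B) →L[ℂ] ℂ) (b : B),
      slice (ω.comp ((ContinuousLinearMap.mul ℂ 𝓜(ℂ, B)).flip (toMul B b))) x = 0 := fun ω b =>
    multiplier_ext fun a => toMul_injective A (by
      rw [← mul_toMul, ← slice_mul_tmul, h0, map_zero]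
      exact (map_zero (toMul A)).symm)
  refine eq_zero_of_slice_eq_zero fun ω => ?_
  refine SeparatingDual.eq_zero_of_forall_dual_eq_zero (R := ℂ) fun φ => ?_
  have h3 : leftSlice φ x = 0 := multiplier_ext fun b => toMul_injective B (by
    rw [← mul_toMul]
    refine (SeparatingDual.eq_zero_of_forall_dual_eq_zero (R := ℂ) fun ψ => ?_).trans
      (map_zero (toMul B)).symm
    have h5 := congrArg φ (h1 ψ b)
    rw [apply_slice_eq, map_zero] at h5
    exact h5)
  rw [apply_slice_eq φ ω x, h3, map_zero]

theorem homTensor_tmul {D : Type u} [NonUnitalCStarAlgebra D] (φ : A →⋆ₙₐ[ℂ] 𝓜(ℂ, C))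
    (ψ : B →⋆ₙₐ[ℂ] 𝓜(ℂ, D)) (a : A) (b : B) :
    homTensor φ ψ (tmul a b) = mulTmul (φ a) (ψ b) := by
  rw [homTensor, NonUnitalStarAlgHom.comp_apply, map_tmul]; rfl

theorem homTensor_injective {D : Type u} [NonUnitalCStarAlgebra D] {φ : A →⋆ₙₐ[ℂ] 𝓜(ℂ, C)}
    {ψ : B →⋆ₙₐ[ℂ] 𝓜(ℂ, D)} (hφ : Function.Injective φ) (hψ : Function.Injective ψ) :
    Function.Injective (homTensor φ ψ) :=
  (mulTensor_injective C D).comp (MinTensor.map_injective hφ hψ)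

theorem multiplier_ext_tmul {m n : 𝓜(ℂ, MinTensor A B)}
    (h : ∀ a b, m.fst (tmul a b) = n.fst (tmul a b)) : m = n :=
  multiplier_ext fun b => DFunLike.congr_fun (ext_of_clm h) b

theorem mulTmul_mul (m m' : 𝓜(ℂ, A)) (n n' : 𝓜(ℂ, B)) :
    mulTmul m n * mulTmul m' n' = mulTmul (m * m') (n * n') := by
  rw [mulTmul, mulTmul, ← map_mul, tmul_mul_tmul]; rfl

theorem star_mulTmul (m : 𝓜(ℂ, A)) (n : 𝓜(ℂ, B)) :
    star (mulTmul m n) = mulTmul (star m) (star n) := by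
  rw [mulTmul, ← map_star, star_tmul]; rfl

theorem mulTmul_one_one : mulTmul (1 : 𝓜(ℂ, A)) (1 : 𝓜(ℂ, B)) = 1 :=
  multiplier_ext_tmul fun a b => by rw [mulTmul_fst]; rfl

theorem toMul_tmul (a : A) (b : B) :
    toMul (MinTensor A B) (tmul a b) = mulTmul (toMul A a) (toMul B b) :=
  multiplier_ext_tmul fun c d => by rw [mulTmul_fst, toMul_fst, tmul_mul_tmul]; rfl

theorem mulTmul_eq (m : 𝓜(ℂ, A)) (n : 𝓜(ℂ, B)) :
    mulTmul m n = mulTmul m 1 * mulTmul 1 n := by rw [mulTmul_mul, mul_one, one_mul]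

theorem mulTmul_comm (m : 𝓜(ℂ, A)) (n : 𝓜(ℂ, B)) :
    mulTmul m 1 * mulTmul 1 n = mulTmul 1 n * mulTmul m 1 := by
  rw [mulTmul_mul, mulTmul_mul, mul_one, one_mul, mul_one, one_mul]

end MulTensor

end Multipliers

/-! ### Associativity of the minimal tensor product -/

section Associator

variable {A B C : Type u} [NonUnitalCStarAlgebra A] [NonUnitalCStarAlgebra B]
  [NonUnitalCStarAlgebra C]

open UniformSpace.Completion

namespace MinTensor

theorem tmul_add (a : A) (b b' : B) : tmul a (b + b') = tmul a b + tmul a b' :=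
  map_add (tmulL A B a) b b'

theorem add_tmul (a a' : A) (b : B) : tmul (a + a') b = tmul a b + tmul a' b := by
  simp only [← tmulL_apply, map_add, add_apply]

@[elab_as_elim]
theorem induction_tmul_tmul {p : MinTensor A (MinTensor B C) → Prop}
    (x : MinTensor A (MinTensor B C)) (hc : IsClosed {x | p x})
    (hadd : ∀ x y, p x → p y → p (x + y)) (h : ∀ a b c, p (tmul a (tmul b c))) : p x := by
  induction x using induction_tmul with
  | hc => exact hc
  | hadd x y hx hy => exact hadd x y hx hy
  | h a z =>
    induction z using induction_tmul with
    | hc => exact hc.preimage (continuous_tmul continuous_const continuous_id)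
    | hadd x y hx hy => rw [tmul_add]; exact hadd _ _ hx hy
    | h b c => exact h a b c

@[elab_as_elim]
theorem induction_tmul_tmul' {p : MinTensor (MinTensor A B) C → Prop}
    (x : MinTensor (MinTensor A B) C) (hc : IsClosed {x | p x})
    (hadd : ∀ x y, p x → p y → p (x + y)) (h : ∀ a b c, p (tmul (tmul a b) c)) : p x := by
  induction x using induction_tmul with
  | hc => exact hc
  | hadd x y hx hy => exact hadd x y hx hy
  | h z c =>
    induction z using induction_tmul with
    | hc => exact hc.preimage (continuous_tmul continuous_id continuous_const)
    | hadd x y hx hy => rw [add_tmul]; exact hadd _ _ hx hy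
    | h a b => exact h a b c

end MinTensor

open MinTensor

/-- The algebraic threefold tensor product in `A ⊗ (B ⊗ C)`. -/
noncomputable def ofRight (A B C : Type u) [NonUnitalCStarAlgebra A] [NonUnitalCStarAlgebra B]
    [NonUnitalCStarAlgebra C] : (A ⊗[ℂ] B) ⊗[ℂ] C →ₗ[ℂ] MinTensor A (MinTensor B C) :=
  MinTensor.of ∘ₗ LinearMap.lTensor A MinTensor.of ∘ₗ (TensorProduct.assoc ℂ A B C).toLinearMap

/-- The algebraic threefold tensor product in `(A ⊗ B) ⊗ C`. -/
noncomputable def ofLeft (A B C : Type u) [NonUnitalCStarAlgebra A] [NonUnitalCStarAlgebra B]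
    [NonUnitalCStarAlgebra C] : (A ⊗[ℂ] B) ⊗[ℂ] C →ₗ[ℂ] MinTensor (MinTensor A B) C :=
  MinTensor.of ∘ₗ LinearMap.rTensor C MinTensor.of

theorem ofRight_tmul (a : A) (b : B) (c : C) :
    ofRight A B C ((a ⊗ₜ b) ⊗ₜ c) = tmul a (tmul b c) := by
  simp [ofRight, tmul]

theorem ofLeft_tmul (a : A) (b : B) (c : C) :
    ofLeft A B C ((a ⊗ₜ b) ⊗ₜ c) = tmul (tmul a b) c := by
  simp [ofLeft, tmul]

theorem denseRange_ofRight : DenseRange (ofRight A B C) := fun x => by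
  induction x using induction_tmul_tmul with
  | hc => exact isClosed_closure
  | hadd x y hx hy =>
    have := (LinearMap.range (ofRight A B C)).topologicalClosure.add_mem hx hy
    exact this
  | h a b c => exact subset_closure ⟨_, ofRight_tmul a b c⟩

section Isometries

variable {E E' F' L : Type*} [NormedAddCommGroup E] [InnerProductSpace ℂ E]
  [NormedAddCommGroup E'] [InnerProductSpace ℂ E'] [NormedAddCommGroup F']
  [InnerProductSpace ℂ F'] [NormedAddCommGroup L] [InnerProductSpace ℂ L]

theorem denseRange_rTensor {i : E →ₗᵢ[ℂ] E'} (hi : DenseRange i) :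
    DenseRange (i.rTensor L) := fun x => by
  induction x with
  | zero => exact subset_closure ⟨0, map_zero _⟩
  | add x y hx hy =>
    exact (LinearMap.range (i.rTensor L).toLinearMap).topologicalClosure.add_mem hx hy
  | tmul w l =>
    have hcont : Continuous fun w : E' => w ⊗ₜ[ℂ] l := by fun_prop
    refine hi.induction_on w (isClosed_closure.preimage hcont) fun z => ?_
    exact subset_closure ⟨z ⊗ₜ l, by simp⟩

/-- An operator is bounded by any operator with which it agrees on a common dense subspace. -/
theorem opNorm_le_of_intertwine {i : E →ₗᵢ[ℂ] E'} (hi : DenseRange i) (j : E →ₗᵢ[ℂ] F')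
    {S : E' →L[ℂ] E'} {T : F' →L[ℂ] F'} (h : ∀ ζ, ∃ ζ', S (i ζ) = i ζ' ∧ T (j ζ) = j ζ') :
    ‖S‖ ≤ ‖T‖ := by
  refine ContinuousLinearMap.opNorm_le_bound _ (norm_nonneg _) fun w => ?_
  refine hi.induction_on (p := fun w => ‖S w‖ ≤ ‖T‖ * ‖w‖) w
    (isClosed_le (by fun_prop) (by fun_prop)) fun ζ => ?_
  obtain ⟨ζ', h3, h4⟩ := h ζ
  rw [h3, i.norm_map, i.norm_map, ← j.norm_map ζ', ← h4, ← j.norm_map ζ]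
  exact T.le_opNorm _

end Isometries

/-- Both ways of bracketing the action of `A ⊗ B ⊗ C` on a threefold tensor product of Hilbert
spaces agree; `i` and `j` embed the algebraic tensor products of two of the spaces. -/
theorem tensor_intertwine {π : HilbertRep A} {ρ : HilbertRep B} {τ : HilbertRep C}
    {σ : HilbertRep (MinTensor A B)} {σ' : HilbertRep (MinTensor B C)}
    (i : π.H ⊗[ℂ] ρ.H →ₗᵢ[ℂ] σ.H) (j : ρ.H ⊗[ℂ] τ.H →ₗᵢ[ℂ] σ'.H)
    (hi : ∀ x ζ, σ.π (MinTensor.of x) (i ζ) = i (π.tensor ρ x ζ))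
    (hj : ∀ x ζ, σ'.π (MinTensor.of x) (j ζ) = j (ρ.tensor τ x ζ))
    (t : (A ⊗[ℂ] B) ⊗[ℂ] C) (ζ : (π.H ⊗[ℂ] ρ.H) ⊗[ℂ] τ.H) :
    ∃ ζ', σ.tensor τ (LinearMap.rTensor C MinTensor.of t) (i.rTensor τ.H ζ) = i.rTensor τ.H ζ' ∧
      π.tensor σ' (LinearMap.lTensor A MinTensor.of (TensorProduct.assoc ℂ A B C t))
        ((j.lTensor π.H).comp (TensorProduct.assocIsometry ℂ π.H ρ.H τ.H).toLinearIsometry ζ) =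
        (j.lTensor π.H).comp (TensorProduct.assocIsometry ℂ π.H ρ.H τ.H).toLinearIsometry ζ' := by
  induction t with
  | zero => exact ⟨0, by simp⟩
  | add t t' ht ht' =>
    obtain ⟨w, h1, h2⟩ := ht
    obtain ⟨w', h1', h2'⟩ := ht'
    exact ⟨w + w', by simp only [map_add, add_apply, h1, h1'],
      by simp only [map_add, add_apply, h2, h2']⟩
  | tmul s c =>
    induction s with
    | zero => exact ⟨0, by simp⟩
    | add t t' ht ht' =>
      obtain ⟨w, h1, h2⟩ := ht
      obtain ⟨w', h1', h2'⟩ := ht'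
      exact ⟨w + w', by simp only [TensorProduct.add_tmul, map_add, add_apply, h1, h1'],
        by simp only [TensorProduct.add_tmul, map_add, add_apply, h2, h2']⟩
    | tmul a b =>
      induction ζ with
      | zero => exact ⟨0, by simp⟩
      | add t t' ht ht' =>
        obtain ⟨w, h1, h2⟩ := ht
        obtain ⟨w', h1', h2'⟩ := ht'
        exact ⟨w + w', by simp only [map_add, h1, h1'], by simp only [map_add, h2, h2']⟩
      | tmul y ζ =>
        induction y with
        | zero => exact ⟨0, by simp⟩
        | add t t' ht ht' =>
          obtain ⟨w, h1, h2⟩ := ht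
          obtain ⟨w', h1', h2'⟩ := ht'
          exact ⟨w + w', by simp only [TensorProduct.add_tmul, map_add, h1, h1'],
            by simp only [TensorProduct.add_tmul, map_add, h2, h2']⟩
        | tmul ξ η =>
          exact ⟨(π.π a ξ ⊗ₜ ρ.π b η) ⊗ₜ τ.π c ζ, by simp [hi], by simp [hj]⟩

/-- Only this inequality is needed for the associator, since `A ⊗ (B ⊗ C)` is its domain. -/
theorem norm_ofLeft_le (t : (A ⊗[ℂ] B) ⊗[ℂ] C) : ‖ofLeft A B C t‖ ≤ ‖ofRight A B C t‖ := by
  obtain ⟨π, hπ⟩ := exists_faithful_rep A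
  obtain ⟨ρ, hρ⟩ := exists_faithful_rep B
  obtain ⟨τ, hτ⟩ := exists_faithful_rep C
  let σ : HilbertRep (MinTensor A B) := ⟨_, π.spatialHom ρ⟩
  let σ' : HilbertRep (MinTensor B C) := ⟨_, ρ.spatialHom τ⟩
  have hσ : Function.Injective σ.π := HilbertRep.spatialHom_injective hπ hρ
  let i : π.H ⊗[ℂ] ρ.H →ₗᵢ[ℂ] σ.H := toComplₗᵢ
  let j : ρ.H ⊗[ℂ] τ.H →ₗᵢ[ℂ] σ'.H := toComplₗᵢ
  have hi : DenseRange i := denseRange_coe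
  rw [ofLeft, LinearMap.comp_apply, norm_of, minTensorNorm_eq_of_injective hσ hτ, ofRight,
    LinearMap.comp_apply, norm_of]
  refine le_trans ?_ (norm_tensor_le_minTensorNorm π σ' _)
  exact opNorm_le_of_intertwine (denseRange_rTensor hi) _ (tensor_intertwine i j
    (HilbertRep.spatialHom_of π ρ) (HilbertRep.spatialHom_of ρ τ) t)

/-- The defining property of the associator, which extends the identity of the algebraic threefold
tensor product by continuity. -/
theorem tensorAssoc_tmul (a : A) (b : B) (c : C) :
    tensorAssoc A B C (tmul a (tmul b c)) = tmul (tmul a b) c := by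
  let F : MinTensor A (MinTensor B C) →L[ℂ] MinTensor (MinTensor A B) C :=
    LinearMap.extendOfNorm (ofLeft A B C) (ofRight A B C)
  have hF : ∀ a b c, F (tmul a (tmul b c)) = tmul (tmul a b) c := fun a b c => by
    rw [← ofRight_tmul, ← ofLeft_tmul]
    exact LinearMap.extendOfNorm_eq denseRange_ofRight ⟨1, fun x => by
      rw [one_mul]; exact norm_ofLeft_le x⟩ _
  let α : MinTensor A (MinTensor B C) →⋆ₙₐ[ℂ] MinTensor (MinTensor A B) C :=
    { F with
      map_zero' := F.map_zero
      map_mul' := fun x y => by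
        change F (x * y) = F x * F y
        induction x using induction_tmul_tmul with
        | hc => exact isClosed_eq (by fun_prop) (by fun_prop)
        | hadd x x' hx hx' => rw [add_mul, map_add, hx, hx', map_add, add_mul]
        | h a b c =>
          induction y using induction_tmul_tmul with
          | hc => exact isClosed_eq (by fun_prop) (by fun_prop)
          | hadd x x' hx hx' => rw [mul_add, map_add, hx, hx', map_add, mul_add]
          | h a' b' c' => simp only [tmul_mul_tmul, hF]
      map_star' := fun x => by
        change F (star x) = star (F x)
        induction x using induction_tmul_tmul with
        | hc => exact isClosed_eq (by fun_prop) (by fun_prop)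
        | hadd x x' hx hx' => rw [star_add, map_add, hx, hx', map_add, star_add]
        | h a b c => simp only [star_tmul, hF] }
  exact Classical.epsilon_spec (p := fun α : MinTensor A (MinTensor B C) →⋆ₙₐ[ℂ]
    MinTensor (MinTensor A B) C => ∀ (a : A) (b : B) (c : C),
      α (tmul a (tmul b c)) = tmul (tmul a b) c) ⟨α, hF⟩ a b c

end Associator

/-! ### Strict extensions -/

section Strict

variable {A B : Type u} [NonUnitalCStarAlgebra A] [NonUnitalCStarAlgebra B]

/-- The closed linear span `[φ(A)B]`. -/
noncomputable def actionSpan (φ : A →⋆ₙₐ[ℂ] 𝓜(ℂ, B)) : Submodule ℂ B :=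
  (Submodule.span ℂ {y | ∃ (a : A) (b : B), y = (φ a).fst b}).topologicalClosure

/-- The projection `p` is the support of `φ`: it acts as the identity on `φ(A)` and maps `B` into
`[φ(A)B]`.  This is how strictness of `φ` is used below. -/
structure HasSupport (φ : A →⋆ₙₐ[ℂ] 𝓜(ℂ, B)) (p : 𝓜(ℂ, B)) : Prop where
  star_eq : star p = p
  mul_eq : ∀ a, p * φ a = φ a
  mem : ∀ b, p.fst b ∈ actionSpan φ

variable (A) in
theorem exists_approximateUnit : ∃ l : Filter A, l.NeBot ∧ (∀ a, Tendsto (fun e => e * a) l (𝓝 a)) ∧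
    (∀ a, Tendsto (fun e => a * e) l (𝓝 a)) ∧ (∀ᶠ e in l, ‖e‖ ≤ 1) ∧ ∀ᶠ e in l, star e = e := by
  let _ := CStarAlgebra.spectralOrder A
  let _ := CStarAlgebra.spectralOrderedRing A
  have h := CStarAlgebra.increasingApproximateUnit A
  exact ⟨_, h.neBot, h.tendsto_mul_right, h.tendsto_mul_left, h.eventually_norm,
    h.eventually_star_eq⟩

theorem norm_fst_apply_le (m : 𝓜(ℂ, B)) (b : B) : ‖m.fst b‖ ≤ ‖m‖ * ‖b‖ := by
  rw [← DoubleCentralizer.norm_fst]; exact m.fst.le_opNorm b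

theorem star_fst_mul (m : 𝓜(ℂ, B)) (x y : B) :
    star ((star m).fst x) * y = star x * m.fst y := by
  rw [DoubleCentralizer.star_fst, star_star, m.central]

theorem fst_mem_actionSpan (φ : A →⋆ₙₐ[ℂ] 𝓜(ℂ, B)) (a : A) (b : B) :
    (φ a).fst b ∈ actionSpan φ :=
  Submodule.le_topologicalClosure _ (Submodule.subset_span ⟨a, b, rfl⟩)

/-- Continuous linear maps that agree on `φ(A)B` agree on `[φ(A)B]`. -/
theorem eqOn_actionSpan {φ : A →⋆ₙₐ[ℂ] 𝓜(ℂ, B)} {E : Type*} [NormedAddCommGroup E]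
    [NormedSpace ℂ E] {S T : B →L[ℂ] E} (h : ∀ a b, S ((φ a).fst b) = T ((φ a).fst b)) {k : B}
    (hk : k ∈ actionSpan φ) : S k = T k := by
  have h1 : Submodule.span ℂ {y | ∃ (a : A) (b : B), y = (φ a).fst b} ≤ LinearMap.eqLocus S T :=
    Submodule.span_le.mpr (by rintro _ ⟨a, b, rfl⟩; exact h a b)
  exact Submodule.topologicalClosure_minimal _ h1 (isClosed_eq S.continuous T.continuous) hk

theorem tendsto_actionSpan {φ : A →⋆ₙₐ[ℂ] 𝓜(ℂ, B)} {ι : Type*} {l : Filter ι}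
    {T : ι → B →L[ℂ] B} {T₀ : B →L[ℂ] B} {M : ℝ} (hM : ∀ᶠ i in l, ‖T i‖ ≤ M)
    (h : ∀ a b, Tendsto (fun i => T i ((φ a).fst b)) l (𝓝 (T₀ ((φ a).fst b)))) {k : B}
    (hk : k ∈ actionSpan φ) : Tendsto (fun i => T i k) l (𝓝 (T₀ k)) := by
  have h1 : ∀ k ∈ Submodule.span ℂ {y | ∃ (a : A) (b : B), y = (φ a).fst b},
      Tendsto (fun i => T i k) l (𝓝 (T₀ k)) := fun k hk => by
    induction hk using Submodule.span_induction with
    | mem x hx => obtain ⟨a, b, rfl⟩ := hx; exact h a b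
    | zero => simpa using! tendsto_const_nhds
    | add x y _ _ hx hy => simpa only [map_add] using hx.add hy
    | smul c x _ hx => simpa only [map_smul] using hx.const_smul c
  rw [Metric.tendsto_nhds]
  intro ε hε
  set N := |M| + ‖T₀‖ + 1 with hN
  have hN0 : 0 < N := by positivity
  obtain ⟨k', hk', hd⟩ := Metric.mem_closure_iff.mp hk (ε / 2 / N) (by positivity)
  filter_upwards [hM, Metric.tendsto_nhds.mp (h1 k' hk') (ε / 2) (by positivity)] with i hi hi'
  rw [dist_eq_norm] at hd hi' ⊢
  have e : T i k - T₀ k = T i (k - k') - T₀ (k - k') + (T i k' - T₀ k') := by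
    simp only [map_sub]; abel
  have hd' : N * ‖k - k'‖ < ε / 2 := by rwa [lt_div_iff₀' hN0] at hd
  have b1 : ‖T i (k - k')‖ ≤ |M| * ‖k - k'‖ :=
    (T i).le_of_opNorm_le (hi.trans (le_abs_self M)) _
  have b2 : ‖T₀ (k - k')‖ ≤ ‖T₀‖ * ‖k - k'‖ := T₀.le_opNorm _
  have b3 := norm_nonneg (k - k')
  rw [e]
  calc _ ≤ ‖T i (k - k') - T₀ (k - k')‖ + ‖T i k' - T₀ k'‖ := norm_add_le _ _
    _ ≤ ‖T i (k - k')‖ + ‖T₀ (k - k')‖ + ‖T i k' - T₀ k'‖ := by gcongr; exact norm_sub_le _ _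
    _ < ε := by nlinarith

theorem exists_tendsto_actionSpan {φ : A →⋆ₙₐ[ℂ] 𝓜(ℂ, B)} {ι : Type*} {l : Filter ι} [l.NeBot]
    {T : ι → B →L[ℂ] B} {M : ℝ} (hM : ∀ᶠ i in l, ‖T i‖ ≤ M)
    (h : ∀ a b, ∃ y, Tendsto (fun i => T i ((φ a).fst b)) l (𝓝 y)) {k : B}
    (hk : k ∈ actionSpan φ) : ∃ y, Tendsto (fun i => T i k) l (𝓝 y) := by
  -- apply the previous lemma to the differences `T i - T j`
  rw [← cauchy_map_iff_exists_tendsto, cauchy_map_iff, uniformity_eq_comap_nhds_zero,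
    tendsto_comap_iff]
  refine ⟨inferInstance, ?_⟩
  have h2 := tendsto_actionSpan (φ := φ) (l := l ×ˢ l) (T := fun q : ι × ι => T q.2 - T q.1)
    (T₀ := 0) (M := M + M) ?_ ?_ hk
  · simpa using! h2
  · filter_upwards [hM.prod_mk hM] with q hq
    exact (norm_sub_le _ _).trans (add_le_add hq.2 hq.1)
  · intro a b
    obtain ⟨y, hy⟩ := h a b
    simpa using! (hy.comp tendsto_snd).sub (hy.comp tendsto_fst)

theorem continuous_fst_fst (φ : A →⋆ₙₐ[ℂ] 𝓜(ℂ, B)) (b : B) :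
    Continuous fun a => (φ a).fst b := (continuous_fst_apply b).comp φ.continuous

namespace HasSupport

variable {φ : A →⋆ₙₐ[ℂ] 𝓜(ℂ, B)} {p : 𝓜(ℂ, B)}

theorem mul_eq' (h : HasSupport φ p) (a : A) : φ a * p = φ a := by
  have := congrArg star (h.mul_eq (star a))
  rwa [star_mul, map_star, star_star, h.star_eq] at this

theorem fst_eq (h : HasSupport φ p) {k : B} (hk : k ∈ actionSpan φ) : p.fst k = k :=
  eqOn_actionSpan (T := ContinuousLinearMap.id ℂ B) (fun a b => by
    rw [← mul_fst_apply, h.mul_eq]; rfl) hk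

theorem mul_self (h : HasSupport φ p) : p * p = p := multiplier_ext fun b => h.fst_eq (h.mem b)

/-- Two multipliers supported on `p` are equal if they agree on `φ(A)B`. -/
theorem ext (h : HasSupport φ p) {m n : 𝓜(ℂ, B)} (hm : m * p = m) (hn : n * p = n)
    (heq : ∀ a, m * φ a = n * φ a) : m = n := by
  rw [← hm, ← hn]
  refine multiplier_ext fun b => ?_
  rw [mul_fst_apply, mul_fst_apply]
  exact eqOn_actionSpan (fun a b => by rw [← mul_fst_apply, heq, mul_fst_apply]) (h.mem b)

theorem congr_right {ψ : A →⋆ₙₐ[ℂ] 𝓜(ℂ, B)} {q : 𝓜(ℂ, B)} (h : HasSupport φ p) (h1 : φ = ψ)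
    (h2 : p = q) : HasSupport ψ q := h1 ▸ h2 ▸ h

end HasSupport

/-- Convergence for the strict topology. -/
theorem tendsto_strict_iff {ι : Type*} {l : Filter ι} {f : ι → 𝓜(ℂ, B)} {m : 𝓜(ℂ, B)} :
    Tendsto f l (@nhds _ (strictTopology B) m) ↔ ∀ b,
      Tendsto (fun i => (f i).fst b) l (𝓝 (m.fst b)) ∧
        Tendsto (fun i => (f i).snd b) l (𝓝 (m.snd b)) := by
  rw [nhds_induced, tendsto_comap_iff, tendsto_pi_nhds]
  refine forall_congr' fun b => ?_
  rw [nhds_prod_eq, tendsto_prod_iff']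
  rfl

theorem snd_eq_star (m : 𝓜(ℂ, B)) (b : B) : m.snd b = star ((star m).fst (star b)) := by
  rw [DoubleCentralizer.star_fst, star_star, star_star]

/-- A ⋆-homomorphism with a support extends to the multiplier algebra. -/
theorem HasSupport.exists_extension {φ : A →⋆ₙₐ[ℂ] 𝓜(ℂ, B)} {p : 𝓜(ℂ, B)}
    (h : HasSupport φ p) : ∃ Φ : 𝓜(ℂ, A) →⋆ₙₐ[ℂ] 𝓜(ℂ, B), (∀ a, Φ (toMul A a) = φ a) ∧
      @ContinuousOn _ _ (strictTopology A) (strictTopology B) Φ (Metric.closedBall 0 1) := by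
  obtain ⟨l, hl, hr, -, hn, hs⟩ := exists_approximateUnit A
  have bound : ∀ a : A, ‖(φ a).fst‖ ≤ ‖a‖ := fun a => by
    rw [DoubleCentralizer.norm_fst]; exact NonUnitalStarAlgHom.norm_apply_le _ _
  have hφp : ∀ a b, (φ a).fst b = (φ a).fst (p.fst b) := fun a b => by
    rw [← mul_fst_apply, h.mul_eq']
  have hb : ∀ m : 𝓜(ℂ, A), ∀ᶠ e in l, ‖(φ (m.fst e)).fst‖ ≤ ‖m‖ := fun m => by
    filter_upwards [hn] with e he
    refine (bound _).trans ((norm_fst_apply_le m e).trans ?_)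
    exact mul_le_of_le_one_right (norm_nonneg _) he
  have hconv : ∀ (m : 𝓜(ℂ, A)) (a : A) (b : B), Tendsto (fun e => (φ (m.fst e)).fst ((φ a).fst b))
      l (𝓝 ((φ (m.fst a)).fst b)) := fun m a b => by
    have h1 := (((continuous_fst_fst φ b).comp m.fst.continuous).tendsto a).comp (hr a)
    refine h1.congr fun e => ?_
    simp only [Function.comp_apply]
    rw [fst_mul, map_mul, mul_fst_apply]
  have hex : ∀ (m : 𝓜(ℂ, A)) (b : B), ∃ y, Tendsto (fun e => (φ (m.fst e)).fst b) l (𝓝 y) :=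
    fun m b => by
      simp only [hφp _ b]
      exact exists_tendsto_actionSpan (T := fun e => (φ (m.fst e)).fst) (hb m)
        (fun a b => ⟨_, hconv m a b⟩) (h.mem b)
  choose L hL using hex
  let T : 𝓜(ℂ, A) → B →L[ℂ] B := fun m => LinearMap.mkContinuous
    { toFun := L m
      map_add' := fun x y => tendsto_nhds_unique (hL m (x + y)) (by
        simpa only [map_add] using (hL m x).add (hL m y))
      map_smul' := fun c x => tendsto_nhds_unique (hL m (c • x)) (by
        simpa only [map_smul] using! (hL m x).const_smul c) } ‖m‖ fun x => by
    refine le_of_tendsto (hL m x).norm ?_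
    filter_upwards [hb m] with e he
    exact (φ (m.fst e)).fst.le_of_opNorm_le he x
  have hT : ∀ m b, Tendsto (fun e => (φ (m.fst e)).fst b) l (𝓝 (T m b)) := hL
  have hTφ : ∀ m a b, T m ((φ a).fst b) = (φ (m.fst a)).fst b := fun m a b =>
    tendsto_nhds_unique (hT m _) (hconv m a b)
  have hTp : ∀ m b, T m (p.fst b) = T m b := fun m b =>
    tendsto_nhds_unique (hT m _) (by simp only [← hφp]; exact hT m b)
  have hText : ∀ (m : 𝓜(ℂ, A)) (S : B →L[ℂ] B), (∀ b, S (p.fst b) = S b) →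
      (∀ a b, S ((φ a).fst b) = (φ (m.fst a)).fst b) → ∀ b, T m b = S b := fun m S h1 h2 b => by
    rw [← hTp, ← h1]
    exact eqOn_actionSpan (fun a b => by rw [hTφ, h2]) (h.mem b)
  have hadj : ∀ m x y, star (T (star m) x) * y = star x * T m y := fun m x y => by
    have h1 : Tendsto (fun e => star ((φ ((star m).fst e)).fst x) * y) l
        (𝓝 (star (T (star m) x) * y)) := ((hT (star m) x).star).mul_const y
    have h2 : Tendsto (fun e => (φ (m.snd e)).fst (p.fst y)) l (𝓝 (T m (p.fst y))) := by
      refine tendsto_actionSpan (φ := φ) (T := fun e => (φ (m.snd e)).fst) (M := ‖m‖) ?_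
        (fun a b => ?_) (h.mem y)
      · filter_upwards [hn] with e he
        refine (bound _).trans ((m.snd.le_opNorm e).trans ?_)
        rw [DoubleCentralizer.norm_snd]
        exact mul_le_of_le_one_right (norm_nonneg _) he
      · rw [hTφ]
        refine (((continuous_fst_fst φ b).tendsto _).comp (hr (m.fst a))).congr fun e => ?_
        simp only [Function.comp_apply]
        rw [← m.central, map_mul, mul_fst_apply]
    simp only [← hφp, hTp] at h2
    refine tendsto_nhds_unique h1 ((h2.const_mul (star x)).congr' ?_)
    filter_upwards [hs] with e he
    rw [← star_fst_mul, ← map_star φ, snd_eq_star, star_star, he]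
  let Φ : 𝓜(ℂ, A) →⋆ₙₐ[ℂ] 𝓜(ℂ, B) :=
    { toFun := fun m => multiplierOfAdjoint (T m) (T (star m)) (hadj m)
      map_smul' := fun c m => multiplier_ext (hText _ (c • T m)
        (fun b => by simp only [smul_apply, hTp]) (fun a b => by
          simp only [smul_apply, hTφ, DoubleCentralizer.smul_fst, map_smul]))
      map_zero' := multiplier_ext (hText _ 0 (fun b => by simp) (fun a b => by simp))
      map_add' := fun m n => multiplier_ext (hText _ (T m + T n)
        (fun b => by simp only [add_apply, hTp]) (fun a b => by
          simp only [add_apply, hTφ, DoubleCentralizer.add_fst, map_add]))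
      map_mul' := fun m n => multiplier_ext (hText _ (T m * T n)
        (fun b => by
          change T m (T n (p.fst b)) = T m (T n b)
          rw [hTp]) (fun a b => by
          change T m (T n _) = _
          rw [hTφ, hTφ]; rfl))
      map_star' := fun m => multiplier_ext fun b => by
        rw [DoubleCentralizer.star_fst]
        change T (star m) b = star (star (T (star m) (star (star b))))
        rw [star_star, star_star] }
  have hfst : ∀ m b, (Φ m).fst b = T m b := fun _ _ => rfl
  refine ⟨Φ, fun a => multiplier_ext fun b => ?_, fun m hm => ?_⟩
  · rw [hfst]
    exact hText _ (φ a).fst (fun b => (hφp a b).symm) (fun a' b => by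
      rw [toMul_fst, map_mul, mul_fst_apply]) b
  · change Tendsto Φ (@nhdsWithin _ (strictTopology A) m _) (@nhds _ (strictTopology B) (Φ m))
    have h1 : Tendsto id (@nhdsWithin _ (strictTopology A) m (Metric.closedBall 0 1))
        (@nhds _ (strictTopology A) m) := by
      rw [tendsto_id']; exact inf_le_left
    have h2 : ∀ᶠ n in @nhdsWithin _ (strictTopology A) m (Metric.closedBall 0 1), ‖n‖ ≤ 1 := by
      have : Metric.closedBall 0 1 ∈ @nhdsWithin _ (strictTopology A) m (Metric.closedBall 0 1) :=
        mem_inf_of_right (mem_principal_self _)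
      filter_upwards [this] with n hn
      simpa using hn
    rw [tendsto_strict_iff] at h1 ⊢
    have hTn : ∀ n, ‖T n‖ ≤ ‖n‖ := fun n => LinearMap.mkContinuous_norm_le _ (norm_nonneg _) _
    refine fun b => ⟨?_, ?_⟩
    · simp only [hfst, ← hTp _ b]
      refine tendsto_actionSpan (φ := φ) (M := 1) (h2.mono fun n hn => (hTn n).trans hn)
        (fun a b => ?_) (h.mem b)
      simp only [hTφ]
      exact ((continuous_fst_fst φ b).tendsto _).comp (h1 a).1
    · simp only [snd_eq_star, ← map_star, hfst, ← hTp _ (star b)]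
      refine Tendsto.star ?_
      refine tendsto_actionSpan (φ := φ) (T := fun n => T (star n)) (M := 1)
        (h2.mono fun n hn => (hTn _).trans (by rwa [norm_star])) (fun a b => ?_) (h.mem _)
      simp only [hTφ]
      refine ((continuous_fst_fst φ b).tendsto _).comp ?_
      simp only [DoubleCentralizer.star_fst]
      exact (h1 (star a)).2.star

theorem HasSupport.strictExt_spec {φ : A →⋆ₙₐ[ℂ] 𝓜(ℂ, B)} {p : 𝓜(ℂ, B)} (h : HasSupport φ p) :
    (∀ a, strictExt φ (toMul A a) = φ a) ∧
      @ContinuousOn _ _ (strictTopology A) (strictTopology B) (strictExt φ)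
        (Metric.closedBall 0 1) :=
  Classical.epsilon_spec (p := fun Φ : 𝓜(ℂ, A) →⋆ₙₐ[ℂ] 𝓜(ℂ, B) => (∀ a, Φ (toMul A a) = φ a) ∧
    @ContinuousOn _ _ (strictTopology A) (strictTopology B) Φ (Metric.closedBall 0 1))
    h.exists_extension

theorem HasSupport.strictExt_toMul {φ : A →⋆ₙₐ[ℂ] 𝓜(ℂ, B)} {p : 𝓜(ℂ, B)} (h : HasSupport φ p)
    (a : A) : strictExt φ (toMul A a) = φ a := h.strictExt_spec.1 a

theorem HasSupport.strictExt_one {φ : A →⋆ₙₐ[ℂ] 𝓜(ℂ, B)} {p : 𝓜(ℂ, B)} (h : HasSupport φ p) :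
    strictExt φ 1 = p := by
  obtain ⟨l, hl, hr, hlt, hn, -⟩ := exists_approximateUnit A
  have h0 : (1 : 𝓜(ℂ, A)) ∈ Metric.closedBall (0 : 𝓜(ℂ, A)) 1 := by
    rw [mem_closedBall_zero_iff, ← DoubleCentralizer.norm_fst]
    exact ContinuousLinearMap.norm_id_le
  have h1 : Tendsto (toMul A) l (@nhdsWithin _ (strictTopology A) 1 (Metric.closedBall 0 1)) := by
    refine tendsto_inf.mpr ⟨tendsto_strict_iff.mpr fun a => ⟨hr a, hlt a⟩, ?_⟩
    rw [tendsto_principal]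
    filter_upwards [hn] with e he
    rw [mem_closedBall_zero_iff]
    exact (NonUnitalStarAlgHom.norm_apply_le _ _).trans he
  have hc : Tendsto (strictExt φ) (@nhdsWithin _ (strictTopology A) 1 (Metric.closedBall 0 1))
    (@nhds _ (strictTopology B) (strictExt φ 1)) := h.strictExt_spec.2 1 h0
  have h2 := tendsto_strict_iff.mp (hc.comp h1)
  refine multiplier_ext fun b => tendsto_nhds_unique (h2 b).1 ?_
  simp only [Function.comp_apply, h.strictExt_toMul]
  have h3 : ∀ a, (φ a).fst b = (φ a).fst (p.fst b) := fun a => by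
    rw [← mul_fst_apply, h.mul_eq']
  simp only [h3]
  refine tendsto_actionSpan (φ := φ) (T := fun a => (φ a).fst) (M := 1)
    (T₀ := ContinuousLinearMap.id ℂ B) ?_ (fun a b => ?_) (h.mem b)
  · filter_upwards [hn] with e he
    rw [DoubleCentralizer.norm_fst]
    exact (NonUnitalStarAlgHom.norm_apply_le _ _).trans he
  · refine (((continuous_fst_fst φ b).tendsto a).comp (hr a)).congr fun e => ?_
    simp only [Function.comp_apply, map_mul, mul_fst_apply]

/-- A strict ⋆-homomorphism has a support: the strict limit of the images of an approximate
unit. -/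
theorem IsStrict.exists_hasSupport {φ : A →⋆ₙₐ[ℂ] 𝓜(ℂ, B)} (h : IsStrict φ) :
    ∃ p, HasSupport φ p := by
  obtain ⟨l, hl, hr, hlt, hn, hs⟩ := exists_approximateUnit A
  have h0 : Tendsto φ (@nhdsWithin _ ((strictTopology A).induced (toMul A)) 0
      (Metric.closedBall 0 1)) (@nhds _ (strictTopology B) (φ 0)) :=
    h 0 (by simp)
  have h1 : Tendsto (fun q : A × A => (2⁻¹ : ℂ) • (q.2 - q.1)) (l ×ˢ l)
      (@nhdsWithin _ ((strictTopology A).induced (toMul A)) 0 (Metric.closedBall 0 1)) := by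
    refine tendsto_inf.mpr ⟨?_, ?_⟩
    · rw [@nhds_induced _ _ (strictTopology A), tendsto_comap_iff, tendsto_strict_iff]
      intro a
      constructor
      · have := (((hr a).comp tendsto_snd).sub ((hr a).comp tendsto_fst)).const_smul (2⁻¹ : ℂ)
        simpa [sub_mul, smul_mul_assoc] using! this
      · have := (((hlt a).comp tendsto_snd).sub ((hlt a).comp tendsto_fst)).const_smul (2⁻¹ : ℂ)
        simpa [mul_sub, mul_smul_comm] using! this
    · rw [tendsto_principal]
      filter_upwards [hn.prod_mk hn] with q hq
      rw [mem_closedBall_zero_iff, norm_smul]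
      have := norm_sub_le q.2 q.1
      norm_num
      linarith [hq.1, hq.2]
  have hex : ∀ b, ∃ y, Tendsto (fun e => (φ e).fst b) l (𝓝 y) := fun b => by
    rw [← cauchy_map_iff_exists_tendsto, cauchy_map_iff, uniformity_eq_comap_nhds_zero,
      tendsto_comap_iff]
    refine ⟨inferInstance, ?_⟩
    have h2 := ((tendsto_strict_iff.mp (h0.comp h1) b).1).const_smul (2 : ℂ)
    simpa [smul_smul] using! h2
  choose L hL using hex
  let P : B →L[ℂ] B := LinearMap.mkContinuous
    { toFun := L
      map_add' := fun x y => tendsto_nhds_unique (hL (x + y)) (by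
        simpa only [map_add] using (hL x).add (hL y))
      map_smul' := fun c x => tendsto_nhds_unique (hL (c • x)) (by
        simpa only [map_smul] using! (hL x).const_smul c) } 1 fun x => by
    refine le_of_tendsto (hL x).norm ?_
    filter_upwards [hn] with e he
    refine (φ e).fst.le_of_opNorm_le ?_ x
    rw [DoubleCentralizer.norm_fst]
    exact (NonUnitalStarAlgHom.norm_apply_le _ _).trans he
  have hP : ∀ b, Tendsto (fun e => (φ e).fst b) l (𝓝 (P b)) := hL
  have hadj : ∀ x y, star (P x) * y = star x * P y := fun x y => by
    refine tendsto_nhds_unique ((hP x).star.mul_const y) (((hP y).const_mul (star x)).congr' ?_)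
    filter_upwards [hs] with e he
    rw [← star_fst_mul, ← map_star φ, he]
  refine ⟨multiplierOfAdjoint P P hadj, multiplier_ext fun b => ?_, fun a => multiplier_ext
    fun b => ?_, fun b => ?_⟩
  · rw [DoubleCentralizer.star_fst]
    change star (star (P (star (star b)))) = P b
    rw [star_star, star_star]
  · rw [mul_fst_apply, multiplierOfAdjoint_fst]
    refine tendsto_nhds_unique (hP _) ?_
    refine (((continuous_fst_fst φ b).tendsto a).comp (hr a)).congr fun e => ?_
    simp only [Function.comp_apply, map_mul, mul_fst_apply]
  · exact (Submodule.isClosed_topologicalClosure _).mem_of_tendsto (hP b)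
      (Eventually.of_forall fun e => fst_mem_actionSpan φ e b)

end Strict

/-! ### Normal homomorphisms of multiplier algebras -/

section Normal

variable {A B C : Type u} [NonUnitalCStarAlgebra A] [NonUnitalCStarAlgebra B]
  [NonUnitalCStarAlgebra C]

open MinTensor

theorem map_mem_of_mem_actionSpan {φ : A →⋆ₙₐ[ℂ] 𝓜(ℂ, B)} {E : Type*} [NormedAddCommGroup E]
    [NormedSpace ℂ E] (T : B →L[ℂ] E) {K : Submodule ℂ E} (hK : IsClosed (K : Set E))
    (h : ∀ a b, T ((φ a).fst b) ∈ K) {k : B} (hk : k ∈ actionSpan φ) : T k ∈ K := by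
  have h1 : Submodule.span ℂ {y | ∃ (a : A) (b : B), y = (φ a).fst b} ≤
      K.comap (T : B →ₗ[ℂ] E) :=
    Submodule.span_le.mpr (by rintro _ ⟨a, b, rfl⟩; exact h a b)
  exact Submodule.topologicalClosure_minimal _ h1 (hK.preimage T.continuous) hk

theorem isClosed_actionSpan (φ : A →⋆ₙₐ[ℂ] 𝓜(ℂ, B)) : IsClosed (actionSpan φ : Set B) :=
  Submodule.isClosed_topologicalClosure _

/-- A ⋆-homomorphism `M(A) → M(B)` is normal if `Ψ(1)` is the support of its restriction to `A`;
equivalently, if it is the strict extension of this restriction. -/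
def IsNormal (Ψ : 𝓜(ℂ, A) →⋆ₙₐ[ℂ] 𝓜(ℂ, B)) : Prop := HasSupport (Ψ.comp (toMul A)) (Ψ 1)

theorem map_one_mul (Ψ : 𝓜(ℂ, A) →⋆ₙₐ[ℂ] 𝓜(ℂ, B)) (m : 𝓜(ℂ, A)) : Ψ 1 * Ψ m = Ψ m := by
  rw [← map_mul, one_mul]

theorem map_mul_one (Ψ : 𝓜(ℂ, A) →⋆ₙₐ[ℂ] 𝓜(ℂ, B)) (m : 𝓜(ℂ, A)) : Ψ m * Ψ 1 = Ψ m := by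
  rw [← map_mul, mul_one]

/-- A normal homomorphism determines every homomorphism that it dominates on `A`. -/
theorem IsNormal.eq_one_mul {Ψ Ψ' : 𝓜(ℂ, A) →⋆ₙₐ[ℂ] 𝓜(ℂ, B)} (h : IsNormal Ψ')
    (h1 : Ψ 1 * Ψ' 1 = Ψ 1) (he : ∀ a, Ψ 1 * Ψ' (toMul A a) = Ψ (toMul A a)) (m : 𝓜(ℂ, A)) :
    Ψ m = Ψ 1 * Ψ' m := by
  refine HasSupport.ext h ?_ ?_ fun a => ?_
  · rw [← map_mul_one Ψ m, mul_assoc, h1]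
  · rw [mul_assoc, map_mul_one]
  · change Ψ m * Ψ' (toMul A a) = Ψ 1 * Ψ' m * Ψ' (toMul A a)
    rw [mul_assoc, ← map_mul Ψ', mul_toMul, he, ← mul_toMul, map_mul, ← he, ← mul_assoc,
      map_mul_one]

theorem IsNormal.ext {Ψ Ψ' : 𝓜(ℂ, A) →⋆ₙₐ[ℂ] 𝓜(ℂ, B)} (h : IsNormal Ψ')
    (h1 : Ψ 1 = Ψ' 1) (he : ∀ a, Ψ (toMul A a) = Ψ' (toMul A a)) (m : 𝓜(ℂ, A)) :
    Ψ m = Ψ' m := by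
  rw [h.eq_one_mul (by rw [h1, map_mul_one]) (fun a => by rw [h1, map_one_mul, he]) m, h1,
    map_one_mul]

/-- On a tensor product it suffices to compare the restrictions to both legs. -/
theorem IsNormal.eq_one_mul_of_legs {Ψ Ψ' : 𝓜(ℂ, MinTensor A B) →⋆ₙₐ[ℂ] 𝓜(ℂ, C)}
    (h : IsNormal Ψ') (h1 : Ψ 1 * Ψ' 1 = Ψ 1)
    (hl : ∀ a, Ψ 1 * Ψ' (mulTmul (toMul A a) 1) = Ψ (mulTmul (toMul A a) 1))
    (hr : ∀ b, Ψ 1 * Ψ' (mulTmul 1 (toMul B b)) = Ψ (mulTmul 1 (toMul B b)))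
    (m : 𝓜(ℂ, MinTensor A B)) : Ψ m = Ψ 1 * Ψ' m := by
  have c1 := Ψ.continuous
  have c2 := Ψ'.continuous
  have c3 := (toMul (MinTensor A B)).continuous
  refine h.eq_one_mul h1 (fun x => ?_) m
  induction x using MinTensor.induction_tmul with
  | hc => exact isClosed_eq (by fun_prop) (by fun_prop)
  | hadd x y hx hy => rw [map_add, map_add, mul_add, hx, hy, map_add]
  | h a b =>
    rw [toMul_tmul, mulTmul_eq, map_mul, ← mul_assoc, hl, map_mul, ← hr, ← mul_assoc,
      map_mul_one]

theorem IsNormal.ext_of_legs {Ψ Ψ' : 𝓜(ℂ, MinTensor A B) →⋆ₙₐ[ℂ] 𝓜(ℂ, C)}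
    (h : IsNormal Ψ') (h1 : Ψ 1 = Ψ' 1)
    (hl : ∀ a, Ψ (mulTmul (toMul A a) 1) = Ψ' (mulTmul (toMul A a) 1))
    (hr : ∀ b, Ψ (mulTmul 1 (toMul B b)) = Ψ' (mulTmul 1 (toMul B b)))
    (m : 𝓜(ℂ, MinTensor A B)) : Ψ m = Ψ' m := by
  rw [h.eq_one_mul_of_legs (by rw [h1, map_mul_one]) (fun a => by rw [h1, map_one_mul, hl])
    (fun a => by rw [h1, map_one_mul, hr]) m, h1, map_one_mul]

theorem HasSupport.isNormal {φ : A →⋆ₙₐ[ℂ] 𝓜(ℂ, B)} {p : 𝓜(ℂ, B)} (h : HasSupport φ p) :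
    IsNormal (strictExt φ) :=
  h.congr_right (NonUnitalStarAlgHom.ext fun a => (h.strictExt_toMul a).symm) h.strictExt_one.symm

theorem IsNormal.strictExt_apply {Ψ : 𝓜(ℂ, A) →⋆ₙₐ[ℂ] 𝓜(ℂ, B)} (h : IsNormal Ψ) (m : 𝓜(ℂ, A)) :
    strictExt (Ψ.comp (toMul A)) m = Ψ m :=
  h.ext (HasSupport.strictExt_one h) (fun a => HasSupport.strictExt_toMul h a) m

theorem IsNormal.hasSupport_comp {Ψ : 𝓜(ℂ, B) →⋆ₙₐ[ℂ] 𝓜(ℂ, C)} (h : IsNormal Ψ)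
    {φ : A →⋆ₙₐ[ℂ] 𝓜(ℂ, B)} {p : 𝓜(ℂ, B)} (hφ : HasSupport φ p) :
    HasSupport (Ψ.comp φ) (Ψ p) where
  star_eq := by rw [← map_star, hφ.star_eq]
  mul_eq a := by rw [NonUnitalStarAlgHom.comp_apply, ← map_mul, hφ.mul_eq]
  mem c := by
    rw [← map_mul_one, mul_fst_apply]
    refine map_mem_of_mem_actionSpan (φ := Ψ.comp (toMul B)) (Ψ p).fst
      (isClosed_actionSpan _) (fun b c => ?_) (HasSupport.mem h c)
    rw [← mul_fst_apply, NonUnitalStarAlgHom.comp_apply, ← map_mul, mul_toMul]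
    let T : B →L[ℂ] C := LinearMap.mkContinuousOfExistsBound
      { toFun := fun b => (Ψ (toMul B b)).fst c
        map_add' := fun x y => by rw [map_add, map_add]; rfl
        map_smul' := fun z x => by rw [map_smul, map_smul]; rfl } ⟨‖c‖, fun b => by
      refine (norm_fst_apply_le _ _).trans ?_
      rw [mul_comm]
      gcongr
      exact (NonUnitalStarAlgHom.norm_apply_le Ψ _).trans
        (NonUnitalStarAlgHom.norm_apply_le (toMul B) b)⟩
    refine map_mem_of_mem_actionSpan (φ := φ) T (isClosed_actionSpan _) (fun a b => ?_) (hφ.mem b)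
    change (Ψ (toMul B ((φ a).fst b))).fst c ∈ _
    rw [← mul_toMul, map_mul, mul_fst_apply]
    exact fst_mem_actionSpan (Ψ.comp φ) a _

theorem IsNormal.comp {Ψ : 𝓜(ℂ, B) →⋆ₙₐ[ℂ] 𝓜(ℂ, C)} (h : IsNormal Ψ)
    {Φ : 𝓜(ℂ, A) →⋆ₙₐ[ℂ] 𝓜(ℂ, B)} (h' : IsNormal Φ) : IsNormal (Ψ.comp Φ) :=
  h.hasSupport_comp h'

theorem hasSupport_toMul_comp {f : A →⋆ₙₐ[ℂ] B} (hf : DenseRange f) :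
    HasSupport ((toMul B).comp f) 1 where
  star_eq := star_one _
  mul_eq a := one_mul _
  mem b := by
    obtain ⟨l, hl, hr, -, -, -⟩ := exists_approximateUnit B
    refine (isClosed_actionSpan _).mem_of_tendsto (hr b) (Eventually.of_forall fun e => ?_)
    refine hf.induction_on e ?_ fun a => fst_mem_actionSpan ((toMul B).comp f) a b
    exact (isClosed_actionSpan _).preimage (continuous_mul_const b)

variable (A) in
theorem hasSupport_toMul : HasSupport (toMul A) 1 :=
  (hasSupport_toMul_comp (f := NonUnitalStarAlgHom.id ℂ A)
    Function.surjective_id.denseRange).congr_right rfl rfl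

theorem strictExt_toMul_apply (m : 𝓜(ℂ, A)) : strictExt (toMul A) m = m :=
  IsNormal.strictExt_apply (Ψ := NonUnitalStarAlgHom.id ℂ 𝓜(ℂ, A)) (hasSupport_toMul A) m

theorem IsNondegenerate.hasSupport {φ : A →⋆ₙₐ[ℂ] 𝓜(ℂ, B)} (h : IsNondegenerate φ) :
    HasSupport φ 1 where
  star_eq := star_one _
  mul_eq a := one_mul _
  mem b := by
    change b ∈ (Submodule.span ℂ _).topologicalClosure
    rw [h]; trivial

/-- The support of a tensor product is the tensor product of the supports. -/
theorem HasSupport.homTensor {D : Type u} [NonUnitalCStarAlgebra D] {φ : A →⋆ₙₐ[ℂ] 𝓜(ℂ, C)}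
    {ψ : B →⋆ₙₐ[ℂ] 𝓜(ℂ, D)} {p : 𝓜(ℂ, C)} {q : 𝓜(ℂ, D)} (hφ : HasSupport φ p)
    (hψ : HasSupport ψ q) : HasSupport (homTensor φ ψ) (mulTmul p q) where
  star_eq := by rw [star_mulTmul, hφ.star_eq, hψ.star_eq]
  mul_eq x := by
    have c1 := (_root_.homTensor φ ψ).continuous
    induction x using MinTensor.induction_tmul with
    | hc => exact isClosed_eq (by fun_prop) (by fun_prop)
    | hadd x y hx hy => rw [map_add, mul_add, hx, hy]
    | h a b => rw [homTensor_tmul, mulTmul_mul, hφ.mul_eq, hψ.mul_eq]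
  mem x := by
    induction x using MinTensor.induction_tmul with
    | hc => exact (isClosed_actionSpan _).preimage (mulTmul p q).fst.continuous
    | hadd x y hx hy => rw [map_add]; exact add_mem hx hy
    | h c d =>
      rw [mulTmul_fst]
      refine map_mem_of_mem_actionSpan (tmulL C D (p.fst c)) (isClosed_actionSpan _)
        (fun b d => ?_) (hψ.mem d)
      refine map_mem_of_mem_actionSpan ((tmulL C D).flip ((ψ b).fst d)) (isClosed_actionSpan _)
        (fun a c => ?_) (hφ.mem c)
      rw [ContinuousLinearMap.flip_apply, tmulL_apply, ← mulTmul_fst, ← homTensor_tmul]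
      exact fst_mem_actionSpan _ _ _

/-- The strict extension of `φ ⊗ ψ` maps `m ⊗ n` to `φ(m) ⊗ ψ(n)`. -/
theorem strictExt_homTensor_mulTmul {D : Type u} [NonUnitalCStarAlgebra D]
    {φ : A →⋆ₙₐ[ℂ] 𝓜(ℂ, C)} {ψ : B →⋆ₙₐ[ℂ] 𝓜(ℂ, D)} {p : 𝓜(ℂ, C)} {q : 𝓜(ℂ, D)}
    (hφ : HasSupport φ p) (hψ : HasSupport ψ q) (m : 𝓜(ℂ, A)) (n : 𝓜(ℂ, B)) :
    strictExt (homTensor φ ψ) (mulTmul m n) = mulTmul (strictExt φ m) (strictExt ψ n) := by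
  have h := hφ.homTensor hψ
  have c1 := (homTensor φ ψ).continuous
  refine h.ext ?_ ?_ fun x => ?_
  · rw [← h.strictExt_one, map_mul_one]
  · rw [mulTmul_mul, ← hφ.strictExt_one, ← hψ.strictExt_one, map_mul_one, map_mul_one]
  · induction x using MinTensor.induction_tmul with
    | hc => exact isClosed_eq (by fun_prop) (by fun_prop)
    | hadd x y hx hy => rw [map_add, mul_add, hx, hy, mul_add]
    | h a b =>
      rw [← h.strictExt_toMul, ← map_mul, mul_toMul, mulTmul_fst, h.strictExt_toMul,
        homTensor_tmul, h.strictExt_toMul, homTensor_tmul, mulTmul_mul, ← hφ.strictExt_toMul a,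
        ← hψ.strictExt_toMul b, ← map_mul, ← map_mul, mul_toMul, mul_toMul, hφ.strictExt_toMul,
        hψ.strictExt_toMul]

end Normal

/-! ### Legs of threefold tensor products -/

section Legs

variable {A B C D : Type u} [NonUnitalCStarAlgebra A] [NonUnitalCStarAlgebra B]
  [NonUnitalCStarAlgebra C] [NonUnitalCStarAlgebra D]

open MinTensor

theorem denseRange_tensorAssoc : DenseRange (tensorAssoc A B C) := fun x => by
  let K := (tensorAssoc A B C).toCLM.toLinearMap.range.topologicalClosure
  change x ∈ K
  induction x using MinTensor.induction_tmul_tmul' with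
  | hc => exact Submodule.isClosed_topologicalClosure _
  | hadd x y hx hy => exact add_mem hx hy
  | h a b c =>
    exact Submodule.le_topologicalClosure _ ⟨tmul a (tmul b c), tensorAssoc_tmul a b c⟩

variable (A B C) in
/-- The isomorphism `M(A ⊗ (B ⊗ C)) → M((A ⊗ B) ⊗ C)`. -/
noncomputable def assocMul :
    𝓜(ℂ, MinTensor A (MinTensor B C)) →⋆ₙₐ[ℂ] 𝓜(ℂ, MinTensor (MinTensor A B) C) :=
  strictExt ((toMul _).comp (tensorAssoc A B C))

theorem hasSupport_tensorAssoc :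
    HasSupport ((toMul (MinTensor (MinTensor A B) C)).comp (tensorAssoc A B C)) 1 :=
  hasSupport_toMul_comp denseRange_tensorAssoc

theorem isNormal_assocMul : IsNormal (assocMul A B C) := hasSupport_tensorAssoc.isNormal

theorem assocMul_one : assocMul A B C 1 = 1 := hasSupport_tensorAssoc.strictExt_one

theorem assocMul_toMul (x : MinTensor A (MinTensor B C)) :
    assocMul A B C (toMul _ x) = toMul _ (tensorAssoc A B C x) :=
  hasSupport_tensorAssoc.strictExt_toMul x

theorem assocMul_mulTmul (m : 𝓜(ℂ, A)) (n : 𝓜(ℂ, B)) (k : 𝓜(ℂ, C)) :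
    assocMul A B C (mulTmul m (mulTmul n k)) = mulTmul (mulTmul m n) k := by
  have c1 := (toMul (MinTensor (MinTensor A B) C)).continuous
  have c2 := (tensorAssoc A B C).continuous
  refine (hasSupport_tensorAssoc (A := A) (B := B) (C := C)).ext (mul_one _) (mul_one _)
    fun x => ?_
  rw [NonUnitalStarAlgHom.comp_apply]
  induction x using MinTensor.induction_tmul_tmul with
  | hc => exact isClosed_eq (by fun_prop) (by fun_prop)
  | hadd x y hx hy => rw [map_add, map_add, mul_add, hx, hy, mul_add]
  | h a b c =>
    rw [← assocMul_toMul, ← map_mul, mul_toMul, mulTmul_fst, mulTmul_fst, assocMul_toMul,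
      tensorAssoc_tmul, assocMul_toMul, tensorAssoc_tmul, mul_toMul, mulTmul_fst, mulTmul_fst]

variable (A B) in
/-- The embedding `n ↦ 1 ⊗ n` of `M(B)` into `M(A ⊗ B)`. -/
noncomputable def mulInr : 𝓜(ℂ, B) →⋆ₙₐ[ℂ] 𝓜(ℂ, MinTensor A B) where
  toFun n := mulTmul 1 n
  map_smul' c n := multiplier_ext_tmul fun a b => by
    rw [DoubleCentralizer.smul_fst, smul_apply, mulTmul_fst, mulTmul_fst,
      ← tmulL_apply, ← tmulL_apply]
    exact map_smul _ _ _
  map_zero' := multiplier_ext_tmul fun a b => by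
    rw [mulTmul_fst, ← tmulL_apply]
    exact map_zero _
  map_add' m n := multiplier_ext_tmul fun a b => by
    rw [DoubleCentralizer.add_fst, add_apply, mulTmul_fst, mulTmul_fst, mulTmul_fst,
      ← tmulL_apply, ← tmulL_apply, ← tmulL_apply]
    exact map_add _ _ _
  map_mul' m n := by rw [mulTmul_mul, one_mul]
  map_star' m := by rw [star_mulTmul, star_one]

theorem mulInr_apply (n : 𝓜(ℂ, B)) : mulInr A B n = mulTmul 1 n := rfl

theorem isNormal_mulInr : IsNormal (mulInr A B) where
  star_eq := by rw [← map_star, star_one]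
  mul_eq b := map_one_mul _ _
  mem x := by
    rw [mulInr_apply, mulTmul_one_one, one_fst_apply]
    induction x using MinTensor.induction_tmul with
    | hc => exact isClosed_actionSpan _
    | hadd x y hx hy => exact add_mem hx hy
    | h a b =>
      refine map_mem_of_mem_actionSpan (tmulL A B a) (isClosed_actionSpan _) (fun b' b => ?_)
        ((hasSupport_toMul B).mem b)
      rw [tmulL_apply]
      convert fst_mem_actionSpan ((mulInr A B).comp (toMul B)) b' (tmul a b) using 1
      rw [NonUnitalStarAlgHom.comp_apply, mulInr_apply, mulTmul_fst, one_fst_apply]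

variable (A B C) in
/-- The embedding `X ↦ 1 ⊗ X` of `M(B ⊗ C)` into `M((A ⊗ B) ⊗ C)`. -/
noncomputable def mulInrAssoc : 𝓜(ℂ, MinTensor B C) →⋆ₙₐ[ℂ] 𝓜(ℂ, MinTensor (MinTensor A B) C) :=
  (assocMul A B C).comp (mulInr A (MinTensor B C))

theorem mulInrAssoc_apply (X : 𝓜(ℂ, MinTensor B C)) :
    mulInrAssoc A B C X = assocMul A B C (mulTmul 1 X) := rfl

theorem isNormal_mulInrAssoc : IsNormal (mulInrAssoc A B C) :=
  isNormal_assocMul.comp isNormal_mulInr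

theorem mulInrAssoc_mulTmul (m : 𝓜(ℂ, B)) (n : 𝓜(ℂ, C)) :
    mulInrAssoc A B C (mulTmul m n) = mulTmul (mulTmul 1 m) n :=
  assocMul_mulTmul 1 m n

theorem mulInrAssoc_one : mulInrAssoc A B C 1 = 1 := by
  rw [mulInrAssoc_apply, mulTmul_one_one, assocMul_one]

end Legs

/-! ### The maps `id ⊗ Δ` and `δ ⊗ id` on multipliers -/

section Comultiplication

variable {A B C : Type u} [NonUnitalCStarAlgebra A] [NonUnitalCStarAlgebra B]
  [NonUnitalCStarAlgebra C]

open MinTensor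

variable {Δ : A →⋆ₙₐ[ℂ] 𝓜(ℂ, MinTensor A A)}

variable (C) in
theorem isNormal_idTensor (hΔ : HasSupport Δ 1) : IsNormal (idTensor C Δ) :=
  isNormal_assocMul.comp ((hasSupport_toMul C).homTensor hΔ).isNormal

theorem idTensor_mulTmul (hΔ : HasSupport Δ 1) (m : 𝓜(ℂ, C)) (n : 𝓜(ℂ, A)) :
    idTensor C Δ (mulTmul m n) = assocMul C A A (mulTmul m (strictExt Δ n)) := by
  change assocMul C A A (strictExt _ _) = _
  rw [strictExt_homTensor_mulTmul (hasSupport_toMul C) hΔ, strictExt_toMul_apply]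

theorem idTensor_inl (hΔ : HasSupport Δ 1) (m : 𝓜(ℂ, C)) : idTensor C Δ (mulTmul m 1) = mulTmul (mulTmul m 1) 1 := by
  rw [idTensor_mulTmul hΔ, hΔ.strictExt_one, ← mulTmul_one_one, assocMul_mulTmul]

theorem idTensor_inr (hΔ : HasSupport Δ 1) (n : 𝓜(ℂ, A)) :
    idTensor C Δ (mulTmul 1 n) = mulInrAssoc C A A (strictExt Δ n) :=
  idTensor_mulTmul hΔ 1 n

variable (C) in
theorem idTensor_one (hΔ : HasSupport Δ 1) : idTensor C Δ 1 = 1 := by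
  rw [← mulTmul_one_one, idTensor_inl hΔ, mulTmul_one_one, mulTmul_one_one]

variable {φ : B →⋆ₙₐ[ℂ] 𝓜(ℂ, C)} {p : 𝓜(ℂ, C)}

/-- The support of `φ ⊗ id`. -/
theorem HasSupport.homTensor_toMul (h : HasSupport φ p) : HasSupport (_root_.homTensor φ (toMul A)) (mulTmul p 1) :=
  h.homTensor (hasSupport_toMul A)

theorem HasSupport.strictExt_homTensor_inl (h : HasSupport φ p) (m : 𝓜(ℂ, B)) :
    strictExt (_root_.homTensor φ (toMul A)) (mulTmul m 1) = mulTmul (strictExt φ m) 1 := by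
  rw [strictExt_homTensor_mulTmul h (hasSupport_toMul A), strictExt_toMul_apply]

theorem HasSupport.strictExt_homTensor_inr (h : HasSupport φ p) (n : 𝓜(ℂ, A)) :
    strictExt (_root_.homTensor φ (toMul A)) (mulTmul 1 n) = mulTmul p n := by
  rw [strictExt_homTensor_mulTmul h (hasSupport_toMul A), strictExt_toMul_apply, h.strictExt_one]

end Comultiplication

/-! ### Coassociativity on multipliers -/

section Coassociativity

variable {A B C : Type u} [NonUnitalCStarAlgebra A] [NonUnitalCStarAlgebra B]
  [NonUnitalCStarAlgebra C]

open MinTensor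

variable (A) in
/-- The map `Ψ ⊗ id : M(B ⊗ A) → M(C ⊗ A)` for a normal ⋆-homomorphism `Ψ : M(B) → M(C)`. -/
noncomputable def mulTensorId (Ψ : 𝓜(ℂ, B) →⋆ₙₐ[ℂ] 𝓜(ℂ, C)) :
    𝓜(ℂ, MinTensor B A) →⋆ₙₐ[ℂ] 𝓜(ℂ, MinTensor C A) :=
  strictExt (homTensor (Ψ.comp (toMul B)) (toMul A))

theorem IsNormal.mulTensorId_isNormal {Ψ : 𝓜(ℂ, B) →⋆ₙₐ[ℂ] 𝓜(ℂ, C)} (h : IsNormal Ψ) :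
    IsNormal (mulTensorId A Ψ) := (HasSupport.homTensor_toMul h).isNormal

theorem IsNormal.mulTensorId_mulTmul {Ψ : 𝓜(ℂ, B) →⋆ₙₐ[ℂ] 𝓜(ℂ, C)} (h : IsNormal Ψ)
    (m : 𝓜(ℂ, B)) (n : 𝓜(ℂ, A)) : mulTensorId A Ψ (mulTmul m n) = mulTmul (Ψ m) n := by
  rw [mulTensorId, strictExt_homTensor_mulTmul h (hasSupport_toMul A), strictExt_toMul_apply,
    h.strictExt_apply]

theorem IsNormal.mulTensorId_one {Ψ : 𝓜(ℂ, B) →⋆ₙₐ[ℂ] 𝓜(ℂ, C)} (h : IsNormal Ψ) :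
    mulTensorId A Ψ 1 = mulTmul (Ψ 1) 1 := by
  rw [← mulTmul_one_one, h.mulTensorId_mulTmul]

variable {Δ : A →⋆ₙₐ[ℂ] 𝓜(ℂ, MinTensor A A)}

variable (C) in
/-- The comultiplication is compatible with the embedding of `M(A ⊗ A)` into the last two legs. -/
theorem idTensor_mulInrAssoc (hΔ : HasSupport Δ 1) (X : 𝓜(ℂ, MinTensor A A)) :
    idTensor (MinTensor C A) Δ (mulInrAssoc C A A X) =
      mulTensorId A (mulInrAssoc C A A) (idTensor A Δ X) := by
  have hL : IsNormal (mulInrAssoc C A A) := isNormal_mulInrAssoc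
  have hLΔ : ∀ Y : 𝓜(ℂ, MinTensor A A), mulTensorId A (mulInrAssoc C A A) (mulInrAssoc A A A Y) =
      mulInrAssoc (MinTensor C A) A A Y := by
    refine IsNormal.ext_of_legs (Ψ := (mulTensorId A (mulInrAssoc C A A)).comp (mulInrAssoc A A A))
      isNormal_mulInrAssoc ?_ (fun a => ?_) fun a => ?_
    · rw [NonUnitalStarAlgHom.comp_apply, mulInrAssoc_one, mulInrAssoc_one, hL.mulTensorId_one,
        mulInrAssoc_one, mulTmul_one_one]
    · rw [NonUnitalStarAlgHom.comp_apply, mulInrAssoc_mulTmul, mulInrAssoc_mulTmul,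
        hL.mulTensorId_mulTmul, mulInrAssoc_mulTmul, mulTmul_one_one]
    · rw [NonUnitalStarAlgHom.comp_apply, mulInrAssoc_mulTmul, mulInrAssoc_mulTmul,
        hL.mulTensorId_mulTmul, mulTmul_one_one, mulTmul_one_one, mulInrAssoc_one]
  refine IsNormal.ext_of_legs (Ψ := (idTensor (MinTensor C A) Δ).comp (mulInrAssoc C A A))
    (Ψ' := (mulTensorId A (mulInrAssoc C A A)).comp (idTensor A Δ))
    (hL.mulTensorId_isNormal.comp (isNormal_idTensor A hΔ)) ?_ (fun a => ?_) (fun a => ?_) X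
  · rw [NonUnitalStarAlgHom.comp_apply, NonUnitalStarAlgHom.comp_apply, mulInrAssoc_one,
      idTensor_one _ hΔ, idTensor_one _ hΔ, hL.mulTensorId_one, mulInrAssoc_one, mulTmul_one_one]
  · rw [NonUnitalStarAlgHom.comp_apply, NonUnitalStarAlgHom.comp_apply, mulInrAssoc_mulTmul,
      idTensor_inl hΔ, idTensor_inl hΔ, hL.mulTensorId_mulTmul, mulInrAssoc_mulTmul]
  · rw [NonUnitalStarAlgHom.comp_apply, NonUnitalStarAlgHom.comp_apply, mulInrAssoc_mulTmul,
      mulTmul_one_one, idTensor_inr hΔ, idTensor_inr hΔ, hLΔ]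

/-- The map `id ⊗ Δ` satisfies `((id ⊗ Δ) ⊗ id)(id ⊗ Δ) = (id ⊗ id ⊗ Δ)(id ⊗ Δ)`. -/
theorem idTensor_coassoc (hΔ : HasSupport Δ 1)
    (hco : ∀ a, strictExt (tensorId Δ) (Δ a) = idTensor A Δ (Δ a)) (x : 𝓜(ℂ, MinTensor C A)) :
    mulTensorId A (idTensor C Δ) (idTensor C Δ x) =
      idTensor (MinTensor C A) Δ (idTensor C Δ x) := by
  have hL : IsNormal (mulInrAssoc C A A) := isNormal_mulInrAssoc
  have hΦ := isNormal_idTensor C hΔ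
  have hTL : ∀ X : 𝓜(ℂ, MinTensor A A), mulTensorId A (idTensor C Δ) (mulInrAssoc C A A X) =
      mulTensorId A (mulInrAssoc C A A) (strictExt (tensorId Δ) X) := by
    rw [tensorId]
    refine IsNormal.ext_of_legs (Ψ := (mulTensorId A (idTensor C Δ)).comp (mulInrAssoc C A A))
      (Ψ' := (mulTensorId A (mulInrAssoc C A A)).comp (strictExt (homTensor Δ (toMul A))))
      (hL.mulTensorId_isNormal.comp hΔ.homTensor_toMul.isNormal) ?_ (fun a => ?_) fun a => ?_
    · rw [NonUnitalStarAlgHom.comp_apply, NonUnitalStarAlgHom.comp_apply, mulInrAssoc_one,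
        hΔ.homTensor_toMul.strictExt_one, hL.mulTensorId_mulTmul, hΦ.mulTensorId_one,
        idTensor_one _ hΔ, mulInrAssoc_one]
    · rw [NonUnitalStarAlgHom.comp_apply, NonUnitalStarAlgHom.comp_apply, mulInrAssoc_mulTmul,
        hΦ.mulTensorId_mulTmul, hΔ.strictExt_homTensor_inl, hL.mulTensorId_mulTmul,
        idTensor_inr hΔ]
    · rw [NonUnitalStarAlgHom.comp_apply, NonUnitalStarAlgHom.comp_apply, mulInrAssoc_mulTmul,
        hΦ.mulTensorId_mulTmul, hΔ.strictExt_homTensor_inr, hL.mulTensorId_mulTmul,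
        mulTmul_one_one, idTensor_one _ hΔ, mulInrAssoc_one]
  refine IsNormal.ext_of_legs (Ψ := (mulTensorId A (idTensor C Δ)).comp (idTensor C Δ))
    (Ψ' := (idTensor (MinTensor C A) Δ).comp (idTensor C Δ))
    ((isNormal_idTensor _ hΔ).comp hΦ) ?_ (fun c => ?_) (fun a => ?_) x
  · rw [NonUnitalStarAlgHom.comp_apply, NonUnitalStarAlgHom.comp_apply, idTensor_one _ hΔ,
      idTensor_one _ hΔ, hΦ.mulTensorId_one, idTensor_one _ hΔ, mulTmul_one_one]
  · rw [NonUnitalStarAlgHom.comp_apply, NonUnitalStarAlgHom.comp_apply, idTensor_inl hΔ,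
      idTensor_inl hΔ, hΦ.mulTensorId_mulTmul, idTensor_inl hΔ]
  · rw [NonUnitalStarAlgHom.comp_apply, NonUnitalStarAlgHom.comp_apply, idTensor_inr hΔ,
      hΔ.strictExt_toMul, hTL, idTensor_mulInrAssoc C hΔ, hco]

/-- The maps `δ ⊗ id` and `id ⊗ Δ` act on different legs, so that they commute. -/
theorem mulTensorId_idTensor (hΔ : HasSupport Δ 1) {δ : C →⋆ₙₐ[ℂ] 𝓜(ℂ, MinTensor C A)}
    {p : 𝓜(ℂ, MinTensor C A)} (hδ : HasSupport δ p) (x : 𝓜(ℂ, MinTensor C A)) :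
    mulTensorId A (strictExt (tensorId δ)) (idTensor C Δ x) =
      idTensor (MinTensor C A) Δ (strictExt (tensorId δ) x) := by
  have hΦ := isNormal_idTensor C hΔ
  have hU : IsNormal (strictExt (tensorId δ)) := hδ.homTensor_toMul.isNormal
  have hU1 : strictExt (tensorId δ) 1 = mulTmul p 1 := hδ.homTensor_toMul.strictExt_one
  have hUl : ∀ m, strictExt (tensorId δ) (mulTmul m 1) = mulTmul (strictExt δ m) 1 :=
    hδ.strictExt_homTensor_inl
  have hUr : ∀ n, strictExt (tensorId δ) (mulTmul 1 n) = mulTmul p n :=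
    hδ.strictExt_homTensor_inr
  have hVL : ∀ X : 𝓜(ℂ, MinTensor A A),
      mulTensorId A (strictExt (tensorId δ)) (mulInrAssoc C A A X) =
        mulTmul (mulTmul p 1) 1 * mulInrAssoc (MinTensor C A) A A X := fun X => by
    have h1 : (mulTensorId A (strictExt (tensorId δ))).comp (mulInrAssoc C A A) 1 =
        mulTmul (mulTmul p 1) 1 := by
      rw [NonUnitalStarAlgHom.comp_apply, mulInrAssoc_one, hU.mulTensorId_one, hU1]
    rw [← h1]
    refine IsNormal.eq_one_mul_of_legs
      (Ψ := (mulTensorId A (strictExt (tensorId δ))).comp (mulInrAssoc C A A))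
      (Ψ' := mulInrAssoc (MinTensor C A) A A) isNormal_mulInrAssoc ?_ (fun a => ?_) (fun a => ?_) X
    · rw [mulInrAssoc_one, mul_one]
    · rw [h1, NonUnitalStarAlgHom.comp_apply, mulInrAssoc_mulTmul, mulInrAssoc_mulTmul,
        hU.mulTensorId_mulTmul, hUr, mulTmul_mul, mulTmul_mul, one_mul, mul_one, one_mul]
    · rw [h1, NonUnitalStarAlgHom.comp_apply, mulInrAssoc_mulTmul, mulInrAssoc_mulTmul,
        hU.mulTensorId_mulTmul, mulTmul_one_one, mulTmul_one_one, hU1, mulTmul_mul, one_mul,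
        mul_one]
  refine IsNormal.ext_of_legs (Ψ := (mulTensorId A (strictExt (tensorId δ))).comp (idTensor C Δ))
    (Ψ' := (idTensor (MinTensor C A) Δ).comp (strictExt (tensorId δ)))
    ((isNormal_idTensor _ hΔ).comp hU) ?_ (fun c => ?_) (fun a => ?_) x
  · rw [NonUnitalStarAlgHom.comp_apply, NonUnitalStarAlgHom.comp_apply, idTensor_one _ hΔ,
      hU.mulTensorId_one, hU1, idTensor_inl hΔ]
  · rw [NonUnitalStarAlgHom.comp_apply, NonUnitalStarAlgHom.comp_apply, idTensor_inl hΔ,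
      hU.mulTensorId_mulTmul, hUl, idTensor_inl hΔ]
  · rw [NonUnitalStarAlgHom.comp_apply, NonUnitalStarAlgHom.comp_apply, idTensor_inr hΔ,
      hVL, hUr, mulTmul_eq p (toMul A a), map_mul, idTensor_inl hΔ, idTensor_inr hΔ]

end Coassociativity

/-! ### Slices of multipliers -/

section SliceMultiplier

variable {A B C D : Type u} [NonUnitalCStarAlgebra A] [NonUnitalCStarAlgebra B]
  [NonUnitalCStarAlgebra C] [NonUnitalCStarAlgebra D]

open MinTensor

theorem mulTmul_snd (m : 𝓜(ℂ, A)) (n : 𝓜(ℂ, B)) (a : A) (b : B) :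
    (mulTmul m n).snd (tmul a b) = tmul (m.snd a) (n.snd b) := by
  rw [snd_eq_star, star_mulTmul, star_tmul, mulTmul_fst, star_tmul, ← snd_eq_star, ← snd_eq_star]

/-- Multipliers that are intertwined by `φ` and `ψ` have tensor products intertwined by
`φ ⊗ ψ`. -/
theorem homTensor_mulTmul_fst {φ : A →⋆ₙₐ[ℂ] 𝓜(ℂ, C)} {ψ : B →⋆ₙₐ[ℂ] 𝓜(ℂ, D)} {m : 𝓜(ℂ, A)}
    {n : 𝓜(ℂ, B)} {m' : 𝓜(ℂ, C)} {n' : 𝓜(ℂ, D)} (hm : ∀ a, φ (m.fst a) = m' * φ a)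
    (hn : ∀ b, ψ (n.fst b) = n' * ψ b) (x : MinTensor A B) :
    homTensor φ ψ ((mulTmul m n).fst x) = mulTmul m' n' * homTensor φ ψ x := by
  have c1 := (homTensor φ ψ).continuous
  induction x using MinTensor.induction_tmul with
  | hc => exact isClosed_eq (by fun_prop) (by fun_prop)
  | hadd x y hx hy => rw [map_add, map_add, hx, hy, map_add, mul_add]
  | h a b => rw [mulTmul_fst, homTensor_tmul, hm, hn, homTensor_tmul, mulTmul_mul]

theorem homTensor_mulTmul_snd {φ : A →⋆ₙₐ[ℂ] 𝓜(ℂ, C)} {ψ : B →⋆ₙₐ[ℂ] 𝓜(ℂ, D)} {m : 𝓜(ℂ, A)}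
    {n : 𝓜(ℂ, B)} {m' : 𝓜(ℂ, C)} {n' : 𝓜(ℂ, D)} (hm : ∀ a, φ (m.snd a) = φ a * m')
    (hn : ∀ b, ψ (n.snd b) = ψ b * n') (x : MinTensor A B) :
    homTensor φ ψ ((mulTmul m n).snd x) = homTensor φ ψ x * mulTmul m' n' := by
  have c1 := (homTensor φ ψ).continuous
  induction x using MinTensor.induction_tmul with
  | hc => exact isClosed_eq (by fun_prop) (by fun_prop)
  | hadd x y hx hy => rw [map_add, map_add, hx, hy, map_add, add_mul]
  | h a b => rw [mulTmul_snd, homTensor_tmul, hm, hn, homTensor_tmul, mulTmul_mul]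

theorem slice_mulTmul_fst (ω : A →L[ℂ] ℂ) (m : 𝓜(ℂ, B)) (x : MinTensor B A) :
    slice ω ((mulTmul m 1).fst x) = m.fst (slice ω x) := by
  induction x using MinTensor.induction_tmul with
  | hc => exact isClosed_eq (by fun_prop) (by fun_prop)
  | hadd x y hx hy => rw [map_add, map_add, hx, hy, map_add, map_add]
  | h a b => rw [mulTmul_fst, slice_tmul, slice_tmul, map_smul]; rfl

theorem slice_mulTmul_snd (ω : A →L[ℂ] ℂ) (m : 𝓜(ℂ, B)) (x : MinTensor B A) :
    slice ω ((mulTmul m 1).snd x) = m.snd (slice ω x) := by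
  induction x using MinTensor.induction_tmul with
  | hc => exact isClosed_eq (by fun_prop) (by fun_prop)
  | hadd x y hx hy => rw [map_add, map_add, hx, hy, map_add, map_add]
  | h a b => rw [mulTmul_snd, slice_tmul, slice_tmul, map_smul]; rfl

theorem slice_map (ω : A →L[ℂ] ℂ) (f : B →⋆ₙₐ[ℂ] C) (x : MinTensor B A) :
    slice ω (MinTensor.map f (NonUnitalStarAlgHom.id ℂ A) x) = f (slice ω x) := by
  have c1 := f.continuous
  have c2 := (MinTensor.map f (NonUnitalStarAlgHom.id ℂ A)).continuous
  induction x using MinTensor.induction_tmul with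
  | hc => exact isClosed_eq (by fun_prop) (by fun_prop)
  | hadd x y hx hy => rw [map_add, map_add, hx, hy, map_add, map_add]
  | h a b => rw [map_tmul, slice_tmul, slice_tmul, map_smul]; rfl

theorem homTensor_map (φ : B →⋆ₙₐ[ℂ] 𝓜(ℂ, D)) (f : C →⋆ₙₐ[ℂ] B) (x : MinTensor C A) :
    homTensor φ (toMul A) (MinTensor.map f (NonUnitalStarAlgHom.id ℂ A) x) =
      homTensor (φ.comp f) (toMul A) x := by
  have : (homTensor φ (toMul A)).comp (MinTensor.map f (NonUnitalStarAlgHom.id ℂ A)) =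
      homTensor (φ.comp f) (toMul A) := ext_hom fun a b => by
    rw [NonUnitalStarAlgHom.comp_apply, map_tmul, homTensor_tmul, homTensor_tmul]; rfl
  exact DFunLike.congr_fun this x

theorem homTensor_toMul_toMul : homTensor (toMul B) (toMul A) = toMul (MinTensor B A) :=
  ext_hom fun a b => by rw [homTensor_tmul, toMul_tmul]

variable (A B) in
/-- The embedding of `M(B) ⊗ A` into `M(B ⊗ A)`. -/
noncomputable def mulTensorHom : MinTensor 𝓜(ℂ, B) A →⋆ₙₐ[ℂ] 𝓜(ℂ, MinTensor B A) :=
  homTensor (NonUnitalStarAlgHom.id ℂ 𝓜(ℂ, B)) (toMul A)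

theorem mulTensorHom_injective : Function.Injective (mulTensorHom A B) :=
  homTensor_injective Function.injective_id (toMul_injective A)

theorem mulTensorHom_tmul (m : 𝓜(ℂ, B)) (a : A) :
    mulTensorHom A B (tmul m a) = mulTmul m (toMul A a) := homTensor_tmul _ _ _ _

theorem mulTensorHom_map (φ : C →⋆ₙₐ[ℂ] 𝓜(ℂ, B)) (x : MinTensor C A) :
    mulTensorHom A B (MinTensor.map φ (NonUnitalStarAlgHom.id ℂ A) x) =
      homTensor φ (toMul A) x := homTensor_map _ _ _

theorem exists_mul_left (m : 𝓜(ℂ, B)) (y : MinTensor 𝓜(ℂ, B) A) :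
    ∃ y', mulTensorHom A B y' = mulTmul m 1 * mulTensorHom A B y ∧
      ∀ ω : A →L[ℂ] ℂ, slice ω y' = m * slice ω y :=
  ⟨(mulTmul (toMul 𝓜(ℂ, B) m) 1).fst y,
    homTensor_mulTmul_fst (fun _ => rfl) (fun b => by rw [one_mul]; rfl) y,
    fun ω => slice_mulTmul_fst ω _ y⟩

theorem exists_mul_right (m : 𝓜(ℂ, B)) (y : MinTensor 𝓜(ℂ, B) A) :
    ∃ y', mulTensorHom A B y' = mulTensorHom A B y * mulTmul m 1 ∧
      ∀ ω : A →L[ℂ] ℂ, slice ω y' = slice ω y * m :=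
  ⟨(mulTmul (toMul 𝓜(ℂ, B) m) 1).snd y,
    homTensor_mulTmul_snd (fun _ => rfl) (fun b => by rw [mul_one]; rfl) y,
    fun ω => slice_mulTmul_snd ω _ y⟩

/-- Slices of an element of the image of `D ⊗ A` lie in the image of `D`. -/
theorem slice_mem_range {k : D →⋆ₙₐ[ℂ] 𝓜(ℂ, B)} {y : MinTensor 𝓜(ℂ, B) A}
    (h : mulTensorHom A B y ∈ Set.range (homTensor k (toMul A))) (ω : A →L[ℂ] ℂ) :
    slice ω y ∈ Set.range k := by
  obtain ⟨x, hx⟩ := h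
  rw [← mulTensorHom_map] at hx
  exact ⟨slice ω x, by rw [← slice_map, mulTensorHom_injective hx]⟩

theorem slice_mul_mem_range {k : D →⋆ₙₐ[ℂ] 𝓜(ℂ, B)} {y : MinTensor 𝓜(ℂ, B) A}
    {X : 𝓜(ℂ, MinTensor B A)} {a : A} (hy : mulTensorHom A B y = X * mulTmul 1 (toMul A a))
    {n : 𝓜(ℂ, B)} (h : ∀ e, X * mulTmul n (toMul A e) ∈ Set.range (homTensor k (toMul A)))
    (ω : A →L[ℂ] ℂ) : slice ω y * n ∈ Set.range k := by
  obtain ⟨y', h1, h2⟩ := exists_mul_right n y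
  rw [← h2]
  refine slice_mem_range ?_ ω
  rw [h1, hy, mul_assoc, mulTmul_mul, one_mul, mul_one]
  exact h a

theorem mul_slice_mem_range {k : D →⋆ₙₐ[ℂ] 𝓜(ℂ, B)} (hk : Function.Injective k)
    {y : MinTensor 𝓜(ℂ, B) A} {X : 𝓜(ℂ, MinTensor B A)} {a : A}
    (hy : mulTensorHom A B y = X * mulTmul 1 (toMul A a)) {n : 𝓜(ℂ, B)}
    (h : ∀ e, mulTmul n (toMul A e) * X ∈ Set.range (homTensor k (toMul A)))
    (ω : A →L[ℂ] ℂ) : n * slice ω y ∈ Set.range k := by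
  obtain ⟨y', h1, h2⟩ := exists_mul_left n y
  rw [← h2]
  refine slice_mem_range ?_ ω
  rw [h1]
  -- `(n ⊗ 1)y` is the limit of `(n ⊗ e)y` along an approximate unit
  obtain ⟨l, hl, hr, -, hn, -⟩ := exists_approximateUnit A
  have hcl : IsClosed (Set.range (homTensor k (toMul A))) :=
    NonUnitalStarAlgHom.isClosed_range (homTensor_injective hk (toMul_injective A))
  have hconv : ∀ z : MinTensor 𝓜(ℂ, B) A, Tendsto (fun e => (mulTmul 1 (toMul A e)).fst z) l
      (𝓝 ((1 : 𝓜(ℂ, MinTensor 𝓜(ℂ, B) A)).fst z)) := fun z => by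
    have hm := (isNormal_mulInr (A := 𝓜(ℂ, B)) (B := A)).mem z
    rw [mulInr_apply, mulTmul_one_one] at hm
    refine tendsto_actionSpan (φ := (mulInr 𝓜(ℂ, B) A).comp (toMul A)) (M := 1)
      (T := fun e => (mulTmul 1 (toMul A e)).fst) (T₀ := ContinuousLinearMap.id ℂ _) ?_
      (fun a b => ?_) hm
    · filter_upwards [hn] with e he
      rw [DoubleCentralizer.norm_fst]
      exact ((NonUnitalStarAlgHom.norm_apply_le (mulInr 𝓜(ℂ, B) A) _).trans
        (NonUnitalStarAlgHom.norm_apply_le (toMul A) e)).trans he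
    · refine (((continuous_fst_fst ((mulInr 𝓜(ℂ, B) A).comp (toMul A)) b).tendsto a).comp
        (hr a)).congr fun e => ?_
      rw [Function.comp_apply, map_mul, mul_fst_apply]
      rfl
  have h3 := ((mulTensorHom A B).continuous.tendsto _).comp (hconv y)
  have h4 := h3.const_mul (mulTmul n 1)
  rw [one_fst_apply] at h4
  refine hcl.mem_of_tendsto h4 (Eventually.of_forall fun e => ?_)
  have h5 : mulTensorHom A B ((mulTmul 1 (toMul A e)).fst y) =
      mulTmul 1 (toMul A e) * mulTensorHom A B y :=
    homTensor_mulTmul_fst (fun b => by rw [one_mul]; rfl) (fun b => map_mul _ _ _) y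
  obtain ⟨x, hx⟩ := h e
  refine ⟨(mulTmul 1 (toMul A a)).snd x, ?_⟩
  rw [homTensor_mulTmul_snd (m' := 1) (n' := toMul A a) (fun b => by rw [mul_one]; rfl)
    (fun b => map_mul _ _ _), hx, Function.comp_apply, h5, hy, ← mul_assoc, ← mul_assoc,
    mulTmul_mul, mul_one, one_mul]

theorem IsNormal.mulTensorHom_map {Ψ : 𝓜(ℂ, B) →⋆ₙₐ[ℂ] 𝓜(ℂ, C)} (h : IsNormal Ψ)
    (y : MinTensor 𝓜(ℂ, B) A) :
    mulTensorHom A C (MinTensor.map Ψ (NonUnitalStarAlgHom.id ℂ A) y) =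
      mulTensorId A Ψ (mulTensorHom A B y) := by
  have : (mulTensorHom A C).comp (MinTensor.map Ψ (NonUnitalStarAlgHom.id ℂ A)) =
      (mulTensorId A Ψ).comp (mulTensorHom A B) := ext_hom fun m a => by
    rw [NonUnitalStarAlgHom.comp_apply, map_tmul, NonUnitalStarAlgHom.comp_apply,
      mulTensorHom_tmul, mulTensorHom_tmul, h.mulTensorId_mulTmul]
    rfl
  exact DFunLike.congr_fun this y

variable {Δ : A →⋆ₙₐ[ℂ] 𝓜(ℂ, MinTensor A A)}

/-- If `X(1 ⊗ A)` lies in the image of `D ⊗ A`, then `(id ⊗ Δ)(X)(1 ⊗ A ⊗ A)` lies in the image of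
`D ⊗ A ⊗ A`, because `A ⊗ A` is the closed linear span of `Δ(A)(A ⊗ A)`. -/
theorem idTensor_mul_mem_range (hΔ : HasSupport Δ 1) {j : D →⋆ₙₐ[ℂ] 𝓜(ℂ, C)}
    (hj : Function.Injective j) {X : 𝓜(ℂ, MinTensor C A)}
    (hX : ∀ b, X * mulTmul 1 (toMul A b) ∈ Set.range (homTensor j (toMul A)))
    (w : MinTensor A A) : idTensor C Δ X * mulInrAssoc C A A (toMul _ w) ∈
      Set.range (homTensor (homTensor j (toMul A)) (toMul A)) := by
  set κ := homTensor (homTensor j (toMul A)) (toMul A) with hκ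
  have hκi : Function.Injective κ :=
    homTensor_injective (homTensor_injective hj (toMul_injective A)) (toMul_injective A)
  have hcl : IsClosed (Set.range κ) := NonUnitalStarAlgHom.isClosed_range hκi
  have hadd : ∀ {x y}, x ∈ Set.range κ → y ∈ Set.range κ → x + y ∈ Set.range κ := by
    rintro _ _ ⟨x, rfl⟩ ⟨y, rfl⟩; exact ⟨x + y, map_add _ _ _⟩
  have h1 : ∀ (d : D) (w : MinTensor A A),
      assocMul C A A (mulTmul (j d) (toMul _ w)) ∈ Set.range κ := fun d w => by
    have c1 : Continuous fun w => assocMul C A A (mulTmul (j d) (toMul _ w)) := by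
      refine (assocMul C A A).continuous.comp ((mulTensor _ _).continuous.comp ?_)
      exact continuous_tmul continuous_const (toMul _).continuous
    induction w using MinTensor.induction_tmul with
    | hc => exact hcl.preimage c1
    | hadd x y hx hy =>
      have : mulTmul (j d) (toMul _ (x + y)) =
          mulTmul (j d) (toMul _ x) + mulTmul (j d) (toMul _ y) := by
        rw [map_add, mulTmul, MinTensor.tmul_add, map_add]; rfl
      rw [this, map_add]
      exact hadd hx hy
    | h a b =>
      rw [toMul_tmul, assocMul_mulTmul]
      exact ⟨tmul (tmul d a) b, by rw [hκ, homTensor_tmul, homTensor_tmul]⟩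
  have h2 : ∀ (x : MinTensor D A) (w : MinTensor A A),
      idTensor C Δ (homTensor j (toMul A) x) * mulInrAssoc C A A (toMul _ w) ∈ Set.range κ :=
    fun x w => by
    have c1 := (homTensor j (toMul A)).continuous
    have c2 := (idTensor C Δ).continuous
    induction x using MinTensor.induction_tmul with
    | hc => exact hcl.preimage (by fun_prop)
    | hadd x y hx hy => rw [map_add, map_add, add_mul]; exact hadd hx hy
    | h d a =>
      rw [homTensor_tmul, idTensor_mulTmul hΔ, mulInrAssoc_apply, ← map_mul, mulTmul_mul, mul_one,
        hΔ.strictExt_toMul, mul_toMul]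
      exact h1 _ _
  have hw := hΔ.mem w
  rw [one_fst_apply] at hw
  exact map_mem_of_mem_actionSpan (K := κ.toCLM.toLinearMap.range)
    ((ContinuousLinearMap.mul ℂ _ (idTensor C Δ X)).comp
      ((mulInrAssoc C A A).comp (toMul _)).toCLM) hcl (fun a w' => by
    change idTensor C Δ X * mulInrAssoc C A A (toMul _ ((Δ a).fst w')) ∈ Set.range κ
    obtain ⟨x, hx⟩ := hX a
    rw [← mul_toMul, map_mul, ← hΔ.strictExt_toMul, ← idTensor_inr hΔ, ← mul_assoc, ← map_mul,
      ← hx]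
    exact h2 x w') hw

theorem mul_idTensor_mem_range (hΔ : HasSupport Δ 1) {j : D →⋆ₙₐ[ℂ] 𝓜(ℂ, C)}
    (hj : Function.Injective j) {X : 𝓜(ℂ, MinTensor C A)}
    (hX : ∀ b, mulTmul 1 (toMul A b) * X ∈ Set.range (homTensor j (toMul A)))
    (w : MinTensor A A) : mulInrAssoc C A A (toMul _ w) * idTensor C Δ X ∈
      Set.range (homTensor (homTensor j (toMul A)) (toMul A)) := by
  have h := idTensor_mul_mem_range hΔ hj (X := star X) (fun b => ?_) (star w)
  · obtain ⟨x, hx⟩ := h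
    refine ⟨star x, ?_⟩
    rw [map_star, hx, star_mul, ← map_star, ← map_star, ← map_star, star_star, star_star]
  · obtain ⟨x, hx⟩ := hX (star b)
    refine ⟨star x, ?_⟩
    rw [map_star, hx, star_mul, star_mulTmul, star_one, ← map_star, star_star]

end SliceMultiplier

/-! ### The C⋆-algebra `C ⊠ A` -/

section Boxtimes

variable {A B C : Type u} [NonUnitalCStarAlgebra A] [NonUnitalCStarAlgebra B]
  [NonUnitalCStarAlgebra C]

open MinTensor

theorem IsStrict.hasSupport_unitImage {φ : A →⋆ₙₐ[ℂ] 𝓜(ℂ, B)} (h : IsStrict φ) :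
    HasSupport φ (unitImage φ) := by
  obtain ⟨p, hp⟩ := h.exists_hasSupport
  rwa [unitImage, hp.strictExt_one]

section Range

variable {E F : Type*} [NonUnitalCStarAlgebra E] [NonUnitalCStarAlgebra F]

theorem add_mem_range (f : E →⋆ₙₐ[ℂ] F) {x y : F} (hx : x ∈ Set.range f) (hy : y ∈ Set.range f) :
    x + y ∈ Set.range f := by
  obtain ⟨x, rfl⟩ := hx
  obtain ⟨y, rfl⟩ := hy
  exact ⟨x + y, map_add _ _ _⟩

theorem smul_mem_range (f : E →⋆ₙₐ[ℂ] F) (c : ℂ) {x : F} (hx : x ∈ Set.range f) :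
    c • x ∈ Set.range f := by
  obtain ⟨x, rfl⟩ := hx
  exact ⟨c • x, map_smul _ _ _⟩

theorem star_mem_range (f : E →⋆ₙₐ[ℂ] F) {x : F} (hx : x ∈ Set.range f) :
    star x ∈ Set.range f := by
  obtain ⟨x, rfl⟩ := hx
  exact ⟨star x, map_star _ _⟩

theorem zero_mem_range (f : E →⋆ₙₐ[ℂ] F) : 0 ∈ Set.range f := ⟨0, map_zero _⟩

end Range

theorem mul_inl_mem_mulTensorRange {Y : 𝓜(ℂ, MinTensor B A)} (hY : Y ∈ mulTensorRange B A)
    (m : 𝓜(ℂ, B)) : Y * mulTmul m 1 ∈ mulTensorRange B A := by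
  obtain ⟨y, rfl⟩ := hY
  obtain ⟨y', h, -⟩ := exists_mul_right m y
  exact ⟨y', h⟩

theorem isClosed_mulTensorRange : IsClosed (mulTensorRange B A) :=
  NonUnitalStarAlgHom.isClosed_range mulTensorHom_injective

theorem mul_mem_mulTensorRange {X Y : 𝓜(ℂ, MinTensor B A)}
    (hX : ∀ a, X * mulTmul 1 (toMul A a) ∈ mulTensorRange B A) (hY : Y ∈ mulTensorRange B A) :
    X * Y ∈ mulTensorRange B A := by
  obtain ⟨y, rfl⟩ := hY
  change X * mulTensorHom A B y ∈ _
  have c1 := (mulTensorHom A B).continuous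
  induction y using MinTensor.induction_tmul with
  | hc => exact isClosed_mulTensorRange.preimage (by fun_prop)
  | hadd x y hx hy => rw [map_add, mul_add]; exact add_mem_range _ hx hy
  | h m a =>
    rw [mulTensorHom_tmul, mulTmul_eq, mulTmul_comm, ← mul_assoc]
    exact mul_inl_mem_mulTensorRange (hX a) m

variable {Δ : A →⋆ₙₐ[ℂ] 𝓜(ℂ, MinTensor A A)} {δ : C →⋆ₙₐ[ℂ] 𝓜(ℂ, MinTensor C A)}

namespace MemBoxtimes

theorem star_mem {x : 𝓜(ℂ, MinTensor C A)} (h : MemBoxtimes Δ δ x)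
    (hp : star (unitImage δ) = unitImage δ) : MemBoxtimes Δ δ (star x) where
  commute := by
    have := congrArg star h.commute
    rw [star_mul, star_mul, hp] at this
    exact this.symm
  left_eq := by rw [map_star, h.right_eq, star_mul, star_mulTmul, star_one, hp, ← map_star]
  right_eq := by rw [map_star, h.left_eq, star_mul, star_mulTmul, star_one, hp, ← map_star]
  mul_mem a := by
    have := star_mem_range _ (h.mem_mul (star a))
    rwa [star_mul, star_mulTmul, star_one, ← map_star, star_star] at this
  mem_mul a := by
    have := star_mem_range _ (h.mul_mem (star a))
    rwa [star_mul, star_mulTmul, star_one, ← map_star, star_star] at this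
  comul_mul_mem a := by
    have := star_mem_range _ (h.mem_comul_mul (star a))
    rwa [star_mul, star_mulTmul, star_one, ← map_star, ← map_star, star_star] at this
  mem_comul_mul a := by
    have := star_mem_range _ (h.comul_mul_mem (star a))
    rwa [star_mul, star_mulTmul, star_one, ← map_star, ← map_star, star_star] at this

/-- For `x` in `C ⊠ A`, the element `(id ⊗ Δ)(x)` commutes with `δ(1) ⊗ 1`. -/
theorem comul_commute {x : 𝓜(ℂ, MinTensor C A)} (h : MemBoxtimes Δ δ x) :
    mulTmul (unitImage δ) 1 * idTensor C Δ x = idTensor C Δ x * mulTmul (unitImage δ) 1 := by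
  rw [← h.left_eq, h.right_eq]

theorem mul_mem_boxtimes {x y : 𝓜(ℂ, MinTensor C A)} (hx : MemBoxtimes Δ δ x)
    (hy : MemBoxtimes Δ δ y) (hp : star (unitImage δ) = unitImage δ)
    (hpp : unitImage δ * unitImage δ = unitImage δ) : MemBoxtimes Δ δ (x * y) := by
  have hP : mulTmul (unitImage δ) 1 * mulTmul (unitImage δ) (1 : 𝓜(ℂ, A)) =
      mulTmul (unitImage δ) 1 := by rw [mulTmul_mul, hpp, mul_one]
  have h1 : strictExt (tensorId δ) (x * y) = mulTmul (unitImage δ) 1 * idTensor C Δ (x * y) := by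
    rw [map_mul, map_mul, hx.right_eq, hy.left_eq, mul_assoc, ← mul_assoc (mulTmul _ _), hP,
      ← mul_assoc, ← mul_assoc, hx.comul_commute]
  have hl : ∀ {x y}, MemBoxtimes Δ δ x → MemBoxtimes Δ δ y → ∀ a : A,
      x * y * mulTmul 1 (toMul A a) ∈ Set.range (toMul (MinTensor C A)) := fun hx hy a => by
    obtain ⟨z, hz⟩ := hy.mul_mem a
    rw [mul_assoc, ← hz, mul_toMul]
    exact ⟨_, rfl⟩
  have hΔl : ∀ {x y}, MemBoxtimes Δ δ x → MemBoxtimes Δ δ y → ∀ a : A,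
      idTensor C Δ (x * y) * mulTmul 1 (toMul A a) ∈ mulTensorRange (MinTensor C A) A :=
    fun hx hy a => by
    rw [map_mul, mul_assoc]
    exact mul_mem_mulTensorRange hx.comul_mul_mem (hy.comul_mul_mem a)
  refine ⟨?_, h1, ?_, hl hx hy, fun a => ?_, hΔl hx hy, fun a => ?_⟩
  · rw [mul_assoc, hy.commute, ← mul_assoc, hx.commute, mul_assoc]
  · rw [h1, map_mul, ← mul_assoc, hx.comul_commute, mul_assoc, hy.comul_commute, mul_assoc]
  · have := star_mem_range _ (hl (hy.star_mem hp) (hx.star_mem hp) (star a))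
    rwa [← star_mul, star_mul, star_star, star_mulTmul, star_one, ← map_star, star_star] at this
  · have := star_mem_range _ (hΔl (hy.star_mem hp) (hx.star_mem hp) (star a))
    rwa [← star_mul, star_mul, star_mulTmul, star_one, ← map_star, ← map_star, star_star,
      star_star] at this

end MemBoxtimes

variable (Δ) in
theorem isClosed_boxtimes (δ : C →⋆ₙₐ[ℂ] 𝓜(ℂ, MinTensor C A)) : IsClosed (boxtimes Δ δ) := by
  have c1 := (strictExt (tensorId δ)).continuous
  have c2 := (idTensor C Δ).continuous
  have hcl : IsClosed (Set.range (toMul (MinTensor C A))) :=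
    NonUnitalStarAlgHom.isClosed_range (toMul_injective _)
  have hcl' : IsClosed (mulTensorRange (MinTensor C A) A) := isClosed_mulTensorRange
  have : boxtimes Δ δ = {x | x * unitImage δ = unitImage δ * x} ∩
      ({x | strictExt (tensorId δ) x = mulTmul (unitImage δ) 1 * idTensor C Δ x} ∩
      ({x | strictExt (tensorId δ) x = idTensor C Δ x * mulTmul (unitImage δ) 1} ∩
      ((⋂ a : A, (fun x => x * mulTmul 1 (toMul A a)) ⁻¹' Set.range (toMul (MinTensor C A))) ∩
      ((⋂ a : A, (fun x => mulTmul 1 (toMul A a) * x) ⁻¹' Set.range (toMul (MinTensor C A))) ∩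
      ((⋂ a : A, (fun x => idTensor C Δ x * mulTmul 1 (toMul A a)) ⁻¹'
        mulTensorRange (MinTensor C A) A) ∩
      (⋂ a : A, (fun x => mulTmul 1 (toMul A a) * idTensor C Δ x) ⁻¹'
        mulTensorRange (MinTensor C A) A)))))) := by
    ext x
    simp only [Set.mem_inter_iff, Set.mem_iInter]
    exact ⟨fun h => ⟨h.1, h.2, h.3, h.4, h.5, h.6, h.7⟩,
      fun ⟨h1, h2, h3, h4, h5, h6, h7⟩ => ⟨h1, h2, h3, h4, h5, h6, h7⟩⟩
  rw [this]
  refine (isClosed_eq (by fun_prop) (by fun_prop)).inter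
    ((isClosed_eq (by fun_prop) (by fun_prop)).inter
    ((isClosed_eq (by fun_prop) (by fun_prop)).inter
    ((isClosed_iInter fun a => hcl.preimage (by fun_prop)).inter
    ((isClosed_iInter fun a => hcl.preimage (by fun_prop)).inter
    ((isClosed_iInter fun a => hcl'.preimage (by fun_prop)).inter
    (isClosed_iInter fun a => hcl'.preimage (by fun_prop)))))))

/-- The C⋆-subalgebra `C ⊠ A` of `M(C ⊗ A)`. -/
def boxtimesSubalgebra (Δ : A →⋆ₙₐ[ℂ] 𝓜(ℂ, MinTensor A A))
    {δ : C →⋆ₙₐ[ℂ] 𝓜(ℂ, MinTensor C A)} (hδ : HasSupport δ (unitImage δ)) :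
    NonUnitalStarSubalgebra ℂ 𝓜(ℂ, MinTensor C A) where
  carrier := boxtimes Δ δ
  add_mem' {x y} hx hy :=
    { commute := by rw [add_mul, mul_add, hx.commute, hy.commute]
      left_eq := by rw [map_add, map_add, mul_add, hx.left_eq, hy.left_eq]
      right_eq := by rw [map_add, map_add, add_mul, hx.right_eq, hy.right_eq]
      mul_mem := fun a => by
        rw [add_mul]; exact add_mem_range _ (hx.mul_mem a) (hy.mul_mem a)
      mem_mul := fun a => by
        rw [mul_add]; exact add_mem_range _ (hx.mem_mul a) (hy.mem_mul a)
      comul_mul_mem := fun a => by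
        rw [map_add, add_mul]; exact add_mem_range _ (hx.comul_mul_mem a) (hy.comul_mul_mem a)
      mem_comul_mul := fun a => by
        rw [map_add, mul_add]; exact add_mem_range _ (hx.mem_comul_mul a) (hy.mem_comul_mul a) }
  zero_mem' :=
    { commute := by rw [zero_mul, mul_zero]
      left_eq := by rw [map_zero, map_zero, mul_zero]
      right_eq := by rw [map_zero, map_zero, zero_mul]
      mul_mem := fun a => by rw [zero_mul]; exact zero_mem_range _
      mem_mul := fun a => by rw [mul_zero]; exact zero_mem_range _
      comul_mul_mem := fun a => by rw [map_zero, zero_mul]; exact zero_mem_range _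
      mem_comul_mul := fun a => by rw [map_zero, mul_zero]; exact zero_mem_range _ }
  mul_mem' hx hy := MemBoxtimes.mul_mem_boxtimes hx hy hδ.star_eq hδ.mul_self
  smul_mem' c x hx :=
    { commute := by rw [smul_mul_assoc, mul_smul_comm, hx.commute]
      left_eq := by rw [map_smul, map_smul, mul_smul_comm, hx.left_eq]
      right_eq := by rw [map_smul, map_smul, smul_mul_assoc, hx.right_eq]
      mul_mem := fun a => by rw [smul_mul_assoc]; exact smul_mem_range _ c (hx.mul_mem a)
      mem_mul := fun a => by rw [mul_smul_comm]; exact smul_mem_range _ c (hx.mem_mul a)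
      comul_mul_mem := fun a => by
        rw [map_smul, smul_mul_assoc]; exact smul_mem_range _ c (hx.comul_mul_mem a)
      mem_comul_mul := fun a => by
        rw [map_smul, mul_smul_comm]; exact smul_mem_range _ c (hx.mem_comul_mul a) }
  star_mem' hx := MemBoxtimes.star_mem hx hδ.star_eq

/-- The slices of `(id ⊗ Δ)(x)(1 ⊗ 1 ⊗ a)` belong to `C ⊠ A` if `x` does. -/
theorem MemBoxtimes.slice_mem (hΔ : HasSupport Δ 1)
    (hco : ∀ a, strictExt (tensorId Δ) (Δ a) = idTensor A Δ (Δ a))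
    (hδ : HasSupport δ (unitImage δ)) {x : 𝓜(ℂ, MinTensor C A)} (hx : MemBoxtimes Δ δ x) {a : A}
    {y : MinTensor 𝓜(ℂ, MinTensor C A) A}
    (hy : mulTensorHom A (MinTensor C A) y = idTensor C Δ x * mulTmul 1 (toMul A a))
    (ω : A →L[ℂ] ℂ) : MemBoxtimes Δ δ (slice ω y) := by
  set p := unitImage δ
  have hΦ := isNormal_idTensor C hΔ
  have hU : IsNormal (strictExt (tensorId δ)) := hδ.homTensor_toMul.isNormal
  have hU1 : strictExt (tensorId δ) 1 = mulTmul p 1 := hδ.homTensor_toMul.strictExt_one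
  have hκ := mulTensorHom_injective (A := A) (B := MinTensor C A)
  have hκ' := mulTensorHom_injective (A := A) (B := MinTensor (MinTensor C A) A)
  set i := NonUnitalStarAlgHom.id ℂ A
  -- the images of `y` under `(id ⊗ Δ) ⊗ id` and `(δ ⊗ id) ⊗ id`
  have hyΦ : mulTensorHom A (MinTensor (MinTensor C A) A) (MinTensor.map (idTensor C Δ) i y) =
      idTensor (MinTensor C A) Δ (idTensor C Δ x) * mulTmul 1 (toMul A a) := by
    rw [hΦ.mulTensorHom_map, hy, map_mul, idTensor_coassoc hΔ hco, hΦ.mulTensorId_mulTmul,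
      idTensor_one _ hΔ]
  have hcomm : mulTmul (mulTmul p 1) 1 * idTensor (MinTensor C A) Δ (idTensor C Δ x) =
      idTensor (MinTensor C A) Δ (idTensor C Δ x) * mulTmul (mulTmul p 1) 1 := by
    rw [← idTensor_inl hΔ, ← map_mul, hx.comul_commute, map_mul]
  have hpp : mulTmul (mulTmul p 1) 1 * mulTmul (mulTmul p 1) 1 =
      (mulTmul (mulTmul p (1 : 𝓜(ℂ, A))) (1 : 𝓜(ℂ, A))) := by
    rw [mulTmul_mul, mulTmul_mul, hδ.mul_self, mul_one]
  have hyU : mulTensorHom A (MinTensor (MinTensor C A) A)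
      (MinTensor.map (strictExt (tensorId δ)) i y) =
        mulTmul (mulTmul p 1) 1 * mulTensorHom A (MinTensor (MinTensor C A) A)
          (MinTensor.map (idTensor C Δ) i y) := by
    rw [hyΦ, hU.mulTensorHom_map, hy, map_mul, mulTensorId_idTensor hΔ hδ, hx.left_eq,
      hU.mulTensorId_mulTmul, hU1, mulTmul_eq (mulTmul p 1) (toMul A a), map_mul,
      idTensor_inl hΔ, ← mul_assoc, hcomm, mul_assoc (idTensor (MinTensor C A) Δ _), hpp,
      ← hcomm, mul_assoc]
  have hyU' : mulTensorHom A (MinTensor (MinTensor C A) A)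
      (MinTensor.map (strictExt (tensorId δ)) i y) =
        mulTensorHom A (MinTensor (MinTensor C A) A)
          (MinTensor.map (idTensor C Δ) i y) * mulTmul (mulTmul p 1) 1 := by
    rw [hyU, hyΦ, ← mul_assoc, hcomm, mul_assoc, mulTmul_comm, mul_assoc]
  have hw : ∀ b e : A, mulTmul (mulTmul 1 (toMul A b)) (toMul A e) =
      mulInrAssoc C A A (toMul _ (tmul b e)) := fun b e => by
    rw [toMul_tmul, mulInrAssoc_mulTmul]
  have hw' : ∀ b e : A, mulTmul (mulTmul 1 (toMul A b)) (toMul A e) =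
      mulInrAssoc (MinTensor C A) A A (toMul _ (tmul b e)) := fun b e => by
    rw [toMul_tmul, mulInrAssoc_mulTmul]
  refine ⟨?_, ?_, ?_, fun b => ?_, fun b => ?_, fun b => ?_, fun b => ?_⟩
  · obtain ⟨y₁, h1, h1'⟩ := exists_mul_right p y
    obtain ⟨y₂, h2, h2'⟩ := exists_mul_left p y
    rw [← h1', ← h2']
    congr 1
    apply hκ
    rw [h1, h2, hy, ← mul_assoc, hx.comul_commute, mul_assoc, mul_assoc, mulTmul_comm]
  · obtain ⟨y₂, h2, h2'⟩ := exists_mul_left (mulTmul p 1) (MinTensor.map (idTensor C Δ) i y)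
    rw [← slice_map, ← slice_map, ← h2']
    congr 1
    apply hκ'
    rw [h2, hyU]
  · obtain ⟨y₂, h2, h2'⟩ := exists_mul_right (mulTmul p 1) (MinTensor.map (idTensor C Δ) i y)
    rw [← slice_map, ← slice_map, ← h2']
    congr 1
    apply hκ'
    rw [h2, hyU']
  · refine slice_mul_mem_range hy (fun e => ?_) ω
    rw [hw]
    have := idTensor_mul_mem_range hΔ (toMul_injective C) (X := x)
      (by simpa only [homTensor_toMul_toMul] using hx.mul_mem) (tmul b e)
    rwa [homTensor_toMul_toMul (A := A) (B := C)] at this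
  · refine mul_slice_mem_range (toMul_injective _) hy (fun e => ?_) ω
    rw [hw]
    have := mul_idTensor_mem_range hΔ (toMul_injective C) (X := x)
      (by simpa only [homTensor_toMul_toMul] using hx.mem_mul) (tmul b e)
    rwa [homTensor_toMul_toMul (A := A) (B := C)] at this
  · rw [← slice_map]
    refine slice_mul_mem_range (k := mulTensorHom A (MinTensor C A)) hyΦ (fun e => ?_) ω
    rw [hw']
    exact idTensor_mul_mem_range hΔ Function.injective_id hx.comul_mul_mem (tmul b e)
  · rw [← slice_map]
    refine mul_slice_mem_range (k := mulTensorHom A (MinTensor C A)) hκ hyΦ (fun e => ?_) ω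
    rw [hw']
    exact mul_idTensor_mem_range hΔ Function.injective_id hx.mem_comul_mul (tmul b e)

/-- If `A` has the slice map property, an element of `M(B) ⊗ A` with slices in `S` lies in
`S ⊗ A`. -/
theorem mem_range_homTensor_subtype (hA : SliceMapProperty A)
    (S : NonUnitalStarSubalgebra ℂ 𝓜(ℂ, B)) [hS : IsClosed (S : Set 𝓜(ℂ, B))]
    {y : MinTensor 𝓜(ℂ, B) A} (h : ∀ ω : A →L[ℂ] ℂ, slice ω y ∈ S) :
    mulTensorHom A B y ∈
      Set.range (homTensor (NonUnitalStarSubalgebraClass.subtype S) (toMul A)) := by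
  let f := MinTensor.map (NonUnitalStarSubalgebraClass.subtype S) (NonUnitalStarAlgHom.id ℂ A)
  have hf : IsClosed (Set.range f) := NonUnitalStarAlgHom.isClosed_range
    (MinTensor.map_injective Subtype.val_injective Function.injective_id)
  have h1 : y ∈ f.toCLM.toLinearMap.range := by
    refine Submodule.topologicalClosure_minimal _ (Submodule.span_le.mpr ?_) hf
      (hA 𝓜(ℂ, B) S hS y h)
    rintro _ ⟨s, hs, a, rfl⟩
    exact ⟨tmul ⟨s, hs⟩ a, map_tmul _ _ _ _⟩
  obtain ⟨x, rfl⟩ := h1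
  exact ⟨x, (mulTensorHom_map _ x).symm⟩

end Boxtimes

/-! ### The coaction on `C ⊠ A` -/

section Coaction

variable {A B C E : Type u} [NonUnitalCStarAlgebra A] [NonUnitalCStarAlgebra B]
  [NonUnitalCStarAlgebra C] [NonUnitalCStarAlgebra E]

open MinTensor

variable {Δ : A →⋆ₙₐ[ℂ] 𝓜(ℂ, MinTensor A A)}

theorem assocMul_fst (M : 𝓜(ℂ, MinTensor B (MinTensor A C))) (x : MinTensor B (MinTensor A C)) :
    (assocMul B A C M).fst (tensorAssoc B A C x) = tensorAssoc B A C (M.fst x) := by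
  apply toMul_injective
  rw [← mul_toMul, ← assocMul_toMul, ← map_mul, mul_toMul, assocMul_toMul]

/-- The embedding `j ⊗ id ⊗ id` intertwines the multipliers `1 ⊗ Z`. -/
theorem homTensor_mulInrAssoc_fst (j : E →⋆ₙₐ[ℂ] 𝓜(ℂ, B)) (Z : 𝓜(ℂ, MinTensor A A))
    (t : MinTensor (MinTensor E A) A) :
    homTensor (homTensor j (toMul A)) (toMul A) ((mulInrAssoc E A A Z).fst t) =
      mulInrAssoc B A A Z * homTensor (homTensor j (toMul A)) (toMul A) t := by
  set κ := homTensor (homTensor j (toMul A)) (toMul A) with hκ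
  have c1 := κ.continuous
  have hs : ∀ (s : E) (w : MinTensor A A),
      κ (tensorAssoc E A A (tmul s w)) = assocMul B A A (mulTmul (j s) (toMul _ w)) := by
    have : κ.comp (tensorAssoc E A A) = (assocMul B A A).comp (homTensor j (toMul _)) := by
      refine NonUnitalStarAlgHom.ext fun x => ?_
      have c2 := (κ.comp (tensorAssoc E A A)).continuous
      have c3 := ((assocMul B A A).comp (homTensor j (toMul (MinTensor A A)))).continuous
      induction x using MinTensor.induction_tmul_tmul with
      | hc => exact isClosed_eq c2 c3
      | hadd x y hx hy => rw [map_add, hx, hy, map_add]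
      | h s b c =>
        rw [NonUnitalStarAlgHom.comp_apply, NonUnitalStarAlgHom.comp_apply, tensorAssoc_tmul, hκ,
          homTensor_tmul, homTensor_tmul, homTensor_tmul, toMul_tmul, assocMul_mulTmul]
    intro s w
    rw [← homTensor_tmul]
    exact DFunLike.congr_fun this _
  induction t using MinTensor.induction_tmul_tmul' with
  | hc => exact isClosed_eq (by fun_prop) (by fun_prop)
  | hadd x y hx hy => rw [map_add, map_add, hx, hy, map_add, mul_add]
  | h s b c =>
    rw [← tensorAssoc_tmul, mulInrAssoc_apply, assocMul_fst, mulTmul_fst, one_fst_apply, hs, hs,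
      mulInrAssoc_apply, ← map_mul, mulTmul_mul, one_mul, mul_toMul]

/-- If `j ⊗ id` intertwines the multipliers `X` and `X'`, then `j ⊗ id ⊗ id` intertwines
`(id ⊗ Δ)(X)` and `(id ⊗ Δ)(X')`. -/
theorem homTensor_idTensor_fst (hΔ : HasSupport Δ 1) (j : E →⋆ₙₐ[ℂ] 𝓜(ℂ, B))
    {X : 𝓜(ℂ, MinTensor E A)} {X' : 𝓜(ℂ, MinTensor B A)}
    (hX : ∀ i, homTensor j (toMul A) (X.fst i) = X' * homTensor j (toMul A) i)
    (t : MinTensor (MinTensor E A) A) :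
    homTensor (homTensor j (toMul A)) (toMul A) ((idTensor E Δ X).fst t) =
      idTensor B Δ X' * homTensor (homTensor j (toMul A)) (toMul A) t := by
  set κ := homTensor (homTensor j (toMul A)) (toMul A) with hκ
  have c1 := κ.continuous
  have hi : ∀ (i : MinTensor E A) (t : MinTensor (MinTensor E A) A),
      κ ((idTensor E Δ (toMul _ i)).fst t) =
        idTensor B Δ (homTensor j (toMul A) i) * κ t := fun i t => by
    have c2 := (idTensor B Δ).continuous
    have c3 := (homTensor j (toMul A)).continuous
    have c4 := continuous_fst_fst ((idTensor E Δ).comp (toMul _)) t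
    induction i using MinTensor.induction_tmul with
    | hc => exact isClosed_eq (c1.comp c4) (by fun_prop)
    | hadd x y hx hy =>
      rw [map_add, map_add, DoubleCentralizer.add_fst, add_apply, map_add, hx, hy, map_add,
        map_add, add_mul]
    | h s a =>
      rw [toMul_tmul, mulTmul_eq, map_mul, mul_fst_apply, idTensor_inl hΔ, idTensor_inr hΔ,
        homTensor_tmul, mulTmul_eq (j s), map_mul, idTensor_inl hΔ, idTensor_inr hΔ, mul_assoc,
        ← homTensor_mulInrAssoc_fst]
      refine homTensor_mulTmul_fst (homTensor_mulTmul_fst (fun _ => map_mul _ _ _) fun b => ?_)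
        (fun b => ?_) _
      · rw [one_mul, one_fst_apply]
      · rw [one_mul, one_fst_apply]
  have hsupp : HasSupport ((idTensor E Δ).comp (toMul _)) 1 :=
    HasSupport.congr_right (isNormal_idTensor E hΔ) rfl (idTensor_one E hΔ)
  have ht := hsupp.mem t
  rw [one_fst_apply] at ht
  refine eqOn_actionSpan (S := κ.toCLM.comp (idTensor E Δ X).fst)
    (T := (ContinuousLinearMap.mul ℂ _ (idTensor B Δ X')).comp κ.toCLM) (fun i t => ?_) ht
  change κ ((idTensor E Δ X).fst ((idTensor E Δ (toMul _ i)).fst t)) =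
    idTensor B Δ X' * κ ((idTensor E Δ (toMul _ i)).fst t)
  rw [← mul_fst_apply, ← map_mul, mul_toMul, hi, hi, hX, map_mul, mul_assoc]

/-- The embedding `j ⊗ id ⊗ id` intertwines `δ ⊗ id` and `Φ ⊗ id` if `j ⊗ id` intertwines `δ` and
`Φ`. -/
theorem homTensor_tensorId_fst {Φ : 𝓜(ℂ, B) →⋆ₙₐ[ℂ] 𝓜(ℂ, MinTensor B A)} (hΦ : IsNormal Φ)
    {j : E →⋆ₙₐ[ℂ] 𝓜(ℂ, B)} {δ : E →⋆ₙₐ[ℂ] 𝓜(ℂ, MinTensor E A)}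
    (hδ : ∀ s i, homTensor j (toMul A) ((δ s).fst i) = Φ (j s) * homTensor j (toMul A) i)
    (y : MinTensor E A) (t : MinTensor (MinTensor E A) A) :
    homTensor (homTensor j (toMul A)) (toMul A) ((tensorId δ y).fst t) =
      mulTensorId A Φ (homTensor j (toMul A) y) *
        homTensor (homTensor j (toMul A)) (toMul A) t := by
  have c1 := (homTensor (homTensor j (toMul A)) (toMul A)).continuous
  have c2 := continuous_fst_fst (tensorId δ) t
  have c3 := (homTensor j (toMul A)).continuous
  have c4 := (mulTensorId A Φ).continuous
  induction y using MinTensor.induction_tmul with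
  | hc => exact isClosed_eq (c1.comp c2) (by fun_prop)
  | hadd x y hx hy =>
    rw [map_add, DoubleCentralizer.add_fst, add_apply, map_add, hx, hy, map_add, map_add, add_mul]
  | h s b =>
    rw [tensorId, homTensor_tmul, homTensor_tmul, hΦ.mulTensorId_mulTmul]
    exact homTensor_mulTmul_fst (hδ s) (fun c => map_mul _ _ _) t

/-- If `Φ(j(E))(1 ⊗ A)` is contained in the image of `E ⊗ A`, then `Φ` restricts to `E`. -/
theorem exists_isRestriction {Φ : 𝓜(ℂ, B) →⋆ₙₐ[ℂ] 𝓜(ℂ, MinTensor B A)}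
    {j : E →⋆ₙₐ[ℂ] 𝓜(ℂ, B)} (hj : Function.Injective j)
    (h : ∀ s (a : A), Φ (j s) * mulTmul 1 (toMul A a) ∈ Set.range (homTensor j (toMul A))) :
    ∃ δ : E →⋆ₙₐ[ℂ] 𝓜(ℂ, MinTensor E A), IsRestriction Φ j δ ∧
      ∀ s i, homTensor j (toMul A) ((δ s).fst i) = Φ (j s) * homTensor j (toMul A) i := by
  set κ := homTensor j (toMul A) with hκdef
  have hκ : Function.Injective κ := homTensor_injective hj (toMul_injective A)
  have hΦκ : ∀ (s : E) (i : MinTensor E A), Φ (j s) * κ i ∈ Set.range κ := fun s i => by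
    have c1 := κ.continuous
    induction i using MinTensor.induction_tmul with
    | hc => exact (NonUnitalStarAlgHom.isClosed_range hκ).preimage (by fun_prop)
    | hadd x y hx hy => rw [map_add, mul_add]; exact add_mem_range _ hx hy
    | h s' a =>
      obtain ⟨x, hx⟩ := h s a
      rw [hκdef, homTensor_tmul, mulTmul_eq, mulTmul_comm, ← mul_assoc, ← hx]
      exact ⟨(mulTmul (toMul E s') 1).snd x, homTensor_mulTmul_snd (fun b => map_mul _ _ _)
        (fun b => by rw [mul_one]; rfl) x⟩
  obtain ⟨δ, hδ⟩ := exists_hom_multiplier (Φ.comp j) hκ hΦκ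
  have hδ' : ∀ s i, κ ((δ s).fst i) = Φ (j s) * κ i := hδ
  refine ⟨δ, fun s a => ?_, hδ'⟩
  obtain ⟨y, hy⟩ := h s a
  refine ⟨y, multiplier_ext fun i => hκ ?_, hy⟩
  rw [toMul_fst, map_mul, hy, mul_fst_apply, hδ', mul_assoc]
  congr 1
  exact (homTensor_mulTmul_fst (fun b => by rw [one_mul]; rfl) (fun b => map_mul _ _ _) i).symm

/-- The restriction of a coassociative map to `E` is a coaction: coassociativity is checked after
embedding `E ⊗ A ⊗ A` into `M(B ⊗ A ⊗ A)`. -/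
theorem IsRestriction.isCoaction (hΔ : HasSupport Δ 1)
    {Φ : 𝓜(ℂ, B) →⋆ₙₐ[ℂ] 𝓜(ℂ, MinTensor B A)} (hΦ : IsNormal Φ) (hΦ1 : Φ 1 = 1)
    (hco : ∀ x, mulTensorId A Φ (Φ x) = idTensor B Δ (Φ x))
    {j : E →⋆ₙₐ[ℂ] 𝓜(ℂ, B)} (hj : Function.Injective j)
    {δ : E →⋆ₙₐ[ℂ] 𝓜(ℂ, MinTensor E A)} (hres : IsRestriction Φ j δ)
    (hδ : ∀ s i, homTensor j (toMul A) ((δ s).fst i) = Φ (j s) * homTensor j (toMul A) i) :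
    IsCoaction Δ δ := by
  refine ⟨fun s a => ?_, fun s a y hy => ?_⟩
  · obtain ⟨y, hy, -⟩ := hres s a
    exact ⟨y, hy⟩
  · obtain ⟨y', hy', hκy⟩ := hres s a
    obtain rfl : y = y' := toMul_injective _ (hy.trans hy'.symm)
    refine multiplier_ext fun t => homTensor_injective
      (homTensor_injective hj (toMul_injective A)) (toMul_injective A) ?_
    rw [homTensor_tensorId_fst hΦ hδ, hκy, map_mul, hco, hΦ.mulTensorId_mulTmul, mul_fst_apply,
      homTensor_idTensor_fst hΔ j (hδ s), hΦ1, mul_assoc]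
    congr 1
    exact (homTensor_mulTmul_fst (fun b => by rw [one_mul]; rfl) (fun b => map_mul _ _ _) t).symm

/-- A partial coaction takes its values in `C ⊠ A` if it is regular. -/
theorem IsPartialCoaction.memBoxtimes {δ : C →⋆ₙₐ[ℂ] 𝓜(ℂ, MinTensor C A)}
    (hδ : IsPartialCoaction Δ δ) (hreg : IsRegularPartialCoaction Δ δ) (c : C) :
    MemBoxtimes Δ δ (δ c) := by
  have hδs := hδ.strict.hasSupport_unitImage
  exact
    { commute := by rw [hδs.mul_eq, hδs.mul_eq']
      left_eq := hδ.coassoc c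
      right_eq := by
        have := congrArg star (hδ.coassoc (star c))
        rwa [star_mul, star_mulTmul, star_one, hδs.star_eq, ← map_star, ← map_star, ← map_star,
          ← map_star, star_star] at this
      mul_mem := hδ.mul_mem c
      mem_mul := fun a => by
        have := star_mem_range _ (hδ.mul_mem (star c) (star a))
        rwa [star_mul, star_mulTmul, star_one, ← map_star, ← map_star, star_star,
          star_star] at this
      comul_mul_mem := hreg c
      mem_comul_mul := fun a => by
        have := star_mem_range _ (hreg (star c) (star a))
        rwa [star_mul, star_mulTmul, star_one, ← map_star, ← map_star, ← map_star, star_star,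
          star_star] at this }

/-- The embedding `δ ⊗ id` of `C ⊗ A` maps `δ(c)(c' ⊗ a)` to `(id ⊗ Δ)(δ(c))(δ(c') ⊗ a)`. -/
theorem IsPartialCoaction.tensorId_fst {δ : C →⋆ₙₐ[ℂ] 𝓜(ℂ, MinTensor C A)}
    (hδ : IsPartialCoaction Δ δ) (hreg : IsRegularPartialCoaction Δ δ) (c c' : C) (a : A) :
    tensorId δ ((δ c).fst (tmul c' a)) = idTensor C Δ (δ c) * mulTmul (δ c') (toMul A a) := by
  have hδs := hδ.strict.hasSupport_unitImage
  have hU : ∀ x, strictExt (tensorId δ) (toMul _ x) = tensorId δ x :=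
    (hδs.homTensor_toMul (A := A)).strictExt_toMul
  rw [← hU, ← mul_toMul, map_mul, hU, (hδ.memBoxtimes hreg c).right_eq, tensorId, homTensor_tmul,
    mul_assoc, mulTmul_mul, hδs.mul_eq, one_mul]

end Coaction

theorem proposition7p6 {A C : Type u} [NonUnitalCStarAlgebra A] [NonUnitalCStarAlgebra C]
    (Δ : A →⋆ₙₐ[ℂ] 𝓜(ℂ, MinTensor A A)) (hΔ : IsCStarBialgebra Δ)
    (δ : C →⋆ₙₐ[ℂ] 𝓜(ℂ, MinTensor C A)) (hδ : IsPartialCoaction Δ δ)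
    (hinj : Function.Injective δ) (hreg : IsRegularPartialCoaction Δ δ)
    (hA : SliceMapProperty A) :
    ∃ (S : NonUnitalStarSubalgebra ℂ 𝓜(ℂ, MinTensor C A))
      (_hS : IsClosed (S : Set 𝓜(ℂ, MinTensor C A))),
      (S : Set 𝓜(ℂ, MinTensor C A)) = boxtimes Δ δ ∧
      ∃ (δS : S →⋆ₙₐ[ℂ] 𝓜(ℂ, MinTensor S A)) (ι : C →⋆ₙₐ[ℂ] S),
        IsRestriction (idTensor C Δ) (NonUnitalStarSubalgebraClass.subtype S) δS ∧
        IsCoaction Δ δS ∧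
        (∀ c, (ι c : 𝓜(ℂ, MinTensor C A)) = δ c) ∧
        IsDilation Δ δ δS ι := by
  have hΔs : HasSupport Δ 1 := hΔ.nondegenerate.hasSupport
  have hδs := hδ.strict.hasSupport_unitImage
  let S := boxtimesSubalgebra Δ hδs
  have hmem : ∀ {x}, x ∈ S ↔ MemBoxtimes Δ δ x := Iff.rfl
  have hS : IsClosed (S : Set 𝓜(ℂ, MinTensor C A)) := isClosed_boxtimes Δ δ
  refine ⟨S, hS, rfl, ?_⟩
  have hj : Function.Injective (NonUnitalStarSubalgebraClass.subtype S) := Subtype.val_injective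
  obtain ⟨δS, hres, hδS⟩ := exists_isRestriction (Φ := idTensor C Δ) hj fun s a => by
    obtain ⟨y, hy⟩ := (hmem.mp s.2).comul_mul_mem a
    have h1 := mem_range_homTensor_subtype hA S (y := y) fun ω =>
      hmem.mpr ((hmem.mp s.2).slice_mem hΔs hΔ.coassoc hδs hy ω)
    exact hy ▸ h1
  have hcoact : IsCoaction Δ δS := hres.isCoaction hΔs (isNormal_idTensor C hΔs)
    (idTensor_one C hΔs) (idTensor_coassoc hΔs hΔ.coassoc) hj hδS
  let ι : C →⋆ₙₐ[ℂ] S := NonUnitalStarAlgHom.codRestrict δ S (hδ.memBoxtimes hreg)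
  refine ⟨δS, ι, hres, hcoact, fun c => rfl, hcoact,
    fun c c' h => hinj (congrArg Subtype.val h), fun c c' a =>
    homTensor_injective hj (toMul_injective A) ?_⟩
  rw [hδS, homTensor_map, homTensor_tmul]
  exact (hδ.tensorId_fst hreg c c' a).symm
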